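/- **Theorem 1.** Let $\rho(\theta)$, $\theta\in\Theta\subseteq\mathbb R^p$, be a once continuously differentiable family of $d\times d$ density matrices, let $\psi:\Theta\to\mathbb R^q$ be $C^1$ with $q\times p$ matrix of partial derivatives $\psi'$, and let $\widetilde G(\theta)$ be a (measurable) real symmetric positive-definite $q\times q$ matrix function. Let $\Theta_0\subseteq\Theta$ be compact (its boundary may be piecewise smooth, but no regularity of it is needed) and let $\pi$ be a probability density on $\Theta_0$ that is $C^1$ on $\Theta_0$ and zero on the boundary of $\Theta_0$. For a real symmetric $p\times p$ matrix $G$, the Holevo bound is $$\mathcal C_G(\theta)=\inf\{\operatorname{tr}(GV)\;:\;V \text{ real symmetric},\ V\ge Z(\vec X)\},\qquad Z(\vec X)_{ij}=\operatorname{tr}(\rho(\theta)X_iX_j),$$ where $\vec X=(X_1,\dots,X_p)$ ranges over the $p$-tuples of self-adjoint $d\times d$ matrices with $\frac{\partial}{\partial\theta_i}\operatorname{tr}(\rho(\theta)X_j)=\delta_{ij}$ at $\theta$. Assume that at each interior point $\theta$ of $\Theta_0$ such an $\vec X$ exists and that $G_0=\psi'^\top\widetilde G\psi'$ is positive definite there.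 Let $\mathcal V(\theta)$ be the set of real positive-definite $V$ with $\operatorname{tr}(GV)\ge\mathcal C_G(\theta)$ for all real positive-definite $G$, let $V_0(\theta)\in\mathcal V(\theta)$ be the element with $\operatorname{tr}(G_0V_0)=\mathcal C_{G_0}$, put $I_0=V_0^{-1}$ and $C=\widetilde G\psi'I_0^{-1}=\widetilde G\psi'V_0$. Assume that $C\pi$ is $C^1$ on $\Theta_0$ and that $$\mathcal J(\pi)=\mathbb E_\pi\frac{(C\pi)'^\top\,\widetilde G^{-1}\,(C\pi)'}{\pi^2}<\infty,\qquad (C\pi)'_i=\sum_j\frac{\partial}{\partial\theta_j}(C\pi)_{ij}.$$ For each $N$ let $M^{(N)}$ be any measurement (positive operator valued measure on any measurable outcome space) on the $N$-copy state $\rho(\theta)^{\otimes N}$, and let $\widehat\psi^{(N)}$ be any measurable $\mathbb R^q$-valued function of its outcome, whose law under $\theta$ is $B\mapsto\operatorname{tr}(\rho(\theta)^{\otimes N}M^{(N)}(B))$. Let $$R^{(N)}(\pi)=\mathbb E_\pi\mathbb E_\theta(\widehat\psi^{(N)}-\psi(\theta))^\top\widetilde G(\theta)(\widehat\psi^{(N)}-\psi(\theta))=\mathbb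 E_\pi\operatorname{tr}\widetilde G V^{(N)}\in[0,\infty]$$ be the Bayes risk, $V^{(N)}(\theta)$ being the mean square error matrix. Then $$\liminf_{N\to\infty}N\,R^{(N)}(\pi)\ \ge\ \mathbb E_\pi\mathcal C_{G_0},$$ and for every $N\ge1$ $$N\,R^{(N)}(\pi)\ \ge\ \mathbb E_\pi\mathcal C_{G_0}-\frac{\mathcal J(\pi)}N .$$ -/

import Mathlib

open MeasureTheory Filter Matrix
open scoped ENNReal Topology ComplexOrder

noncomputable section

/-- A density matrix: a non-negative self-adjoint complex matrix of trace one. -/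
structure DensityMatrix (n : Type*) [Fintype n] where
  /-- the underlying matrix -/
  mat : Matrix n n ℂ
  posSemidef : mat.PosSemidef
  trace_eq_one : mat.trace = 1

open scoped MatrixOrder Matrix.Norms.L2Operator in
theorem posSemidef_exists_factor {n : Type*} [Fintype n] {A : Matrix n n ℂ}
    (hA : A.PosSemidef) : ∃ B : Matrix n n ℂ, A = Bᴴ * B := by
  classical
  exact (CStarAlgebra.nonneg_iff_eq_star_mul_self).1 hA.nonneg

/-- The state `ρ ⊗ ⋯ ⊗ ρ` of `N` copies, as a matrix in the product basis of the `N`-fold tensor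
product, which is indexed by `Fin N → n`. -/
def DensityMatrix.tensorPow {n : Type*} [Fintype n] (ρ : DensityMatrix n) (N : ℕ) :
    DensityMatrix (Fin N → n) where
  mat := Matrix.of fun i j => ∏ k, ρ.mat (i k) (j k)
  posSemidef := by
    classical
    obtain ⟨B, hB⟩ := posSemidef_exists_factor ρ.posSemidef
    have h : (Matrix.of fun i j : Fin N → n => ∏ k, ρ.mat (i k) (j k)) =
        (Matrix.of fun i j : Fin N → n => ∏ k, B (i k) (j k))ᴴ *
          (Matrix.of fun i j : Fin N → n => ∏ k, B (i k) (j k)) := by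
      ext i j
      simp only [hB, Matrix.mul_apply, Matrix.conjTranspose_apply,
        Matrix.of_apply, star_prod, ← Finset.prod_mul_distrib]
      exact Fintype.prod_sum fun k a => star (B a (i k)) * B a (j k)
    rw [h]
    exact Matrix.posSemidef_conjTranspose_mul_self _
  trace_eq_one := by
    classical
    have h := ρ.trace_eq_one
    simp only [Matrix.trace, Matrix.diag_apply, Matrix.of_apply] at h ⊢
    rw [← Fintype.prod_sum (fun (_ : Fin N) a => ρ.mat a a), h]
    simp

/-- A measurement with outcomes in `X`: a positive operator valued measure, i.e. a `σ`-additive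
matrix-valued measure with positive semidefinite values and total mass the identity. -/
structure POVM (X : Type*) [MeasurableSpace X] (n : Type*) [Fintype n] [DecidableEq n] where
  /-- the underlying `σ`-additive matrix-valued measure -/
  measure : VectorMeasure X (Matrix n n ℂ)
  posSemidef : ∀ B, MeasurableSet B → (measure B).PosSemidef
  univ_eq_one : measure Set.univ = 1

theorem trace_mul_re_nonneg {n : Type*} [Fintype n] {A B : Matrix n n ℂ}
    (hA : A.PosSemidef) (hB : B.PosSemidef) : 0 ≤ (A * B).trace.re := by
  classical
  obtain ⟨C, hC⟩ := posSemidef_exists_factor hA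
  rw [hC, Matrix.mul_assoc, Matrix.trace_mul_comm]
  exact (Complex.nonneg_iff.1 (hB.mul_mul_conjTranspose_same C).trace_nonneg).1

/-- The Born law: the distribution of the outcome of the measurement `M` in the state `σ` gives
the mass `trace (σ M(B))` to each measurable set `B`. -/
def outcomeLaw {X : Type*} [MeasurableSpace X] {n : Type*} [Fintype n] [DecidableEq n]
    (σ : DensityMatrix n) (M : POVM X n) : Measure X :=
  Measure.ofMeasurable (fun B _ => ENNReal.ofReal (σ.mat * M.measure B).trace.re) (by simp) (by
    intro f hf hd
    have hs : HasSum (fun i => (σ.mat * M.measure (f i)).trace.re)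
        (σ.mat * M.measure (⋃ i, f i)).trace.re := by
      have hc : Continuous fun A : Matrix n n ℂ => (σ.mat * A).trace.re := by fun_prop
      exact (M.measure.hasSum_of_disjoint_iUnion hf hd).map
        (⟨⟨fun A : Matrix n n ℂ => (σ.mat * A).trace.re, by simp⟩,
          by intro A B; simp [Matrix.mul_add]⟩ : Matrix n n ℂ →+ ℝ) hc
    have h0 : ∀ i, 0 ≤ (σ.mat * M.measure (f i)).trace.re := fun i =>
      trace_mul_re_nonneg σ.posSemidef (M.posSemidef _ (hf i))
    exact hs.tsum_eq ▸ ENNReal.ofReal_tsum_of_nonneg h0 hs.summable)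

theorem outcomeLaw_apply {X : Type*} [MeasurableSpace X] {n : Type*} [Fintype n] [DecidableEq n]
    (σ : DensityMatrix n) (M : POVM X n) {B : Set X} (hB : MeasurableSet B) :
    outcomeLaw σ M B = ENNReal.ofReal (σ.mat * M.measure B).trace.re :=
  Measure.ofMeasurable_apply B hB

section Holevo

variable {p : ℕ} {n : Type*} [Fintype n]

/-- The constraints on `X = (X₁, …, X_p)` in the Holevo bound at the point `θ`: all `X_j` are
self-adjoint, and `∂/∂θ_i trace (ρ(θ) X_j) = δ_ij` at `θ`. -/
def IsLocallyUnbiased (ρ : (Fin p → ℝ) → DensityMatrix n) (θ : Fin p → ℝ)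
    (X : Fin p → Matrix n n ℂ) : Prop :=
  (∀ j, (X j).IsHermitian) ∧
    ∀ i j, fderiv ℝ (fun t => ((ρ t).mat * X j).trace.re) θ (Pi.single i 1) =
      if i = j then 1 else 0

/-- The `p × p` matrix `Z(X)` with entries `trace (ρ X_i X_j)`. -/
def holevoZ (σ : DensityMatrix n) (X : Fin p → Matrix n n ℂ) : Matrix (Fin p) (Fin p) ℂ :=
  Matrix.of fun i j => (σ.mat * X i * X j).trace

/-- The Holevo bound `𝒞_G(θ)`: the infimum of `trace (G V)` over all `X` satisfying the
constraints at `θ` and all real symmetric `V` with `V ≥ Z(X)`. -/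
def holevoBound (ρ : (Fin p → ℝ) → DensityMatrix n) (θ : Fin p → ℝ)
    (G : Matrix (Fin p) (Fin p) ℝ) : ℝ :=
  sInf {c : ℝ | ∃ (X : Fin p → Matrix n n ℂ) (V : Matrix (Fin p) (Fin p) ℝ),
    IsLocallyUnbiased ρ θ X ∧ V.IsSymm ∧
      (V.map (fun x : ℝ => (x : ℂ)) - holevoZ (ρ θ) X).PosSemidef ∧ c = (G * V).trace}

/-- The set `𝒱` of all real positive definite `V` with `trace (G V) ≥ 𝒞_G(θ)` for every real
positive definite `G`. -/
def holevoSet (ρ : (Fin p → ℝ) → DensityMatrix n) (θ : Fin p → ℝ) :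
    Set (Matrix (Fin p) (Fin p) ℝ) :=
  {V | V.PosDef ∧ ∀ G : Matrix (Fin p) (Fin p) ℝ, G.PosDef → holevoBound ρ θ G ≤ (G * V).trace}

/-- The element `V₀` of `𝒱` that achieves equality in the bound `trace (G V) ≥ 𝒞_G(θ)`. -/
def holevoOptimal (ρ : (Fin p → ℝ) → DensityMatrix n) (θ : Fin p → ℝ)
    (G : Matrix (Fin p) (Fin p) ℝ) : Matrix (Fin p) (Fin p) ℝ :=
  Classical.epsilon fun V => V ∈ holevoSet ρ θ ∧ (G * V).trace = holevoBound ρ θ G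

end Holevo

section Bayes

variable {p q : ℕ} {n : Type*} [Fintype n]

/-- The `q × p` matrix `ψ'` of partial derivatives `∂ψ_a/∂θ_i`. -/
def jacobian (ψ : (Fin p → ℝ) → Fin q → ℝ) (θ : Fin p → ℝ) : Matrix (Fin q) (Fin p) ℝ :=
  Matrix.of fun a i => fderiv ℝ (fun t => ψ t a) θ (Pi.single i 1)

/-- `G₀ = ψ'ᵀ G̃ ψ'`. -/
def lossPullback (ψ : (Fin p → ℝ) → Fin q → ℝ) (Gt : (Fin p → ℝ) → Matrix (Fin q) (Fin q) ℝ)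
    (θ : Fin p → ℝ) : Matrix (Fin p) (Fin p) ℝ :=
  (jacobian ψ θ)ᵀ * Gt θ * jacobian ψ θ

/-- The `q × p` matrix function `C = G̃ ψ' V₀`, where `V₀ = I₀⁻¹` is optimal for `G₀`. -/
def vanTreesC (ρ : (Fin p → ℝ) → DensityMatrix n) (ψ : (Fin p → ℝ) → Fin q → ℝ)
    (Gt : (Fin p → ℝ) → Matrix (Fin q) (Fin q) ℝ) (θ : Fin p → ℝ) :
    Matrix (Fin q) (Fin p) ℝ :=
  Gt θ * jacobian ψ θ * holevoOptimal ρ θ (lossPullback ψ Gt θ)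

/-- The prior distribution on `Θ₀` with Lebesgue density `π`. -/
def priorMeasure (Θ₀ : Set (Fin p → ℝ)) (π : (Fin p → ℝ) → ℝ) : Measure (Fin p → ℝ) :=
  (volume.restrict Θ₀).withDensity fun θ => ENNReal.ofReal (π θ)

/-- The vector `(Cπ)'` with components `∑_j ∂/∂θ_j (Cπ)_aj`. -/
def rowDivergence (C : (Fin p → ℝ) → Matrix (Fin q) (Fin p) ℝ) (π : (Fin p → ℝ) → ℝ)
    (θ : Fin p → ℝ) : Fin q → ℝ :=
  fun a => ∑ j, fderiv ℝ (fun t => C t a j * π t) θ (Pi.single j 1)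

/-- The information in the prior, `𝒥(π) = E_π [(Cπ)'ᵀ G̃⁻¹ (Cπ)' / π²]` with `C = G̃ ψ' V₀`. -/
def priorInformation (ρ : (Fin p → ℝ) → DensityMatrix n) (ψ : (Fin p → ℝ) → Fin q → ℝ)
    (Gt : (Fin p → ℝ) → Matrix (Fin q) (Fin q) ℝ) (Θ₀ : Set (Fin p → ℝ))
    (π : (Fin p → ℝ) → ℝ) : ℝ≥0∞ :=
  ∫⁻ θ, ENNReal.ofReal
    ((rowDivergence (vanTreesC ρ ψ Gt) π θ ⬝ᵥ
      ((Gt θ)⁻¹ *ᵥ rowDivergence (vanTreesC ρ ψ Gt) π θ)) / π θ ^ 2) ∂(priorMeasure Θ₀ π)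

/-- The Bayes risk `R^{(N)}(π)` of the estimator `est` of `ψ(θ)` based on the outcome of the joint
measurement `M` on `N` copies of the state `ρ(θ)`, for the quadratic loss given by `G̃`. -/
def bayesRisk [DecidableEq n] {X : Type*} [MeasurableSpace X]
    (ρ : (Fin p → ℝ) → DensityMatrix n) (ψ : (Fin p → ℝ) → Fin q → ℝ)
    (Gt : (Fin p → ℝ) → Matrix (Fin q) (Fin q) ℝ) (Θ₀ : Set (Fin p → ℝ))
    (π : (Fin p → ℝ) → ℝ) (N : ℕ) (M : POVM X (Fin N → n)) (est : X → Fin q → ℝ) : ℝ≥0∞ :=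
  ∫⁻ θ, ∫⁻ x, ENNReal.ofReal ((est x - ψ θ) ⬝ᵥ (Gt θ *ᵥ (est x - ψ θ)))
    ∂(outcomeLaw ((ρ θ).tensorPow N) M) ∂(priorMeasure Θ₀ π)

/-- `E_π 𝒞_{G₀}`, the prior expectation of the Holevo bound. -/
def expectedHolevo (ρ : (Fin p → ℝ) → DensityMatrix n) (ψ : (Fin p → ℝ) → Fin q → ℝ)
    (Gt : (Fin p → ℝ) → Matrix (Fin q) (Fin q) ℝ) (Θ₀ : Set (Fin p → ℝ))
    (π : (Fin p → ℝ) → ℝ) : ℝ≥0∞ :=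
  ∫⁻ θ, ENNReal.ofReal (holevoBound ρ θ (lossPullback ψ Gt θ)) ∂(priorMeasure Θ₀ π)

end Bayes

end

/-! The proof is a van Trees inequality in which the Cramér–Rao step is replaced by a
supporting-hyperplane inequality for the Holevo bound.

Fix `θ`. An operator `S` on `N` copies has a one-copy reduction `oneCopy`: the sum over the slots of
its partial traces against `ρ` in the other slots. By the Leibniz rule `∂_i tr(ρ^{⊗N} S) = tr(∂_iρ ·
oneCopy S)` (`fderiv_trace_piTensor_mul_re`), and for centred `S` the second moment of the reduction
is at most `N` times that of `S` (`re_trace_oneCopy_sq_le`). With the Schwarz inequality for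
measurements, the reductions `Y` of the centred errors of an estimator satisfy `Z(Y) ≤ N Cov`
(`zLe_oneCopy_momentMatrix`). A joint measurement, however entangled, is thus controlled by a tuple
of one-copy observables with some mean derivative `F`.

This tuple is not locally unbiased in general. Optimality of `V₀` still gives `2 tr(Fᵀ C) ≤ tr(G̃ V)
+ 𝒞_{G₀}` for every real symmetric `V ≥ Z(Y)` (`two_mul_trace_le_of_optimal_pullback`): mix a nearly
optimal unbiased tuple with a small proportion `t` of `Y`, rescale to restore unbiasedness, and take
the first-order term at `t = 0`. Put `V = N Cov = N (MSE - g gᵀ)` with `g` the mean error. The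
negative term is absorbed by `2 g·δ ≤ N gᵀ G̃ g + δᵀ G̃⁻¹ δ / N` with `δ = (Cπ)'/π`.

Multiply by `π` and integrate. Since `∂_j g_a = F_aj - ψ'_aj` and the divergence of `g Cπ`
integrates to zero, the terms `g·(Cπ)' + F:(Cπ)` integrate to `∫ ψ':(Cπ) = E_π 𝒞_{G₀}`. Hence `2 E_π
𝒞 ≤ N R + 𝒥/N + E_π 𝒞`, which is the finite `N` bound; the limit follows.

Three technical points remain. The integral of the divergence vanishes without regularity of the
boundary, because the extension by zero is Lipschitz. The optimal `V₀` exists and is positive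
definite, by compactness and a Cramér–Rao bound. Unbounded estimators are cut off to sets of
outcomes where they are bounded, and the cut-off is then removed. -/

noncomputable section

/-! ### Integration by parts on a compact set with arbitrary boundary. -/

section Analysis

variable {E : Type*} [NormedAddCommGroup E] [NormedSpace ℝ E]

/-- Near each point of `K`, `ContDiffOn` supplies some derivative field, continuous at that point
and hence locally bounded. At interior points it must agree with `fderiv`, and compactness makes the
bound uniform. -/
theorem IsCompact.exists_bound_fderiv_interior {F : Type*} [NormedAddCommGroup F] [NormedSpace ℝ F]
    {K : Set E} (hK : IsCompact K) {f : E → F} (hf : ContDiffOn ℝ 1 f K) :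
    ∃ C : ℝ, 0 ≤ C ∧ ∀ x ∈ interior K, ‖fderiv ℝ f x‖ ≤ C := by
  have key : ∀ x ∈ K, ∃ t ∈ 𝓝[K] x, ∃ C : ℝ, ∀ y ∈ t ∩ interior K, ‖fderiv ℝ f y‖ ≤ C := by
    intro x hx
    have h1 : ContDiffWithinAt ℝ (0 + 1) f K x := by simpa using hf x hx
    obtain ⟨u, hu, -, f', hf', hc⟩ :=
      (contDiffWithinAt_succ_iff_hasFDerivWithinAt (by simp)).1 h1
    rw [Set.insert_eq_of_mem hx] at hu
    have hxu : x ∈ u := mem_of_mem_nhdsWithin hx hu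
    have hc' : ContinuousWithinAt (fun y => ‖f' y‖) u x := hc.continuousWithinAt.norm
    have hb : ∀ᶠ y in 𝓝[u] x, ‖f' y‖ < ‖f' x‖ + 1 := hc'.eventually (gt_mem_nhds (by linarith))
    obtain ⟨O, hO, hxO, hOu⟩ := mem_nhdsWithin.1 hu
    obtain ⟨O', hO', hxO', hOu'⟩ := mem_nhdsWithin.1 hb
    refine ⟨O ∩ O', mem_nhdsWithin_of_mem_nhds ((hO.inter hO').mem_nhds ⟨hxO, hxO'⟩),
      ‖f' x‖ + 1, ?_⟩
    rintro y ⟨⟨hyO, hyO'⟩, hyK⟩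
    have hyu : y ∈ u := hOu ⟨hyO, interior_subset hyK⟩
    have hn : u ∈ 𝓝 y := by
      filter_upwards [hO.mem_nhds hyO, isOpen_interior.mem_nhds hyK] with z hz hz'
      exact hOu ⟨hz, interior_subset hz'⟩
    rw [((hf' y hyu).hasFDerivAt hn).fderiv]
    exact (hOu' ⟨hyO', hyu⟩).le
  have := hK.induction_on (p := fun s => ∃ C : ℝ, ∀ y ∈ s ∩ interior K, ‖fderiv ℝ f y‖ ≤ C)
    ⟨0, by simp⟩ (fun s t hst ⟨C, hC⟩ => ⟨C, fun y hy => hC y ⟨hst hy.1, hy.2⟩⟩)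
    (fun s t ⟨C, hC⟩ ⟨D, hD⟩ => ⟨max C D, fun y hy => by
      rcases hy.1 with h | h
      · exact (hC y ⟨h, hy.2⟩).trans (le_max_left _ _)
      · exact (hD y ⟨h, hy.2⟩).trans (le_max_right _ _)⟩)
    key
  obtain ⟨C, hC⟩ := this
  exact ⟨max C 0, le_max_right _ _, fun x hx =>
    (hC x ⟨interior_subset hx, hx⟩).trans (le_max_left _ _)⟩

/-- Follow the segment from `x` to its first exit from the interior. The exit point lies on the
frontier, where `f` vanishes, and the mean value inequality holds on every shorter piece; continuity
of `f` on `K` gives the limit. -/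
theorem norm_le_of_segment_not_subset_interior {K : Set E} (hK : IsClosed K) {f : E → ℝ}
    (hf : ContinuousOn f K) (hd : ∀ x ∈ interior K, DifferentiableAt ℝ f x)
    (hz : ∀ x ∈ frontier K, f x = 0) {C : ℝ} (hC0 : 0 ≤ C)
    (hC : ∀ x ∈ interior K, ‖fderiv ℝ f x‖ ≤ C) {x y : E} (hx : x ∈ interior K)
    (hxy : ¬ segment ℝ x y ⊆ interior K) : ‖f x‖ ≤ C * ‖x - y‖ := by
  set γ : ℝ → E := fun t => AffineMap.lineMap (k := ℝ) x y t with hγ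
  have hγc : Continuous γ := AffineMap.lineMap_continuous
  set S : Set ℝ := Set.Icc 0 1 ∩ γ ⁻¹' (interior K)ᶜ with hS
  have hSc : IsCompact S :=
    isCompact_Icc.inter_right (isOpen_interior.isClosed_compl.preimage hγc)
  have hSn : S.Nonempty := by
    obtain ⟨z, hz1, hz2⟩ := Set.not_subset.1 hxy
    rw [segment_eq_image_lineMap] at hz1
    obtain ⟨t, ht, rfl⟩ := hz1
    exact ⟨t, ht, hz2⟩
  obtain ⟨t₀, ht₀, hmin⟩ := hSc.exists_isLeast hSn
  have ht0 : 0 < t₀ := by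
    rcases ht₀.1.1.eq_or_lt with h | h
    · exfalso
      apply ht₀.2
      rw [← h]
      simpa [hγ] using hx
    · exact h
  have hin : ∀ t, 0 ≤ t → t < t₀ → γ t ∈ interior K := by
    intro t h0 h1
    by_contra h
    exact absurd (hmin ⟨⟨h0, h1.le.trans ht₀.1.2⟩, h⟩) (not_le.2 h1)
  have hKin : γ t₀ ∈ K := by
    have h1 : Tendsto γ (𝓝[<] t₀) (𝓝 (γ t₀)) := hγc.continuousAt.tendsto.mono_left inf_le_left
    refine hK.mem_of_tendsto h1 ?_
    filter_upwards [Ioo_mem_nhdsLT ht0] with t ht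
    exact interior_subset (hin t ht.1.le ht.2)
  have hfz : f (γ t₀) = 0 := hz _ ⟨subset_closure hKin, ht₀.2⟩
  have hb : ∀ t ∈ Set.Ioo 0 t₀, ‖f x - f (γ t)‖ ≤ C * ‖x - y‖ := by
    intro t ht
    have hsub : segment ℝ x (γ t) ⊆ interior K := by
      intro z hz
      rw [segment_eq_image_lineMap] at hz
      obtain ⟨s, hs, rfl⟩ := hz
      have : AffineMap.lineMap x (γ t) s = γ (s * t) := by
        simp only [hγ, AffineMap.lineMap_apply_module']
        rw [add_sub_cancel_right, smul_smul]
      rw [this]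
      refine hin _ (mul_nonneg hs.1 ht.1.le) ?_
      nlinarith [hs.1, hs.2, ht.1, ht.2]
    have h := (convex_segment x (γ t)).norm_image_sub_le_of_norm_fderiv_le (𝕜 := ℝ)
      (fun z hz => hd z (hsub hz)) (fun z hz => hC z (hsub hz))
      (right_mem_segment ℝ x (γ t)) (left_mem_segment ℝ x (γ t))
    refine h.trans (mul_le_mul_of_nonneg_left ?_ hC0)
    have : x - γ t = t • (x - y) := by
      simp only [hγ, AffineMap.lineMap_apply_module']
      rw [← neg_sub x y, smul_neg]
      abel
    rw [this, norm_smul, Real.norm_of_nonneg ht.1.le]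
    have : t ≤ 1 := ht.2.le.trans ht₀.1.2
    nlinarith [norm_nonneg (x - y)]
  have hlim : Tendsto (fun t => ‖f x - f (γ t)‖) (𝓝[<] t₀) (𝓝 ‖f x - f (γ t₀)‖) := by
    refine (tendsto_const_nhds.sub ?_).norm
    have h2 : Tendsto γ (𝓝[<] t₀) (𝓝[K] (γ t₀)) := by
      refine tendsto_nhdsWithin_iff.2 ⟨hγc.continuousAt.tendsto.mono_left inf_le_left, ?_⟩
      filter_upwards [Ioo_mem_nhdsLT ht0] with t ht
      exact interior_subset (hin t ht.1.le ht.2)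
    exact (hf _ hKin).tendsto.comp h2
  rw [hfz, sub_zero] at hlim
  refine le_of_tendsto hlim ?_
  filter_upwards [Ioo_mem_nhdsLT ht0] with t ht using hb t ht

/-- The factor 2 serves two interior points whose segment leaves the interior: each value is then at
most `C * ‖x - y‖` on its own. -/
theorem lipschitzWith_indicator_interior {K : Set E} (hK : IsClosed K) {f : E → ℝ}
    (hf : ContinuousOn f K) (hd : ∀ x ∈ interior K, DifferentiableAt ℝ f x)
    (hz : ∀ x ∈ frontier K, f x = 0) {C : ℝ} (hC0 : 0 ≤ C)
    (hC : ∀ x ∈ interior K, ‖fderiv ℝ f x‖ ≤ C) :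
    LipschitzWith (Real.toNNReal (2 * C)) ((interior K).indicator f) := by
  have key : ∀ x y, x ∈ interior K →
      ‖(interior K).indicator f x - (interior K).indicator f y‖ ≤ 2 * C * ‖x - y‖ := by
    intro x y hx
    by_cases hxy : segment ℝ x y ⊆ interior K
    · rw [Set.indicator_of_mem hx, Set.indicator_of_mem (hxy (right_mem_segment ℝ x y))]
      have h := (convex_segment x y).norm_image_sub_le_of_norm_fderiv_le (𝕜 := ℝ)
        (fun z hz => hd z (hxy hz)) (fun z hz => hC z (hxy hz))
        (right_mem_segment ℝ x y) (left_mem_segment ℝ x y)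
      nlinarith [mul_nonneg hC0 (norm_nonneg (x - y))]
    · have h1 := norm_le_of_segment_not_subset_interior hK hf hd hz hC0 hC hx hxy
      rw [Set.indicator_of_mem hx]
      by_cases hy : y ∈ interior K
      · rw [segment_symm] at hxy
        have h2 := norm_le_of_segment_not_subset_interior hK hf hd hz hC0 hC hy hxy
        rw [Set.indicator_of_mem hy]
        rw [norm_sub_rev y x] at h2
        linarith [norm_sub_le (f x) (f y)]
      · rw [Set.indicator_of_notMem hy, sub_zero]
        nlinarith [mul_nonneg hC0 (norm_nonneg (x - y))]
  refine LipschitzWith.of_dist_le_mul fun x y => ?_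
  rw [Real.coe_toNNReal _ (by positivity), dist_eq_norm, dist_eq_norm]
  by_cases hx : x ∈ interior K
  · exact key x y hx
  · by_cases hy : y ∈ interior K
    · rw [norm_sub_rev, norm_sub_rev x y]
      exact key y x hy
    · rw [Set.indicator_of_notMem hx, Set.indicator_of_notMem hy, sub_zero, norm_zero]
      positivity

variable [FiniteDimensional ℝ E] [MeasurableSpace E] [BorelSpace E] (μ : Measure E)
  [μ.IsAddHaarMeasure]

/-- The derivative of a function vanishes almost everywhere on its zero set. -/
theorem ae_fderiv_eq_zero_of_eq_zero {f : E → ℝ} {s : Set E} (hs : MeasurableSet s)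
    (hz : ∀ x ∈ s, f x = 0) :
    ∀ᵐ x ∂μ, x ∈ s → DifferentiableAt ℝ f x → fderiv ℝ f x = 0 := by
  rcases subsingleton_or_nontrivial E with hE | hE
  · refine Eventually.of_forall fun x _ _ => ?_
    ext v
    rw [Subsingleton.elim v 0]
    simp
  obtain ⟨v, hv⟩ := exists_ne (0 : E)
  set s' : Set E := s ∩ {x | DifferentiableAt ℝ f x} with hs'
  have hms : MeasurableSet s' := hs.inter (measurableSet_of_differentiableAt ℝ f)
  -- On `s'` the function is exactly zero, so it is approximated by the zero map with constant 0,
  -- and at almost every point the derivative must agree with that map. The estimate used is for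
  -- maps from `E` to `E`, hence the factor `v`.
  have hg : ApproximatesLinearOn (fun x => f x • v) (0 : E →L[ℝ] E) s' 0 := by
    intro x hx y hy
    simp [hz x hx.1, hz y hy.1]
  have h := hg.norm_fderiv_sub_le μ hms (fun x => (fderiv ℝ f x).smulRight v)
    (fun x hx => (hx.2.hasFDerivAt.smul_const v).hasFDerivWithinAt)
  rw [ae_restrict_iff' hms] at h
  filter_upwards [h] with x hx h1 h2
  have h3 := hx ⟨h1, h2⟩
  rw [sub_zero, nonpos_iff_eq_zero, nnnorm_eq_zero] at h3
  ext w
  have h4 := DFunLike.congr_fun h3 w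
  simpa [hv] using h4

/-- The integral of a directional derivative of a `C¹` function on a compact set which vanishes on
the boundary is zero. No regularity of the boundary is needed. -/
theorem setIntegral_fderiv_eq_zero_of_frontier {K : Set E} (hK : IsCompact K) {f : E → ℝ}
    (hf : ContDiffOn ℝ 1 f K) (hz : ∀ x ∈ frontier K, f x = 0) (v : E) :
    ∫ x in interior K, fderiv ℝ f x v ∂μ = 0 := by
  obtain ⟨C, hC0, hC⟩ := hK.exists_bound_fderiv_interior hf
  have hd : ∀ x ∈ interior K, DifferentiableAt ℝ f x := fun x hx =>
    ((hf x (interior_subset hx)).contDiffAt (mem_interior_iff_mem_nhds.1 hx)).differentiableAt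
      (by simp)
  have hL := lipschitzWith_indicator_interior hK.isClosed hf.continuousOn hd hz hC0 hC
  have hcs : HasCompactSupport ((interior K).indicator f) :=
    HasCompactSupport.intro hK fun x hx =>
      Set.indicator_of_notMem (fun h => hx (interior_subset h)) f
  -- Integration by parts against the constant 1; the formula reverses the direction, so it is
  -- applied to `-v`.
  have h1 := (LipschitzWith.const (1 : ℝ) (α := E)).integral_lineDeriv_mul_eq (μ := μ) hL hcs (-v)
  -- The frontier may have positive measure. The extension is zero off the interior, so its
  -- derivative vanishes almost everywhere there.
  have h2 : (fun x => lineDeriv ℝ ((interior K).indicator f) x v) =ᵐ[μ]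
      (interior K).indicator fun x => fderiv ℝ f x v := by
    filter_upwards [hL.ae_differentiableAt (μ := μ), ae_fderiv_eq_zero_of_eq_zero μ
      (f := (interior K).indicator f) (s := (interior K)ᶜ) isOpen_interior.measurableSet.compl
      (fun x hx => Set.indicator_of_notMem hx f)] with x hx hx'
    rw [hx.lineDeriv_eq_fderiv]
    by_cases hxK : x ∈ interior K
    · rw [Set.indicator_of_mem hxK, Filter.EventuallyEq.fderiv_eq (f₁ := f)]
      filter_upwards [isOpen_interior.mem_nhds hxK] with y hy
      rw [Set.indicator_of_mem hy]
    · rw [Set.indicator_of_notMem hxK, hx' hxK hx]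
      simp
  rw [← integral_indicator isOpen_interior.measurableSet, ← integral_congr_ae h2]
  have h3 : ∀ x : E, lineDeriv ℝ (fun _ : E => (1 : ℝ)) x (-v) = 0 := fun x => by
    simp [lineDeriv]
  simpa [h3] using h1.symm

end Analysis

/-! ### Densities of measurements and operator-valued integrals. -/

section POVMIntegral

variable {X : Type*} [MeasurableSpace X] {n : Type*} [Fintype n]

/-- The sum of the total variations of all real and imaginary parts dominates each of them, so
Radon–Nikodym applies simultaneously. -/
theorem MeasureTheory.ComplexMeasure.exists_density {ι : Type*} [Finite ι]
    (c : ι → ComplexMeasure X) :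
    ∃ (μ : Measure X) (h : ι → X → ℂ), IsFiniteMeasure μ ∧ (∀ i, Integrable (h i) μ) ∧
      ∀ i B, MeasurableSet B → c i B = ∫ x in B, h i x ∂μ := by
  have := Fintype.ofFinite ι
  set μ : Measure X := ∑ i, ((c i).re.totalVariation + (c i).im.totalVariation) with hμ
  have hfin : IsFiniteMeasure μ := by rw [hμ]; infer_instance
  have hle : ∀ i, (c i).re.totalVariation + (c i).im.totalVariation ≤ μ := fun i => by
    rw [hμ, ← Measure.sum_fintype]
    exact Measure.le_sum _ i
  have hac : ∀ s : SignedMeasure X, s.totalVariation ≤ μ →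
      μ.withDensityᵥ (s.rnDeriv μ) = s := fun s hs => by
    apply SignedMeasure.withDensityᵥ_rnDeriv_eq
    rw [SignedMeasure.absolutelyContinuous_ennreal_iff]
    refine Measure.AbsolutelyContinuous.mk fun S hS hS0 => ?_
    rw [VectorMeasure.ennrealToMeasure_apply hS,
      Measure.toENNRealVectorMeasure_apply_measurable hS] at hS0
    exact le_antisymm ((hs S).trans_eq hS0) zero_le
  refine ⟨μ, fun i x => ((c i).re.rnDeriv μ x : ℂ) + ((c i).im.rnDeriv μ x : ℂ) * Complex.I,
    hfin, fun i => ?_, fun i B hB => ?_⟩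
  · exact (SignedMeasure.integrable_rnDeriv _ _).ofReal.add
      ((SignedMeasure.integrable_rnDeriv _ _).ofReal.mul_const _)
  · have h1 := hac (c i).re (le_trans (Measure.le_add_right le_rfl) (hle i))
    have h2 := hac (c i).im (le_trans (Measure.le_add_left le_rfl) (hle i))
    have i1 := SignedMeasure.integrable_rnDeriv (c i).re μ
    have i2 := SignedMeasure.integrable_rnDeriv (c i).im μ
    have e1 : ∫ x in B, (c i).re.rnDeriv μ x ∂μ = (c i B).re := by
      rw [← withDensityᵥ_apply i1 hB, h1]; rfl
    have e2 : ∫ x in B, (c i).im.rnDeriv μ x ∂μ = (c i B).im := by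
      rw [← withDensityᵥ_apply i2 hB, h2]; rfl
    rw [integral_add i1.integrableOn.ofReal (i2.integrableOn.ofReal.mul_const _),
      integral_mul_const, integral_complex_ofReal, integral_complex_ofReal, e1, e2,
      Complex.re_add_im]

theorem integrable_linearMap_of {μ : Measure X} {h : X → n → n → ℂ}
    (hi : Integrable h μ) (L : Matrix n n ℂ →ₗ[ℝ] ℝ) :
    Integrable (fun x => L (Matrix.of (h x))) μ :=
  (LinearMap.toContinuousLinearMap
    (L ∘ₗ (Matrix.ofLinearEquiv ℝ : (n → n → ℂ) ≃ₗ[ℝ] _).toLinearMap)).integrable_comp hi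

theorem integral_linearMap_of {μ : Measure X} {h : X → n → n → ℂ}
    (hi : Integrable h μ) (L : Matrix n n ℂ →ₗ[ℝ] ℝ) :
    ∫ x, L (Matrix.of (h x)) ∂μ = L (Matrix.of fun i j => ∫ x, h x i j ∂μ) := by
  have h1 := (LinearMap.toContinuousLinearMap
    (L ∘ₗ (Matrix.ofLinearEquiv ℝ : (n → n → ℂ) ≃ₗ[ℝ] _).toLinearMap)).integral_comp_comm hi
  have h2 : ∫ x, h x ∂μ = fun i j => ∫ x, h x i j ∂μ := by
    ext i j
    rw [eval_integral fun i => hi.eval i, eval_integral fun j => (hi.eval i).eval j]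
  rw [h2] at h1
  exact h1

/-- The functional `A ↦ Re trace (B A C)`. -/
def reTrace (B C : Matrix n n ℂ) : Matrix n n ℂ →ₗ[ℝ] ℝ where
  toFun A := (B * A * C).trace.re
  map_add' A A' := by simp [Matrix.mul_add, Matrix.add_mul]
  map_smul' r A := by simp

theorem reTrace_apply (B C A : Matrix n n ℂ) : reTrace B C A = (B * A * C).trace.re := rfl

theorem posSemidef_of_re_nonneg {A : Matrix n n ℂ} (hA : ∀ i j, A i j = star (A j i))
    (h : ∀ v : n → ℂ, 0 ≤ (star v ⬝ᵥ (A *ᵥ v)).re) : A.PosSemidef := by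
  have hH : A.IsHermitian := by
    ext i j
    rw [Matrix.conjTranspose_apply, hA i j]
  refine Matrix.PosSemidef.of_dotProduct_mulVec_nonneg hH fun v => ?_
  rw [Complex.nonneg_iff]
  exact ⟨h v, (hH.im_star_dotProduct_mulVec_self v).symm⟩

variable [DecidableEq n]

/-- The `(i, j)` entry of a POVM, as a complex measure. -/
def POVM.entry (M : POVM X n) (i j : n) : ComplexMeasure X :=
  M.measure.mapRange (Matrix.entryAddMonoidHom ℂ i j)
    (by exact (continuous_id.matrix_elem i j))

theorem POVM.entry_apply (M : POVM X n) (i j : n) (B : Set X) :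
    M.entry i j B = M.measure B i j := rfl

theorem POVM.exists_density (M : POVM X n) :
    ∃ (μ : Measure X) (h : X → n → n → ℂ), IsFiniteMeasure μ ∧ Integrable h μ ∧
      (∀ B, MeasurableSet B → ∀ i j, M.measure B i j = ∫ x in B, h x i j ∂μ) := by
  obtain ⟨μ, h, hfin, hint, hB⟩ :=
    ComplexMeasure.exists_density (fun ij : n × n => M.entry ij.1 ij.2)
  exact ⟨μ, fun x i j => h (i, j) x, hfin,
    Integrable.of_eval fun i => Integrable.of_eval fun j => hint (i, j),
    fun B hBm i j => by rw [← hB _ B hBm, POVM.entry_apply]⟩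

/-- For a fixed vector, the quadratic form of the density has nonnegative integral over every
measurable set, so it is nonnegative almost everywhere. A countable dense set of vectors and
continuity make the null set independent of the vector. -/
theorem POVM.ae_posSemidef (M : POVM X n) {μ : Measure X} [IsFiniteMeasure μ]
    {h : X → n → n → ℂ} (hi : Integrable h μ)
    (hB : ∀ B, MeasurableSet B → ∀ i j, M.measure B i j = ∫ x in B, h x i j ∂μ) :
    ∀ᵐ x ∂μ, (Matrix.of (h x)).PosSemidef := by
  have hherm : ∀ i j, ∀ᵐ x ∂μ, h x i j = star (h x j i) := by
    intro i j
    have hiij : ∀ i j, Integrable (fun x => h x i j) μ := fun i j => (hi.eval i).eval j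
    refine Integrable.ae_eq_of_forall_setIntegral_eq _ _ (hiij i j)
      ((Complex.conjCLE : ℂ →L[ℝ] ℂ).integrable_comp (hiij j i)) fun B hBm _ => ?_
    rw [← hB B hBm]
    have h2 := (Complex.conjCLE : ℂ →L[ℝ] ℂ).integral_comp_comm (μ := μ.restrict B)
      (hiij j i).integrableOn
    refine Eq.trans ?_ h2.symm
    rw [← hB B hBm]
    exact ((M.posSemidef B hBm).1.apply i j).symm
  have hquad : ∀ v : n → ℂ, ∀ᵐ x ∂μ, 0 ≤ (star v ⬝ᵥ (Matrix.of (h x) *ᵥ v)).re := by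
    intro v
    let L : Matrix n n ℂ →ₗ[ℝ] ℝ :=
      { toFun := fun A => (star v ⬝ᵥ (A *ᵥ v)).re
        map_add' := fun A B => by simp [Matrix.add_mulVec]
        map_smul' := fun r A => by simp [Matrix.smul_mulVec] }
    refine ae_nonneg_of_forall_setIntegral_nonneg (integrable_linearMap_of hi L)
      fun B hBm _ => ?_
    refine le_of_le_of_eq ?_ (integral_linearMap_of hi.integrableOn L).symm
    have h1 : (Matrix.of fun i j => ∫ x in B, h x i j ∂μ) = M.measure B := by
      ext i j
      exact (hB B hBm i j).symm
    rw [h1]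
    exact (Complex.nonneg_iff.1 ((M.posSemidef B hBm).dotProduct_mulVec_nonneg v)).1
  have hall := ae_all_iff.2 fun i => ae_all_iff.2 fun j => hherm i j
  have hdense := ae_all_iff.2 fun k : ℕ => hquad (TopologicalSpace.denseSeq (n → ℂ) k)
  filter_upwards [hall, hdense] with x hx hx'
  refine posSemidef_of_re_nonneg hx fun v => ?_
  have hcl : IsClosed {v : n → ℂ | 0 ≤ (star v ⬝ᵥ (Matrix.of (h x) *ᵥ v)).re} := by
    refine isClosed_le continuous_const ?_
    have : Continuous fun v : n → ℂ => star v ⬝ᵥ (Matrix.of (h x) *ᵥ v) := by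
      unfold dotProduct mulVec dotProduct
      fun_prop
    fun_prop
  exact hcl.closure_subset_iff.2 (Set.range_subset_iff.2 hx')
    ((TopologicalSpace.denseRange_denseSeq (n → ℂ)) v)

/-- A finite measure dominating a POVM. -/
def POVM.baseMeasure (M : POVM X n) : Measure X := M.exists_density.choose

/-- The density of a POVM with respect to its base measure. -/
def POVM.density (M : POVM X n) : X → n → n → ℂ := M.exists_density.choose_spec.choose

instance POVM.isFiniteMeasure_baseMeasure (M : POVM X n) : IsFiniteMeasure M.baseMeasure :=
  M.exists_density.choose_spec.choose_spec.1

theorem POVM.integrable_density (M : POVM X n) : Integrable M.density M.baseMeasure :=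
  M.exists_density.choose_spec.choose_spec.2.1

theorem POVM.measure_eq_setIntegral (M : POVM X n) {B : Set X} (hB : MeasurableSet B) (i j : n) :
    M.measure B i j = ∫ x in B, M.density x i j ∂M.baseMeasure :=
  M.exists_density.choose_spec.choose_spec.2.2 B hB i j

theorem POVM.ae_posSemidef_density (M : POVM X n) :
    ∀ᵐ x ∂M.baseMeasure, (Matrix.of (M.density x)).PosSemidef :=
  M.ae_posSemidef M.integrable_density fun _ hB => M.measure_eq_setIntegral hB

/-- The operator `∫ f dM`. -/
def POVM.integral (M : POVM X n) (f : X → ℂ) : Matrix n n ℂ :=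
  Matrix.of fun i j => ∫ x, f x * M.density x i j ∂M.baseMeasure

/-- A bounded measurable function. -/
structure BddMeasurable (f : X → ℂ) : Prop where
  measurable : Measurable f
  bound : ∃ C, ∀ x, ‖f x‖ ≤ C

theorem BddMeasurable.const (c : ℂ) : BddMeasurable (fun _ : X => c) :=
  ⟨measurable_const, ‖c‖, fun _ => le_rfl⟩

theorem BddMeasurable.mul {f g : X → ℂ} (hf : BddMeasurable f) (hg : BddMeasurable g) :
    BddMeasurable (fun x => f x * g x) := by
  obtain ⟨C, hC⟩ := hf.bound
  obtain ⟨D, hD⟩ := hg.bound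
  refine ⟨hf.measurable.mul hg.measurable, C * D, fun x => ?_⟩
  rw [norm_mul]
  exact mul_le_mul (hC x) (hD x) (norm_nonneg _) ((norm_nonneg _).trans (hC x))

theorem BddMeasurable.add {f g : X → ℂ} (hf : BddMeasurable f) (hg : BddMeasurable g) :
    BddMeasurable (fun x => f x + g x) := by
  obtain ⟨C, hC⟩ := hf.bound
  obtain ⟨D, hD⟩ := hg.bound
  exact ⟨hf.measurable.add hg.measurable, C + D,
    fun x => (norm_add_le _ _).trans (add_le_add (hC x) (hD x))⟩

theorem BddMeasurable.sum {ι : Type*} (s : Finset ι) {f : ι → X → ℂ}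
    (hf : ∀ i, BddMeasurable (f i)) : BddMeasurable (fun x => ∑ i ∈ s, f i x) := by
  classical
  induction s using Finset.induction_on with
  | empty => simpa using BddMeasurable.const 0
  | insert a s ha ih => simpa [Finset.sum_insert ha] using (hf a).add ih

theorem BddMeasurable.star {f : X → ℂ} (hf : BddMeasurable f) :
    BddMeasurable (fun x => star (f x)) := by
  obtain ⟨C, hC⟩ := hf.bound
  exact ⟨continuous_star.measurable.comp hf.measurable, C, fun x => by simpa using hC x⟩

theorem BddMeasurable.indicator {f : X → ℂ} (hf : BddMeasurable f) {B : Set X}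
    (hB : MeasurableSet B) : BddMeasurable (B.indicator f) := by
  obtain ⟨C, hC⟩ := hf.bound
  exact ⟨hf.measurable.indicator hB, C, fun x => (norm_indicator_le_norm_self _ _).trans (hC x)⟩

theorem BddMeasurable.integrable {f : X → ℂ} (hf : BddMeasurable f) (μ : Measure X)
    [IsFiniteMeasure μ] : Integrable f μ := by
  obtain ⟨C, hC⟩ := hf.bound
  exact Integrable.of_bound hf.measurable.aestronglyMeasurable C (Eventually.of_forall hC)

theorem POVM.integrable_mul_density (M : POVM X n) {f : X → ℂ} (hf : BddMeasurable f) (i j : n) :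
    Integrable (fun x => f x * M.density x i j) M.baseMeasure := by
  obtain ⟨C, hC⟩ := hf.bound
  exact ((M.integrable_density.eval i).eval j).bdd_mul hf.measurable.aestronglyMeasurable
    (Eventually.of_forall hC)

theorem POVM.integral_apply (M : POVM X n) (f : X → ℂ) (i j : n) :
    M.integral f i j = ∫ x, f x * M.density x i j ∂M.baseMeasure := rfl

theorem POVM.integral_indicator_one (M : POVM X n) {B : Set X} (hB : MeasurableSet B) :
    M.integral (B.indicator 1) = M.measure B := by
  ext i j
  rw [POVM.integral_apply, M.measure_eq_setIntegral hB, ← MeasureTheory.integral_indicator hB]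
  congr 1 with x
  by_cases hx : x ∈ B <;> simp [hx]

theorem POVM.integral_one (M : POVM X n) : M.integral (fun _ => 1) = 1 := by
  rw [← M.univ_eq_one, ← M.integral_indicator_one MeasurableSet.univ]
  congr 1
  ext x
  simp

theorem POVM.integral_add (M : POVM X n) {f g : X → ℂ} (hf : BddMeasurable f)
    (hg : BddMeasurable g) :
    M.integral (fun x => f x + g x) = M.integral f + M.integral g := by
  ext i j
  simp only [POVM.integral_apply, Matrix.add_apply, add_mul]
  exact MeasureTheory.integral_add (M.integrable_mul_density hf i j)
    (M.integrable_mul_density hg i j)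

theorem POVM.integral_const_mul (M : POVM X n) (c : ℂ) (f : X → ℂ) :
    M.integral (fun x => c * f x) = c • M.integral f := by
  ext i j
  simp only [POVM.integral_apply, Matrix.smul_apply, mul_assoc, smul_eq_mul]
  exact MeasureTheory.integral_const_mul _ _

theorem POVM.integral_sum (M : POVM X n) {ι : Type*} (s : Finset ι) {f : ι → X → ℂ}
    (hf : ∀ i, BddMeasurable (f i)) :
    M.integral (fun x => ∑ i ∈ s, f i x) = ∑ i ∈ s, M.integral (f i) := by
  classical
  induction s using Finset.induction_on with
  | empty =>
    ext i j
    simp [POVM.integral_apply]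
  | insert a s ha ih =>
    simp only [Finset.sum_insert ha]
    rw [M.integral_add (hf a) (BddMeasurable.sum s hf), ih]

theorem POVM.integral_star (M : POVM X n) (f : X → ℂ) :
    M.integral (fun x => star (f x)) = (M.integral f)ᴴ := by
  ext i j
  rw [Matrix.conjTranspose_apply, POVM.integral_apply, POVM.integral_apply]
  have h1 := integral_conj (μ := M.baseMeasure) (f := fun x => f x * M.density x j i)
  refine Eq.trans ?_ h1
  refine integral_congr_ae ?_
  filter_upwards [M.ae_posSemidef_density] with x hx
  have h2 : star (M.density x j i) = M.density x i j := hx.1.apply i j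
  rw [map_mul, ← h2]
  rfl

theorem POVM.integral_linearMap (M : POVM X n) {f : X → ℂ} (hf : BddMeasurable f)
    (L : Matrix n n ℂ →ₗ[ℝ] ℝ) :
    Integrable (fun x => L (f x • Matrix.of (M.density x))) M.baseMeasure ∧
    ∫ x, L (f x • Matrix.of (M.density x)) ∂M.baseMeasure = L (M.integral f) := by
  have h1 : Integrable (fun x => fun i j => f x * M.density x i j) M.baseMeasure :=
    Integrable.of_eval fun i => Integrable.of_eval fun j => M.integrable_mul_density hf i j
  exact ⟨integrable_linearMap_of h1 L, integral_linearMap_of h1 L⟩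

/-- This turns expectations under the Born law into traces against `POVM.integral`. Positivity of
the matrix density keeps the scalar density from being truncated by `ENNReal.ofReal`. -/
theorem outcomeLaw_eq_withDensity (σ : DensityMatrix n) (M : POVM X n) :
    outcomeLaw σ M = M.baseMeasure.withDensity fun x =>
      ENNReal.ofReal (reTrace σ.mat 1 (Matrix.of (M.density x))) := by
  ext B hB
  have hi := integrable_linearMap_of M.integrable_density (reTrace σ.mat 1)
  rw [outcomeLaw_apply σ M hB, withDensity_apply _ hB,
    ← ofReal_integral_eq_lintegral_ofReal hi.integrableOn]
  · rw [integral_linearMap_of M.integrable_density.integrableOn]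
    have h1 : (Matrix.of fun i j => ∫ x in B, M.density x i j ∂M.baseMeasure) = M.measure B := by
      ext i j
      exact (M.measure_eq_setIntegral hB i j).symm
    rw [h1, reTrace_apply, Matrix.mul_one]
  · filter_upwards [ae_restrict_of_ae M.ae_posSemidef_density] with x hx
    simpa [reTrace_apply] using trace_mul_re_nonneg σ.posSemidef hx

instance isProbabilityMeasure_outcomeLaw (σ : DensityMatrix n) (M : POVM X n) :
    IsProbabilityMeasure (outcomeLaw σ M) :=
  ⟨by rw [outcomeLaw_apply σ M MeasurableSet.univ, M.univ_eq_one]; simp [σ.trace_eq_one]⟩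

theorem integral_outcomeLaw (σ : DensityMatrix n) (M : POVM X n) {g : X → ℝ}
    (hg : BddMeasurable fun x => (g x : ℂ)) :
    ∫ x, g x ∂(outcomeLaw σ M) = (σ.mat * M.integral fun x => (g x : ℂ)).trace.re := by
  have hi := integrable_linearMap_of M.integrable_density (reTrace σ.mat 1)
  rw [outcomeLaw_eq_withDensity, integral_withDensity_eq_integral_toReal_smul₀
    hi.aemeasurable.ennreal_ofReal (Eventually.of_forall fun x => ENNReal.ofReal_lt_top)]
  have h1 := (M.integral_linearMap hg (reTrace σ.mat 1)).2
  rw [reTrace_apply, Matrix.mul_one] at h1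
  rw [← h1]
  refine integral_congr_ae ?_
  filter_upwards [M.ae_posSemidef_density] with x hx
  have h2 : 0 ≤ reTrace σ.mat 1 (Matrix.of (M.density x)) := by
    simpa [reTrace_apply] using trace_mul_re_nonneg σ.posSemidef hx
  rw [ENNReal.toReal_ofReal h2, Complex.coe_smul, map_smul, smul_eq_mul, smul_eq_mul, mul_comm]

/-- The Schwarz inequality `(∫ f dM)ᴴ (∫ f dM) ≤ ∫ |f|² dM`, in the state `σ`. -/
theorem re_trace_integral_sq_le (σ : DensityMatrix n) (M : POVM X n) {f : X → ℂ}
    (hf : BddMeasurable f) :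
    (σ.mat * ((M.integral f)ᴴ * M.integral f)).trace.re ≤
      ∫ x, ‖f x‖ ^ 2 ∂(outcomeLaw σ M) := by
  set B := M.integral f with hB
  have hsq : BddMeasurable fun x => ((‖f x‖ ^ 2 : ℝ) : ℂ) := by
    have h1 : (fun x => ((‖f x‖ ^ 2 : ℝ) : ℂ)) = fun x => star (f x) * f x := by
      ext x
      simp [Complex.conj_mul']
    rw [h1]
    exact hf.star.mul hf
  rw [integral_outcomeLaw σ M hsq]
  obtain ⟨i1, e1⟩ := M.integral_linearMap hsq (reTrace σ.mat 1)
  obtain ⟨i2, e2⟩ := M.integral_linearMap hf.star (reTrace σ.mat B)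
  obtain ⟨i3, e3⟩ := M.integral_linearMap hf (reTrace (σ.mat * Bᴴ) 1)
  obtain ⟨i4, e4⟩ := M.integral_linearMap (BddMeasurable.const 1) (reTrace (σ.mat * Bᴴ) B)
  -- With `m` the density, the integrand is `tr(σ (f - B)ᴴ m (f - B))` expanded. After integration
  -- the last three terms combine to `-tr(σ Bᴴ B)`.
  have hnn : 0 ≤ ∫ x, (reTrace σ.mat 1 (((‖f x‖ ^ 2 : ℝ) : ℂ) • Matrix.of (M.density x)) -
      reTrace σ.mat B (star (f x) • Matrix.of (M.density x)) -
      (reTrace (σ.mat * Bᴴ) 1 (f x • Matrix.of (M.density x)) -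
      reTrace (σ.mat * Bᴴ) B ((1 : ℂ) • Matrix.of (M.density x)))) ∂M.baseMeasure := by
    refine integral_nonneg_of_ae ?_
    filter_upwards [M.ae_posSemidef_density] with x hx
    have h1 := trace_mul_re_nonneg σ.posSemidef
      (hx.conjTranspose_mul_mul_same (f x • (1 : Matrix n n ℂ) - B))
    refine h1.trans_eq ?_
    simp only [reTrace_apply, ← Complex.sub_re, ← Matrix.trace_sub]
    have hc : ((‖f x‖ ^ 2 : ℝ) : ℂ) = star (f x) * f x := by
      simp [Complex.conj_mul']
    congr 2
    rw [hc]
    simp only [Matrix.conjTranspose_sub, Matrix.conjTranspose_smul, Matrix.conjTranspose_one,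
      Matrix.sub_mul, Matrix.mul_sub, Matrix.smul_mul, Matrix.mul_smul, Matrix.one_mul,
      Matrix.mul_one, one_smul, smul_sub, smul_smul, Matrix.mul_assoc, mul_comm (f x)]
    abel
  rw [MeasureTheory.integral_sub (by exact i1.sub i2) (by exact i3.sub i4),
    MeasureTheory.integral_sub i1 i2,
    MeasureTheory.integral_sub i3 i4, e1, e2, e3, e4, M.integral_star, M.integral_one, ← hB] at hnn
  simp only [reTrace_apply, Matrix.mul_one, Matrix.mul_assoc] at hnn
  linarith

end POVMIntegral

/-! ### Product operators on `N` copies and reduction to one copy. -/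

section Tensor

variable {n : Type*} {N : ℕ}

/-- The tensor product `A₁ ⊗ ⋯ ⊗ A_N` of matrices, in the product basis. -/
def piTensor (A : Fin N → Matrix n n ℂ) : Matrix (Fin N → n) (Fin N → n) ℂ :=
  Matrix.of fun i j => ∏ k, A k (i k) (j k)

theorem piTensor_conjTranspose (A : Fin N → Matrix n n ℂ) :
    (piTensor A)ᴴ = piTensor fun k => (A k)ᴴ := by
  ext i j
  simp [piTensor, Matrix.conjTranspose_apply, star_prod]

theorem piTensor_update_apply (A : Fin N → Matrix n n ℂ) (k : Fin N) (Y : Matrix n n ℂ)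
    (i j : Fin N → n) : piTensor (Function.update A k Y) i j =
      (∏ l ∈ Finset.univ.erase k, A l (i l) (j l)) * Y (i k) (j k) := by
  simp only [piTensor, Matrix.of_apply]
  rw [← Finset.prod_erase_mul _ _ (Finset.mem_univ k), Function.update_self]
  congr 1
  refine Finset.prod_congr rfl fun l hl => ?_
  rw [Function.update_of_ne (Finset.ne_of_mem_erase hl)]

variable [Fintype n]

theorem tensorPow_mat (ρ : DensityMatrix n) (N : ℕ) :
    (ρ.tensorPow N).mat = piTensor fun _ => ρ.mat := rfl

theorem piTensor_mul (A B : Fin N → Matrix n n ℂ) :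
    piTensor A * piTensor B = piTensor fun k => A k * B k := by
  ext i j
  simp only [piTensor, Matrix.mul_apply, Matrix.of_apply, ← Finset.prod_mul_distrib]
  exact (Fintype.prod_sum fun k a => A k (i k) a * B k a (j k)).symm

theorem trace_piTensor (A : Fin N → Matrix n n ℂ) :
    (piTensor A).trace = ∏ k, (A k).trace := by
  simp only [Matrix.trace, Matrix.diag_apply, piTensor, Matrix.of_apply]
  exact (Fintype.prod_sum fun k a => A k a a).symm

section Derivative

variable {E : Type*} [NormedAddCommGroup E] [NormedSpace ℝ E]

/-- The matrix of directional derivatives of the entries of a matrix-valued function. -/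
def entryDeriv (R : E → Matrix n n ℂ) (θ v : E) : Matrix n n ℂ :=
  Matrix.of fun i j => fderiv ℝ (fun t => R t i j) θ v

theorem fderiv_trace_mul_re {R : E → Matrix n n ℂ} {θ : E}
    (hR : ∀ i j, DifferentiableAt ℝ (fun t => R t i j) θ) (X : Matrix n n ℂ) (v : E) :
    fderiv ℝ (fun t => (R t * X).trace.re) θ v = (entryDeriv R θ v * X).trace.re := by
  have h1 : HasFDerivAt (fun t => (R t * X).trace)
      (∑ i, ∑ j, (fderiv ℝ (fun t => R t i j) θ).smulRight (X j i)) θ := by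
    simp only [Matrix.trace, Matrix.diag_apply, Matrix.mul_apply]
    refine HasFDerivAt.fun_sum fun i _ => HasFDerivAt.fun_sum fun j _ => ?_
    exact (hR i j).hasFDerivAt.mul_const' _
  have h2 := (Complex.reCLM.hasFDerivAt.comp θ h1).fderiv
  change fderiv ℝ (Complex.reCLM ∘ fun t => (R t * X).trace) θ v = _
  rw [h2]
  simp [Matrix.trace, Matrix.mul_apply, entryDeriv]

theorem contDiffOn_trace_piTensor_mul_re {R : E → Matrix n n ℂ} {s : Set E}
    (hR : ∀ i j, ContDiffOn ℝ 1 (fun t => R t i j) s)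
    (S : Matrix (Fin N → n) (Fin N → n) ℂ) :
    ContDiffOn ℝ 1 (fun t => (piTensor (fun _ => R t) * S).trace.re) s := by
  have h1 : ContDiffOn ℝ 1 (fun t => (piTensor (fun _ => R t) * S).trace) s := by
    simp only [Matrix.trace, Matrix.diag_apply, Matrix.mul_apply, piTensor, Matrix.of_apply]
    exact ContDiffOn.sum fun i _ => ContDiffOn.sum fun j _ =>
      (contDiffOn_prod fun k _ => hR _ _).mul contDiffOn_const
  exact Complex.reCLM.contDiff.comp_contDiffOn h1

end Derivative

variable [DecidableEq n]

/-- The linear functional `Y ↦ trace ((A₁ ⊗ ⋯ ⊗ Y ⊗ ⋯ ⊗ A_N) S)`, with `Y` in the slot `k`. -/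
def slotFunctional (A : Fin N → Matrix n n ℂ) (k : Fin N) (S : Matrix (Fin N → n) (Fin N → n) ℂ) :
    Matrix n n ℂ →ₗ[ℂ] ℂ where
  toFun Y := (piTensor (Function.update A k Y) * S).trace
  map_add' Y Y' := by
    rw [← Matrix.trace_add, ← Matrix.add_mul]
    congr 2
    ext i j
    simp only [piTensor_update_apply, Matrix.add_apply, mul_add]
  map_smul' c Y := by
    rw [RingHom.id_apply, ← Matrix.trace_smul, ← Matrix.smul_mul]
    congr 2
    ext i j
    simp only [piTensor_update_apply, Matrix.smul_apply, smul_eq_mul]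
    ring

/-- The partial trace of `(A₁ ⊗ ⋯ ⊗ 1 ⊗ ⋯ ⊗ A_N) S` over all slots but the slot `k`. -/
def slotReduce (A : Fin N → Matrix n n ℂ) (k : Fin N) (S : Matrix (Fin N → n) (Fin N → n) ℂ) :
    Matrix n n ℂ :=
  Matrix.of fun b a => slotFunctional A k S (Matrix.single a b 1)

/-- The partial trace is characterised by duality; the indices in `slotReduce` are swapped so that
the trace pairing recovers `slotFunctional`. -/
theorem trace_mul_slotReduce (A : Fin N → Matrix n n ℂ) (k : Fin N)
    (S : Matrix (Fin N → n) (Fin N → n) ℂ) (Y : Matrix n n ℂ) :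
    (Y * slotReduce A k S).trace = (piTensor (Function.update A k Y) * S).trace := by
  have h1 : (piTensor (Function.update A k Y) * S).trace = slotFunctional A k S Y := rfl
  rw [h1]
  conv_rhs => rw [Matrix.matrix_eq_sum_single Y]
  simp only [map_sum, Matrix.trace, Matrix.diag_apply, Matrix.mul_apply]
  refine Finset.sum_congr rfl fun a _ => Finset.sum_congr rfl fun b _ => ?_
  have h2 : Matrix.single a b (Y a b) = Y a b • (Matrix.single a b (1 : ℂ)) := by
    rw [Matrix.smul_single, smul_eq_mul, mul_one]
  rw [h2, map_smul, smul_eq_mul]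
  rfl

theorem slotReduce_conjTranspose {A : Fin N → Matrix n n ℂ} (hA : ∀ l, (A l).IsHermitian)
    (k : Fin N) (S : Matrix (Fin N → n) (Fin N → n) ℂ) :
    slotReduce A k Sᴴ = (slotReduce A k S)ᴴ := by
  ext b a
  rw [Matrix.conjTranspose_apply]
  change (piTensor _ * Sᴴ).trace = star ((piTensor _ * S).trace)
  rw [← Matrix.trace_conjTranspose, Matrix.conjTranspose_mul, piTensor_conjTranspose,
    Matrix.trace_mul_comm]
  congr 3
  ext l i j
  rcases eq_or_ne l k with rfl | h
  · rw [Function.update_self, Function.update_self, Matrix.conjTranspose_single]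
    simp
  · rw [Function.update_of_ne h, Function.update_of_ne h, (hA l).eq]

/-- The sum over the slots of the one-copy reductions of an operator on `N` copies. -/
def oneCopy (A : Matrix n n ℂ) : Matrix (Fin N → n) (Fin N → n) ℂ →ₗ[ℂ] Matrix n n ℂ where
  toFun S := ∑ k, slotReduce (fun _ => A) k S
  map_add' S S' := by
    rw [← Finset.sum_add_distrib]
    refine Finset.sum_congr rfl fun k _ => ?_
    ext b a
    simp [slotReduce, slotFunctional, Matrix.mul_add]
  map_smul' c S := by
    rw [RingHom.id_apply, Finset.smul_sum]
    refine Finset.sum_congr rfl fun k _ => ?_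
    ext b a
    simp [slotReduce, slotFunctional]

theorem oneCopy_conjTranspose {A : Matrix n n ℂ} (hA : A.IsHermitian)
    (S : Matrix (Fin N → n) (Fin N → n) ℂ) : oneCopy A Sᴴ = (oneCopy A S)ᴴ := by
  change ∑ k, slotReduce (fun _ => A) k Sᴴ = (∑ k, slotReduce (fun _ => A) k S)ᴴ
  rw [Matrix.conjTranspose_sum]
  exact Finset.sum_congr rfl fun k _ => slotReduce_conjTranspose (fun _ => hA) k S

theorem trace_mul_oneCopy (A : Matrix n n ℂ) (S : Matrix (Fin N → n) (Fin N → n) ℂ)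
    (Y : Matrix n n ℂ) : (Y * oneCopy A S).trace =
      ∑ k, (piTensor (Function.update (fun _ => A) k Y) * S).trace := by
  change (Y * ∑ k, slotReduce (fun _ => A) k S).trace = _
  rw [Matrix.mul_sum, Matrix.trace_sum]
  exact Finset.sum_congr rfl fun k _ => trace_mul_slotReduce _ k S Y

theorem trace_mul_oneCopy_self (A : Matrix n n ℂ) (S : Matrix (Fin N → n) (Fin N → n) ℂ) :
    (A * oneCopy A S).trace = N * (piTensor (fun _ => A) * S).trace := by
  rw [trace_mul_oneCopy]
  simp [Function.update_eq_self]

/-- The operator `∑ₖ 1 ⊗ ⋯ ⊗ Y ⊗ ⋯ ⊗ 1`. -/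
def sumCopies (N : ℕ) (Y : Matrix n n ℂ) : Matrix (Fin N → n) (Fin N → n) ℂ :=
  ∑ k, piTensor (Function.update (fun _ => 1) k Y)

/-- For the forms `tr(ρ Aᴴ B)` and `tr(ρ^{⊗N} Aᴴ B)`, this makes `oneCopy` the adjoint of
`sumCopies`. -/
theorem trace_piTensor_mul_sumCopies (A : Matrix n n ℂ) (S : Matrix (Fin N → n) (Fin N → n) ℂ)
    (Y : Matrix n n ℂ) : (piTensor (fun _ => A) * S * sumCopies N Y).trace =
      (A * oneCopy A S * Y).trace := by
  rw [Matrix.trace_mul_comm (A * _) Y, ← Matrix.mul_assoc, trace_mul_oneCopy, sumCopies,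
    Matrix.mul_sum, Matrix.trace_sum]
  refine Finset.sum_congr rfl fun k _ => ?_
  rw [Matrix.trace_mul_comm, ← Matrix.mul_assoc, piTensor_mul]
  congr 3
  ext1 l
  rcases eq_or_ne l k with rfl | h
  · simp
  · simp [h]

/-- Distinct slots are orthogonal, a factor `tr(ρ Y) = 0` appearing in the cross terms. On centred
matrices `sumCopies` is therefore `√N` times an isometry. -/
theorem trace_sumCopies_sq (ρ : DensityMatrix n) {Y : Matrix n n ℂ}
    (hY : (ρ.mat * Y).trace = 0) :
    (piTensor (fun _ => ρ.mat) * (sumCopies N Y)ᴴ * sumCopies N Y).trace =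
      N * (ρ.mat * Yᴴ * Y).trace := by
  have h1 : ∀ k l : Fin N, (piTensor (fun _ => ρ.mat) *
      (piTensor (Function.update (fun _ => 1) k Y))ᴴ *
      piTensor (Function.update (fun _ => 1) l Y)).trace =
        if k = l then (ρ.mat * Yᴴ * Y).trace else 0 := by
    intro k l
    rw [piTensor_conjTranspose, piTensor_mul, piTensor_mul, trace_piTensor]
    split_ifs with hkl
    · subst hkl
      rw [Finset.prod_eq_single k]
      · simp
      · intro m _ hm
        simp [hm, ρ.trace_eq_one]
      · simp
    · refine Finset.prod_eq_zero (Finset.mem_univ l) ?_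
      simp [Ne.symm hkl, hY]
  rw [sumCopies, Matrix.conjTranspose_sum]
  simp_rw [Matrix.mul_sum, Matrix.sum_mul, Matrix.trace_sum, h1]
  simp

/-- Reduction to one copy decreases the second moment by a factor `N`. -/
theorem re_trace_oneCopy_sq_le (ρ : DensityMatrix n) (hN : 0 < N)
    {S : Matrix (Fin N → n) (Fin N → n) ℂ}
    (hS : ((ρ.tensorPow N).mat * S).trace = 0) :
    (ρ.mat * ((oneCopy ρ.mat S)ᴴ * oneCopy ρ.mat S)).trace.re ≤
      N * ((ρ.tensorPow N).mat * (Sᴴ * S)).trace.re := by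
  set Y := oneCopy ρ.mat S with hYdef
  set y := sumCopies N Y with hy
  have hρ := ρ.posSemidef.1
  have hY : (ρ.mat * Y).trace = 0 := by
    rw [hYdef, trace_mul_oneCopy_self, ← tensorPow_mat, hS, mul_zero]
  have hN' : (N : ℂ) ≠ 0 := by exact_mod_cast hN.ne'
  have hcross : ((ρ.tensorPow N).mat * (Sᴴ * y)).trace = (ρ.mat * (Yᴴ * Y)).trace := by
    rw [tensorPow_mat, ← Matrix.mul_assoc, hy, trace_piTensor_mul_sumCopies,
      oneCopy_conjTranspose hρ, Matrix.mul_assoc]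
  have hcross' : ((ρ.tensorPow N).mat * (yᴴ * S)).trace.re = (ρ.mat * (Yᴴ * Y)).trace.re := by
    rw [← hcross]
    have h1 : ((ρ.tensorPow N).mat * (yᴴ * S)).trace =
        star ((ρ.tensorPow N).mat * (Sᴴ * y)).trace := by
      rw [← Matrix.trace_conjTranspose, Matrix.conjTranspose_mul, Matrix.conjTranspose_mul,
        Matrix.conjTranspose_conjTranspose, (ρ.tensorPow N).posSemidef.1.eq,
        Matrix.trace_mul_comm]
    rw [h1]
    simp
  have hsq : ((ρ.tensorPow N).mat * (yᴴ * y)).trace = N * (ρ.mat * (Yᴴ * Y)).trace := by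
    rw [tensorPow_mat, ← Matrix.mul_assoc, trace_sumCopies_sq ρ hY, Matrix.mul_assoc]
  -- Expand the second moment of `N S - y`. Writing `s` and `t` for the second moments of `S` and
  -- `Y`, adjointness and the isometry property give `N² s - 2 N t + N t ≥ 0`, hence `t ≤ N s`.
  have h0 := trace_mul_re_nonneg (ρ.tensorPow N).posSemidef
    (Matrix.posSemidef_conjTranspose_mul_self ((N : ℂ) • S - y))
  have h2 : ((ρ.tensorPow N).mat * (((N : ℂ) • S - y)ᴴ * ((N : ℂ) • S - y))).trace =
      (N : ℂ) * ((N : ℂ) * ((ρ.tensorPow N).mat * (Sᴴ * S)).trace) -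
      (N : ℂ) * ((ρ.tensorPow N).mat * (Sᴴ * y)).trace -
      (N : ℂ) * ((ρ.tensorPow N).mat * (yᴴ * S)).trace +
        ((ρ.tensorPow N).mat * (yᴴ * y)).trace := by
    simp only [Matrix.conjTranspose_sub, Matrix.conjTranspose_smul, Matrix.sub_mul,
      Matrix.mul_sub, Matrix.smul_mul, Matrix.mul_smul, Matrix.trace_sub, Matrix.trace_smul,
      smul_eq_mul, star_natCast]
    ring
  rw [h2, hcross, hsq] at h0
  have h3 : ∀ z : ℂ, ((N : ℂ) * z).re = N * z.re := fun z => by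
    rw [← Complex.ofReal_natCast, Complex.re_ofReal_mul]
  simp only [Complex.add_re, Complex.sub_re, h3, hcross'] at h0
  have h4 : (0 : ℝ) < N := by exact_mod_cast hN
  have h5 : 0 ≤ (N : ℝ) * ((N : ℝ) * ((ρ.tensorPow N).mat * (Sᴴ * S)).trace.re -
      (ρ.mat * (Yᴴ * Y)).trace.re) := by linarith
  linarith [nonneg_of_mul_nonneg_right h5 h4]

section Derivative

variable {E : Type*} [NormedAddCommGroup E] [NormedSpace ℝ E]

/-- The Leibniz rule differentiates one slot at a time and leaves `R θ` in the others, which is the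
sum defining `oneCopy`. The reduction thus retains all first-order information about the mean of
`S`. -/
theorem fderiv_trace_piTensor_mul_re {R : E → Matrix n n ℂ} {θ : E}
    (hR : ∀ i j, DifferentiableAt ℝ (fun t => R t i j) θ)
    (S : Matrix (Fin N → n) (Fin N → n) ℂ) (v : E) :
    fderiv ℝ (fun t => (piTensor (fun _ => R t) * S).trace.re) θ v =
      (entryDeriv R θ v * oneCopy (R θ) S).trace.re := by
  have hd : ∀ i j : Fin N → n, HasFDerivAt (fun t => piTensor (fun _ => R t) i j)
      (∑ k, (∏ l ∈ Finset.univ.erase k, R θ (i l) (j l)) •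
        fderiv ℝ (fun t => R t (i k) (j k)) θ) θ := fun i j =>
    HasFDerivAt.finsetProd (u := Finset.univ) (fun k _ => (hR (i k) (j k)).hasFDerivAt)
  rw [fderiv_trace_mul_re (fun i j => (hd i j).differentiableAt), trace_mul_oneCopy,
    ← Matrix.trace_sum, ← Matrix.sum_mul]
  congr 3
  ext i j
  rw [Matrix.sum_apply]
  simp only [piTensor_update_apply]
  change fderiv ℝ (fun t => piTensor (fun _ => R t) i j) θ v = _
  rw [(hd i j).fderiv]
  simp [entryDeriv]

end Derivative

end Tensor

/-! ### Real positive semidefinite matrices. -/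

section RealMatrix

variable {m : Type*} [Fintype m]

open scoped MatrixOrder Matrix.Norms.L2Operator in
theorem Matrix.PosSemidef.exists_real_factor {A : Matrix m m ℝ} (hA : A.PosSemidef) :
    ∃ B : Matrix m m ℝ, A = Bᵀ * B := by
  classical
  obtain ⟨B, hB⟩ := CStarAlgebra.nonneg_iff_eq_star_mul_self.mp hA.nonneg
  exact ⟨B, by rw [hB, Matrix.star_eq_conjTranspose, Matrix.conjTranspose_eq_transpose_of_trivial]⟩

theorem Matrix.PosSemidef.trace_mul_nonneg_real {A B : Matrix m m ℝ} (hA : A.PosSemidef)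
    (hB : B.PosSemidef) : 0 ≤ (A * B).trace := by
  obtain ⟨C, rfl⟩ := hA.exists_real_factor
  rw [Matrix.mul_assoc, Matrix.trace_mul_comm, ← Matrix.conjTranspose_eq_transpose_of_trivial]
  exact (hB.mul_mul_conjTranspose_same C).trace_nonneg

theorem Matrix.PosSemidef.abs_apply_le_trace {A : Matrix m m ℝ} (hA : A.PosSemidef) (i j : m) :
    |A i j| ≤ A.trace := by
  classical
  have hd : ∀ k, 0 ≤ A k k := fun k => hA.diag_nonneg
  have hs : A j i = A i j := by simpa using hA.1.apply i j
  have hle : ∀ k, A k k ≤ A.trace := fun k =>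
    Finset.single_le_sum (f := fun k => A k k) (fun l _ => hd l) (Finset.mem_univ k)
  have key : ∀ s : ℝ, 0 ≤ A i i + 2 * s * A i j + s ^ 2 * A j j := fun s => by
    have h := hA.dotProduct_mulVec_nonneg (Pi.single i 1 + s • Pi.single j 1)
    simp only [star_trivial, Matrix.mulVec_add, Matrix.mulVec_smul, Matrix.mulVec_single_one,
      add_dotProduct, dotProduct_add, smul_dotProduct, dotProduct_smul, single_dotProduct,
      Matrix.col_apply, smul_eq_mul, one_mul, hs] at h
    linarith
  have h1 := key 1
  have h2 := key (-1)
  rw [abs_le]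
  constructor <;> linarith [hle i, hle j]

end RealMatrix

/-! ### Tuples of observables and the order relation `Z(X) ≤ V`. -/

section Combination

variable {n : Type*} {ι κ : Type*} [Fintype ι]

/-- The complex linear combination `∑ c_a X_a`. -/
def combo (c : ι → ℂ) (X : ι → Matrix n n ℂ) : Matrix n n ℂ := ∑ a, c a • X a

/-- The tuple `A X` with entries `∑_b A_ab X_b`. -/
def mulTuple (A : Matrix κ ι ℝ) (X : ι → Matrix n n ℂ) : κ → Matrix n n ℂ :=
  fun a => ∑ b, (A a b : ℂ) • X b

theorem mulTuple_isHermitian (A : Matrix κ ι ℝ) {X : ι → Matrix n n ℂ}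
    (hX : ∀ a, (X a).IsHermitian) (a : κ) : (mulTuple A X a).IsHermitian := by
  unfold mulTuple Matrix.IsHermitian
  rw [Matrix.conjTranspose_sum]
  refine Finset.sum_congr rfl fun b _ => ?_
  rw [Matrix.conjTranspose_smul, (hX b).eq]
  simp

/-- The hermitian form of a real matrix on complex vectors. -/
def quadForm (V : Matrix ι ι ℝ) (c : ι → ℂ) : ℝ :=
  (star c ⬝ᵥ (V.map (fun x : ℝ => (x : ℂ)) *ᵥ c)).re

theorem quadForm_add_smul (V W : Matrix ι ι ℝ) (s t : ℝ) (c : ι → ℂ) :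
    quadForm (s • V + t • W) c = s * quadForm V c + t * quadForm W c := by
  have h : (s • V + t • W).map (fun x : ℝ => (x : ℂ)) =
      (s : ℂ) • V.map (fun x : ℝ => (x : ℂ)) + (t : ℂ) • W.map (fun x : ℝ => (x : ℂ)) := by
    ext i j
    simp
  unfold quadForm
  rw [h, Matrix.add_mulVec, Matrix.smul_mulVec, Matrix.smul_mulVec, dotProduct_add,
    dotProduct_smul, dotProduct_smul, Complex.add_re, smul_eq_mul, smul_eq_mul,
    Complex.re_ofReal_mul, Complex.re_ofReal_mul]

theorem quadForm_ofReal (V : Matrix ι ι ℝ) (u : ι → ℝ) :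
    quadForm V (fun i => (u i : ℂ)) = u ⬝ᵥ (V *ᵥ u) := by
  have h : star (fun i => (u i : ℂ)) ⬝ᵥ
      (V.map (fun x : ℝ => (x : ℂ)) *ᵥ fun i => (u i : ℂ)) = ((u ⬝ᵥ (V *ᵥ u) : ℝ) : ℂ) := by
    simp [dotProduct, Matrix.mulVec]
  rw [quadForm, h, Complex.ofReal_re]

theorem combo_mulTuple [Fintype κ] (A : Matrix κ ι ℝ) (X : ι → Matrix n n ℂ) (c : κ → ℂ) :
    combo c (mulTuple A X) = combo (Aᵀ.map (fun x : ℝ => (x : ℂ)) *ᵥ c) X := by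
  simp only [combo, mulTuple, Finset.smul_sum, smul_smul, Matrix.mulVec, dotProduct,
    Finset.sum_smul, Matrix.map_apply, Matrix.transpose_apply]
  rw [Finset.sum_comm]
  simp only [mul_comm]

theorem quadForm_mul_mul_transpose [Fintype κ] (A : Matrix κ ι ℝ) (V : Matrix ι ι ℝ)
    (c : κ → ℂ) : quadForm (A * V * Aᵀ) c =
      quadForm V (Aᵀ.map (fun x : ℝ => (x : ℂ)) *ᵥ c) := by
  have h : (A * V * Aᵀ).map (fun x : ℝ => (x : ℂ)) = A.map (fun x : ℝ => (x : ℂ)) *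
      V.map (fun x : ℝ => (x : ℂ)) * Aᵀ.map (fun x : ℝ => (x : ℂ)) := by
    ext i j
    simp [Matrix.mul_apply]
  have h2 : (Aᵀ.map (fun x : ℝ => (x : ℂ)))ᴴ = A.map (fun x : ℝ => (x : ℂ)) := by
    ext i j
    simp
  unfold quadForm
  rw [h, Matrix.star_mulVec, h2, ← Matrix.mulVec_mulVec, ← Matrix.mulVec_mulVec,
    Matrix.dotProduct_mulVec (star c)]

variable [Fintype n]

/-- `trace (σ A* A)`. -/
def DensityMatrix.sqMoment (σ : DensityMatrix n) (A : Matrix n n ℂ) : ℝ :=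
  (σ.mat * (Aᴴ * A)).trace.re

theorem DensityMatrix.sqMoment_nonneg (σ : DensityMatrix n) (A : Matrix n n ℂ) :
    0 ≤ σ.sqMoment A :=
  trace_mul_re_nonneg σ.posSemidef (Matrix.posSemidef_conjTranspose_mul_self A)

/-- The deficit is exactly `t (1 - t)` times the second moment of `A - B`. -/
theorem DensityMatrix.sqMoment_convex (σ : DensityMatrix n) (A B : Matrix n n ℂ) {t : ℝ}
    (h0 : 0 ≤ t) (h1 : t ≤ 1) : σ.sqMoment (((1 - t : ℝ) : ℂ) • A + (t : ℂ) • B) ≤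
      (1 - t) * σ.sqMoment A + t * σ.sqMoment B := by
  have h2 := mul_nonneg (mul_nonneg h0 (sub_nonneg.2 h1)) (σ.sqMoment_nonneg (A - B))
  have h3 : (1 - t) * σ.sqMoment A + t * σ.sqMoment B -
      σ.sqMoment (((1 - t : ℝ) : ℂ) • A + (t : ℂ) • B) = t * (1 - t) * σ.sqMoment (A - B) := by
    simp only [DensityMatrix.sqMoment, ← Complex.re_ofReal_mul, ← Complex.add_re,
      ← Complex.sub_re]
    congr 1
    simp only [Matrix.conjTranspose_add, Matrix.conjTranspose_sub, Matrix.conjTranspose_smul,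
      Matrix.add_mul, Matrix.mul_add, Matrix.sub_mul, Matrix.mul_sub, Matrix.smul_mul,
      Matrix.mul_smul, Matrix.trace_add, Matrix.trace_sub, Matrix.trace_smul, smul_eq_mul,
      Complex.star_def, Complex.conj_ofReal]
    push_cast
    ring
  linarith

/-- `Z(X) ≤ V` for a tuple of self-adjoint matrices `X` and a real symmetric matrix `V`. -/
def ZLe (σ : DensityMatrix n) (X : ι → Matrix n n ℂ) (V : Matrix ι ι ℝ) : Prop :=
  ∀ c : ι → ℂ, σ.sqMoment (combo c X) ≤ quadForm V c

theorem ZLe.mul [Fintype κ] {σ : DensityMatrix n} {X : ι → Matrix n n ℂ} {V : Matrix ι ι ℝ}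
    (h : ZLe σ X V) (A : Matrix κ ι ℝ) : ZLe σ (mulTuple A X) (A * V * Aᵀ) := fun c => by
  rw [combo_mulTuple, quadForm_mul_mul_transpose]
  exact h _

/-- The relation is jointly convex in `(X, V)`; this and `ZLe.mul` are the only operations the
perturbation argument needs. -/
theorem ZLe.convex {σ : DensityMatrix n} {X X' : ι → Matrix n n ℂ} {V V' : Matrix ι ι ℝ}
    (h : ZLe σ X V) (h' : ZLe σ X' V') {t : ℝ} (h0 : 0 ≤ t) (h1 : t ≤ 1) :
    ZLe σ (fun a => ((1 - t : ℝ) : ℂ) • X a + (t : ℂ) • X' a) ((1 - t) • V + t • V') := fun c => by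
  have hc : combo c (fun a => ((1 - t : ℝ) : ℂ) • X a + (t : ℂ) • X' a) =
      ((1 - t : ℝ) : ℂ) • combo c X + (t : ℂ) • combo c X' := by
    simp only [combo, Finset.smul_sum, ← Finset.sum_add_distrib, smul_add, smul_smul, mul_comm]
  rw [hc, quadForm_add_smul]
  refine (σ.sqMoment_convex _ _ h0 h1).trans ?_
  exact add_le_add (mul_le_mul_of_nonneg_left (h c) (sub_nonneg.2 h1))
    (mul_le_mul_of_nonneg_left (h' c) h0)

theorem ZLe.posSemidef {σ : DensityMatrix n} {X : ι → Matrix n n ℂ} {V : Matrix ι ι ℝ}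
    (h : ZLe σ X V) (hV : V.IsSymm) : V.PosSemidef := by
  refine Matrix.PosSemidef.of_dotProduct_mulVec_nonneg
    (by rw [Matrix.IsHermitian, Matrix.conjTranspose_eq_transpose_of_trivial]; exact hV)
    fun u => ?_
  rw [star_trivial, ← quadForm_ofReal]
  exact (σ.sqMoment_nonneg _).trans (h _)

end Combination

/-! ### The Holevo matrix constraint as an inequality of hermitian forms. -/

section HolevoZ

variable {n : Type*} [Fintype n] {p : ℕ}

theorem star_dotProduct_holevoZ_mulVec (σ : DensityMatrix n) {X : Fin p → Matrix n n ℂ}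
    (hX : ∀ a, (X a).IsHermitian) (c : Fin p → ℂ) :
    star c ⬝ᵥ (holevoZ σ X *ᵥ c) = (σ.mat * ((combo c X)ᴴ * combo c X)).trace := by
  have h : (combo c X)ᴴ = ∑ a, star (c a) • X a := by
    rw [combo, Matrix.conjTranspose_sum]
    exact Finset.sum_congr rfl fun a _ => by rw [Matrix.conjTranspose_smul, (hX a).eq]
  rw [h, combo, Matrix.sum_mul, Matrix.mul_sum, Matrix.trace_sum]
  refine Finset.sum_congr rfl fun a _ => ?_
  rw [Matrix.mul_sum, Matrix.mul_sum, Matrix.trace_sum, Matrix.mulVec, dotProduct,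
    Finset.mul_sum]
  refine Finset.sum_congr rfl fun b _ => ?_
  simp only [holevoZ, Matrix.of_apply, Pi.star_apply, Matrix.smul_mul, Matrix.mul_smul,
    Matrix.trace_smul, smul_eq_mul, Matrix.mul_assoc]
  ring

theorem holevoZ_apply_star (σ : DensityMatrix n) {X : Fin p → Matrix n n ℂ}
    (hX : ∀ a, (X a).IsHermitian) (i j : Fin p) :
    holevoZ σ X i j = star (holevoZ σ X j i) := by
  simp only [holevoZ, Matrix.of_apply]
  rw [← Matrix.trace_conjTranspose, Matrix.conjTranspose_mul, Matrix.conjTranspose_mul,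
    (hX i).eq, (hX j).eq, σ.posSemidef.1.eq, ← Matrix.mul_assoc (X i),
    Matrix.trace_mul_comm (X i * X j), ← Matrix.mul_assoc]

/-- The form of `Z(X)` at `c` is the second moment of `∑ c_a X_a`. The right-hand side makes sense
for tuples of any index type, in particular for the `q` components of an estimator. -/
theorem posSemidef_sub_holevoZ_iff (σ : DensityMatrix n) {X : Fin p → Matrix n n ℂ}
    (hX : ∀ a, (X a).IsHermitian) {V : Matrix (Fin p) (Fin p) ℝ} (hV : V.IsSymm) :
    (V.map (fun x : ℝ => (x : ℂ)) - holevoZ σ X).PosSemidef ↔ ZLe σ X V := by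
  have key : ∀ c : Fin p → ℂ,
      (star c ⬝ᵥ ((V.map (fun x : ℝ => (x : ℂ)) - holevoZ σ X) *ᵥ c)).re =
        quadForm V c - σ.sqMoment (combo c X) := fun c => by
    rw [Matrix.sub_mulVec, dotProduct_sub, star_dotProduct_holevoZ_mulVec σ hX, Complex.sub_re]
    rfl
  constructor
  · intro h c
    have := (Complex.nonneg_iff.1 (h.dotProduct_mulVec_nonneg c)).1
    rw [key] at this
    linarith
  · intro h
    refine posSemidef_of_re_nonneg (fun i j => ?_) fun c => ?_
    · rw [Matrix.sub_apply, Matrix.sub_apply, star_sub, ← holevoZ_apply_star σ hX]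
      simp [hV.apply i j]
    · rw [key]
      linarith [h c]

/-- Take `V = 2 Re Z`: then `V - Z` is the complex conjugate of `Z`, which equals `Zᵀ` and is
positive semidefinite. -/
theorem exists_ZLe (σ : DensityMatrix n) {X : Fin p → Matrix n n ℂ}
    (hX : ∀ a, (X a).IsHermitian) :
    ∃ V : Matrix (Fin p) (Fin p) ℝ, V.IsSymm ∧ ZLe σ X V := by
  have hZ : (holevoZ σ X).PosSemidef := posSemidef_of_re_nonneg (holevoZ_apply_star σ hX)
    fun c => by
      rw [star_dotProduct_holevoZ_mulVec σ hX]
      exact σ.sqMoment_nonneg _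
  set V : Matrix (Fin p) (Fin p) ℝ := Matrix.of fun i j => 2 * (holevoZ σ X i j).re with hVdef
  have hV : V.IsSymm := by
    ext i j
    rw [hVdef, Matrix.transpose_apply, Matrix.of_apply, Matrix.of_apply,
      holevoZ_apply_star σ hX i j]
    simp
  refine ⟨V, hV, (posSemidef_sub_holevoZ_iff σ hX hV).1 ?_⟩
  have h : V.map (fun x : ℝ => (x : ℂ)) - holevoZ σ X = (holevoZ σ X)ᵀ := by
    ext i j
    rw [Matrix.sub_apply, Matrix.transpose_apply, holevoZ_apply_star σ hX j i]
    apply Complex.ext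
    · simp [hVdef]; ring
    · simp [hVdef]
  rw [h]
  exact hZ.transpose

end HolevoZ

theorem Matrix.IsSymm.mul_mul_transpose {l m R : Type*} [Fintype m] [CommSemiring R]
    {V : Matrix m m R} (hV : V.IsSymm) (A : Matrix l m R) : (A * V * Aᵀ).IsSymm := by
  rw [Matrix.IsSymm, Matrix.transpose_mul (A * V), Matrix.transpose_mul A,
    Matrix.transpose_transpose, hV.eq, Matrix.mul_assoc]

/-! ### First-order optimality of `V₀`. -/

section HolevoBound

variable {n : Type*} [Fintype n] {p : ℕ} {κ ι : Type*}

/-- The derivatives `∂ρ/∂θ_i` of the state. -/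
def stateDeriv (ρ : (Fin p → ℝ) → DensityMatrix n) (θ : Fin p → ℝ) (i : Fin p) : Matrix n n ℂ :=
  entryDeriv (fun t => (ρ t).mat) θ (Pi.single i 1)

/-- The matrix of derivatives `∂/∂θ_i trace (ρ X_a)`. -/
def meanDeriv (ρ : (Fin p → ℝ) → DensityMatrix n) (θ : Fin p → ℝ) (X : κ → Matrix n n ℂ) :
    Matrix κ (Fin p) ℝ :=
  Matrix.of fun a i => (stateDeriv ρ θ i * X a).trace.re

theorem meanDeriv_mulTuple [Fintype ι] (ρ : (Fin p → ℝ) → DensityMatrix n) (θ : Fin p → ℝ)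
    (A : Matrix κ ι ℝ) (X : ι → Matrix n n ℂ) :
    meanDeriv ρ θ (mulTuple A X) = A * meanDeriv ρ θ X := by
  ext a i
  simp [meanDeriv, mulTuple, Matrix.mul_apply, Matrix.mul_sum, Matrix.trace_sum]

theorem meanDeriv_convex (ρ : (Fin p → ℝ) → DensityMatrix n) (θ : Fin p → ℝ)
    (X X' : κ → Matrix n n ℂ) (s t : ℝ) :
    meanDeriv ρ θ (fun a => (s : ℂ) • X a + (t : ℂ) • X' a) =
      s • meanDeriv ρ θ X + t • meanDeriv ρ θ X' := by
  ext a i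
  simp [meanDeriv, Matrix.mul_add]

variable {ρ : (Fin p → ℝ) → DensityMatrix n} {θ : Fin p → ℝ}

theorem isLocallyUnbiased_iff (hd : ∀ i j, DifferentiableAt ℝ (fun t => (ρ t).mat i j) θ)
    (X : Fin p → Matrix n n ℂ) :
    IsLocallyUnbiased ρ θ X ↔ (∀ j, (X j).IsHermitian) ∧ meanDeriv ρ θ X = 1 := by
  unfold IsLocallyUnbiased
  refine and_congr_right fun _ => ?_
  rw [← Matrix.ext_iff]
  simp only [fderiv_trace_mul_re (R := fun t => (ρ t).mat) hd, Matrix.one_apply]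
  constructor
  · intro h i j
    rw [show meanDeriv ρ θ X i j = _ from h j i]
    simp only [eq_comm]
  · intro h i j
    exact (h j i).trans (by simp only [eq_comm])

/-- The set of values `trace (G V)` whose infimum is the Holevo bound. -/
def holevoValues (ρ : (Fin p → ℝ) → DensityMatrix n) (θ : Fin p → ℝ)
    (G : Matrix (Fin p) (Fin p) ℝ) : Set ℝ :=
  {c : ℝ | ∃ (X : Fin p → Matrix n n ℂ) (V : Matrix (Fin p) (Fin p) ℝ),
    (∀ j, (X j).IsHermitian) ∧ meanDeriv ρ θ X = 1 ∧ V.IsSymm ∧ ZLe (ρ θ) X V ∧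
      c = (G * V).trace}

theorem holevoBound_eq (hd : ∀ i j, DifferentiableAt ℝ (fun t => (ρ t).mat i j) θ)
    (G : Matrix (Fin p) (Fin p) ℝ) : holevoBound ρ θ G = sInf (holevoValues ρ θ G) := by
  unfold holevoBound holevoValues
  congr 1
  ext c
  refine exists_congr fun X => exists_congr fun V => ?_
  rw [isLocallyUnbiased_iff hd]
  constructor
  · rintro ⟨⟨h1, h2⟩, h3, h4, h5⟩
    exact ⟨h1, h2, h3, (posSemidef_sub_holevoZ_iff _ h1 h3).1 h4, h5⟩
  · rintro ⟨h1, h2, h3, h4, h5⟩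
    exact ⟨⟨h1, h2⟩, h3, (posSemidef_sub_holevoZ_iff _ h1 h3).2 h4, h5⟩

theorem holevoValues_nonneg {G : Matrix (Fin p) (Fin p) ℝ} (hG : G.PosDef) {c : ℝ}
    (hc : c ∈ holevoValues ρ θ G) : 0 ≤ c := by
  obtain ⟨X, V, -, -, hV, hZ, rfl⟩ := hc
  exact hG.posSemidef.trace_mul_nonneg_real (hZ.posSemidef hV)

theorem holevoValues_bddBelow {G : Matrix (Fin p) (Fin p) ℝ} (hG : G.PosDef) :
    BddBelow (holevoValues ρ θ G) := ⟨0, fun _ hc => holevoValues_nonneg hG hc⟩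

theorem holevoValues_nonempty (hd : ∀ i j, DifferentiableAt ℝ (fun t => (ρ t).mat i j) θ)
    (hX : ∃ X, IsLocallyUnbiased ρ θ X) (G : Matrix (Fin p) (Fin p) ℝ) :
    (holevoValues ρ θ G).Nonempty := by
  obtain ⟨X, hX⟩ := hX
  rw [isLocallyUnbiased_iff hd] at hX
  obtain ⟨V, hV, hZ⟩ := exists_ZLe (ρ θ) hX.1
  exact ⟨_, X, V, hX.1, hX.2, hV, hZ, rfl⟩

/-- The supporting inequality at `G₀` before passing to the limit `t → 0`. -/
theorem trace_le_of_perturbation (hd : ∀ i j, DifferentiableAt ℝ (fun t => (ρ t).mat i j) θ)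
    (hX₀ : ∃ X, IsLocallyUnbiased ρ θ X) {G₀ V₀ : Matrix (Fin p) (Fin p) ℝ} (hG₀ : G₀.PosDef)
    (hV₀ : V₀ ∈ holevoSet ρ θ) (hopt : (G₀ * V₀).trace = holevoBound ρ θ G₀)
    {X : Fin p → Matrix n n ℂ} (hX : ∀ a, (X a).IsHermitian)
    {V : Matrix (Fin p) (Fin p) ℝ} (hV : V.IsSymm) (hZ : ZLe (ρ θ) X V) {t : ℝ} (h0 : 0 ≤ t)
    (h1 : t ≤ 1) {P : Matrix (Fin p) (Fin p) ℝ}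
    (hP : P * ((1 - t) • (1 : Matrix (Fin p) (Fin p) ℝ) + t • meanDeriv ρ θ X) = 1) :
    (G₀ * V₀).trace ≤ ((Pᵀ * G₀ * P) * ((1 - t) • V₀ + t • V)).trace := by
  have hPu : IsUnit P := IsUnit.of_mul_eq_one _ hP
  have hG : (Pᵀ * G₀ * P).PosDef := by
    rw [← Matrix.conjTranspose_eq_transpose_of_trivial]
    exact hG₀.conjTranspose_mul_mul_same (Matrix.mulVec_injective_of_isUnit hPu)
  -- `V₀ ∈ 𝒱` bounds the Holevo value for the loss `Pᵀ G₀ P` by `tr(Pᵀ G₀ P V₀)`. That infimum is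
  -- only approached, so an unbiased pair `(X', V')` within `ε` of this bound is used.
  refine le_of_forall_pos_le_add fun ε hε => ?_
  have hC := hV₀.2 _ hG
  rw [holevoBound_eq hd] at hC
  obtain ⟨c, ⟨X', V', hX', hm', hV', hZ', rfl⟩, hlt⟩ :=
    exists_lt_of_csInf_lt (holevoValues_nonempty hd hX₀ _) (lt_add_of_pos_right _ hε)
  set Y : Fin p → Matrix n n ℂ := fun a => ((1 - t : ℝ) : ℂ) • X' a + (t : ℂ) • X a with hYdef
  have hYh : ∀ a, (Y a).IsHermitian := fun a => by
    simp only [hYdef, Matrix.IsHermitian, Matrix.conjTranspose_add, Matrix.conjTranspose_smul,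
      (hX a).eq, (hX' a).eq, Complex.star_def, Complex.conj_ofReal]
  set W := (1 - t) • V' + t • V with hWdef
  have hW : W.IsSymm := (hV'.smul _).add (hV.smul _)
  -- The mixture `Y` has mean derivative `(1 - t) 1 + t F`; multiplication by its inverse `P`
  -- restores unbiasedness, so the rescaled pair competes in the infimum for `G₀`.
  have hmem : (G₀ * (P * W * Pᵀ)).trace ∈ holevoValues ρ θ G₀ := by
    refine ⟨mulTuple P Y, P * W * Pᵀ, mulTuple_isHermitian P hYh, ?_, ?_,
      (hZ'.convex hZ h0 h1).mul P, rfl⟩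
    · rw [meanDeriv_mulTuple, meanDeriv_convex, hm', hP]
    · exact hW.mul_mul_transpose P
  have hle := csInf_le (holevoValues_bddBelow hG₀) hmem
  rw [← holevoBound_eq hd, ← hopt] at hle
  have e1 : (G₀ * (P * W * Pᵀ)).trace = ((Pᵀ * G₀ * P) * W).trace := by
    rw [Matrix.mul_assoc Pᵀ, Matrix.mul_assoc Pᵀ, Matrix.trace_mul_comm Pᵀ]
    simp only [Matrix.mul_assoc]
  rw [e1, hWdef, Matrix.mul_add, Matrix.trace_add, Matrix.mul_smul, Matrix.mul_smul,
    Matrix.trace_smul, Matrix.trace_smul, smul_eq_mul, smul_eq_mul] at hle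
  rw [Matrix.mul_add, Matrix.trace_add, Matrix.mul_smul, Matrix.mul_smul,
    Matrix.trace_smul, Matrix.trace_smul, smul_eq_mul, smul_eq_mul]
  have h2 : ((Pᵀ * G₀ * P) * V').trace ≤ ((Pᵀ * G₀ * P) * V₀).trace + ε := by linarith
  nlinarith [mul_le_mul_of_nonneg_left h2 (sub_nonneg.2 h1), mul_nonneg h0 hε.le]

/-- At the optimal `V₀`, every tuple `X` of self-adjoint matrices with `V ≥ Z(X)` satisfies
`2 trace (V₀ G₀ F) ≤ trace (G₀ V) + trace (G₀ V₀)`, where `F` is the derivative of the mean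
of `X`. -/
theorem two_mul_trace_le_of_optimal (hd : ∀ i j, DifferentiableAt ℝ (fun t => (ρ t).mat i j) θ)
    (hX₀ : ∃ X, IsLocallyUnbiased ρ θ X) {G₀ V₀ : Matrix (Fin p) (Fin p) ℝ} (hG₀ : G₀.PosDef)
    (hV₀ : V₀ ∈ holevoSet ρ θ) (hopt : (G₀ * V₀).trace = holevoBound ρ θ G₀)
    {X : Fin p → Matrix n n ℂ} (hX : ∀ a, (X a).IsHermitian)
    {V : Matrix (Fin p) (Fin p) ℝ} (hV : V.IsSymm) (hZ : ZLe (ρ θ) X V) :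
    2 * (G₀ * (meanDeriv ρ θ X * V₀)).trace ≤ (G₀ * V).trace + (G₀ * V₀).trace := by
  set F := meanDeriv ρ θ X with hF
  set K : ℝ → Matrix (Fin p) (Fin p) ℝ := fun t => (1 - t) • 1 + t • F with hK
  have hKc : Continuous K := by fun_prop
  have hK0 : K 0 = 1 := by simp [hK]
  -- The inverse of `K t` in adjugate form, so that continuity at `0` comes from that of the
  -- determinant and the adjugate.
  set P : ℝ → Matrix (Fin p) (Fin p) ℝ := fun t => (K t).det⁻¹ • (K t).adjugate with hPdef
  have hdet : ∀ᶠ t in 𝓝 (0 : ℝ), (K t).det ≠ 0 :=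
    hKc.matrix_det.continuousAt.eventually_ne (by rw [hK0]; simp)
  have hP : ∀ t, (K t).det ≠ 0 → P t * K t = 1 := fun t ht => by
    rw [hPdef, Matrix.smul_mul, Matrix.adjugate_mul, smul_smul, inv_mul_cancel₀ ht, one_smul]
  have hPc : ContinuousAt P 0 :=
    (hKc.matrix_det.continuousAt.inv₀ (by rw [hK0]; simp)).smul hKc.matrix_adjugate.continuousAt
  have hP0 : P 0 = 1 := by simp [hPdef, hK0]
  set Q : ℝ → Matrix (Fin p) (Fin p) ℝ := fun t => P t * (1 - F) with hQ
  have hPQ : ∀ t, (K t).det ≠ 0 → P t = 1 + t • Q t := fun t ht => by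
    have h := hP t ht
    have h2 : K t = 1 - t • (1 - F) := by
      simp only [hK, sub_smul, one_smul, smul_sub]
      abel
    rw [h2, Matrix.mul_sub, Matrix.mul_one, Matrix.mul_smul] at h
    exact sub_eq_iff_eq_add.1 h
  set W : ℝ → Matrix (Fin p) (Fin p) ℝ := fun t => (1 - t) • V₀ + t • V with hW
  have hWc : Continuous W := by fun_prop
  -- With `P t = 1 + t Q t`, `φ t` is the difference quotient of the perturbation inequality. It is
  -- nonnegative for small `t > 0`, and `φ 0 = tr(G₀ (V - V₀)) + 2 tr(G₀ (1 - F) V₀)` is the desired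
  -- inequality.
  set φ : ℝ → ℝ := fun t => (G₀ * (V - V₀)).trace + ((Q t)ᵀ * G₀ * W t).trace +
    (G₀ * Q t * W t).trace + t * ((Q t)ᵀ * G₀ * Q t * W t).trace with hφ
  have hQc : ContinuousAt Q 0 := hPc.mul continuousAt_const
  have htr : ∀ f : ℝ → Matrix (Fin p) (Fin p) ℝ, ContinuousAt f 0 →
      ContinuousAt (fun t => (f t).trace) 0 := fun f hf =>
    (continuous_id.matrix_trace).continuousAt.comp hf
  have hQt : ContinuousAt (fun t => (Q t)ᵀ) 0 :=
    (continuous_id.matrix_transpose).continuousAt.comp hQc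
  have hφc : ContinuousAt φ 0 := by
    refine ((continuousAt_const.add (htr _ ?_)).add (htr _ ?_)).add
      (continuousAt_id.mul (htr _ ?_))
    · exact (hQt.mul continuousAt_const).mul hWc.continuousAt
    · exact (continuousAt_const.mul hQc).mul hWc.continuousAt
    · exact ((hQt.mul continuousAt_const).mul hQc).mul hWc.continuousAt
  have hnn : ∀ᶠ t in 𝓝[>] (0 : ℝ), 0 ≤ φ t := by
    filter_upwards [hdet.filter_mono nhdsWithin_le_nhds, Ioo_mem_nhdsGT (zero_lt_one' ℝ)]
      with t ht ht1
    have h := trace_le_of_perturbation hd hX₀ hG₀ hV₀ hopt hX hV hZ ht1.1.le ht1.2.le (hP t ht)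
    have e : (((P t)ᵀ * G₀ * P t) * W t).trace = (G₀ * V₀).trace + t * φ t := by
      have eW : W t = V₀ + t • (V - V₀) := by
        simp only [hW, sub_smul, one_smul, smul_sub]
        abel
      have e1 : (((P t)ᵀ * G₀ * P t) * W t) = G₀ * W t + t • ((Q t)ᵀ * G₀ * W t) +
          t • (G₀ * Q t * W t) + t • (t • ((Q t)ᵀ * G₀ * Q t * W t)) := by
        rw [hPQ t ht]
        simp only [Matrix.transpose_add, Matrix.transpose_one, Matrix.transpose_smul,
          Matrix.add_mul, Matrix.mul_add, Matrix.one_mul, Matrix.mul_one, Matrix.smul_mul,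
          Matrix.mul_smul, smul_add]
        abel
      have e2 : (G₀ * W t).trace = (G₀ * V₀).trace + t * (G₀ * (V - V₀)).trace := by
        rw [eW, Matrix.mul_add, Matrix.trace_add, Matrix.mul_smul, Matrix.trace_smul, smul_eq_mul]
      rw [e1]
      simp only [Matrix.trace_add, Matrix.trace_smul, smul_eq_mul, e2, hφ]
      ring
    rw [e] at h
    exact nonneg_of_mul_nonneg_right (by linarith) ht1.1
  have hlim : 0 ≤ φ 0 := ge_of_tendsto (hφc.tendsto.mono_left nhdsWithin_le_nhds) hnn
  have hV₀s : V₀ᵀ = V₀ := by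
    rw [← Matrix.conjTranspose_eq_transpose_of_trivial]; exact hV₀.1.1
  have hG₀s : G₀ᵀ = G₀ := by
    rw [← Matrix.conjTranspose_eq_transpose_of_trivial]; exact hG₀.1
  have hQ0 : Q 0 = 1 - F := by rw [hQ]; simp only [hP0, Matrix.one_mul]
  have hW0 : W 0 = V₀ := by simp [hW]
  have e3 : ((1 - F)ᵀ * G₀ * V₀).trace = (G₀ * (1 - F) * V₀).trace := by
    rw [← Matrix.trace_transpose, Matrix.transpose_mul, Matrix.transpose_mul, hV₀s, hG₀s,
      Matrix.transpose_transpose, Matrix.trace_mul_comm]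
  simp only [hφ, hQ0, hW0, e3, zero_mul, add_zero] at hlim
  simp only [Matrix.mul_sub, Matrix.sub_mul, Matrix.mul_one, Matrix.trace_sub,
    Matrix.mul_assoc] at hlim ⊢
  linarith

/-- The supporting inequality for a tuple of any length and a quadratic loss `G̃` pulled back
along `J`. -/
theorem two_mul_trace_le_of_optimal_pullback {q : ℕ}
    (hd : ∀ i j, DifferentiableAt ℝ (fun t => (ρ t).mat i j) θ)
    (hX₀ : ∃ X, IsLocallyUnbiased ρ θ X) {Gt : Matrix (Fin q) (Fin q) ℝ} (hGt : Gt.PosDef)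
    {J : Matrix (Fin q) (Fin p) ℝ} (hG₀ : (Jᵀ * Gt * J).PosDef)
    {V₀ : Matrix (Fin p) (Fin p) ℝ} (hV₀ : V₀ ∈ holevoSet ρ θ)
    (hopt : (Jᵀ * Gt * J * V₀).trace = holevoBound ρ θ (Jᵀ * Gt * J))
    {X : Fin q → Matrix n n ℂ} (hX : ∀ a, (X a).IsHermitian)
    {V : Matrix (Fin q) (Fin q) ℝ} (hV : V.IsSymm) (hZ : ZLe (ρ θ) X V) :
    2 * ((meanDeriv ρ θ X)ᵀ * (Gt * J * V₀)).trace ≤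
      (Gt * V).trace + (Jᵀ * Gt * J * V₀).trace := by
  set G₀ := Jᵀ * Gt * J with hG₀def
  -- The weighted least-squares left inverse of `J`; it turns a `q`-tuple into a `p`-tuple with mean
  -- derivative `A F`.
  set A := G₀⁻¹ * (Jᵀ * Gt) with hA
  have hGu : IsUnit G₀.det := (Matrix.isUnit_iff_isUnit_det _).1 hG₀.isUnit
  have hGts : Gtᵀ = Gt := by
    rw [← Matrix.conjTranspose_eq_transpose_of_trivial]; exact hGt.1
  have hG₀s : G₀ᵀ = G₀ := by
    rw [← Matrix.conjTranspose_eq_transpose_of_trivial]; exact hG₀.1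
  have hV₀s : V₀ᵀ = V₀ := by
    rw [← Matrix.conjTranspose_eq_transpose_of_trivial]; exact hV₀.1.1
  have hGA : G₀ * A = Jᵀ * Gt := by
    rw [hA, ← Matrix.mul_assoc, Matrix.mul_nonsing_inv _ hGu, Matrix.one_mul]
  have hAT : Aᵀ = Gt * J * G₀⁻¹ := by
    rw [hA, Matrix.transpose_mul, Matrix.transpose_mul, Matrix.transpose_transpose,
      Matrix.transpose_nonsing_inv, hG₀s, hGts]
  have hVs : (A * V * Aᵀ).IsSymm := hV.mul_mul_transpose A
  have h := two_mul_trace_le_of_optimal hd hX₀ hG₀ hV₀ hopt (mulTuple_isHermitian A hX) hVs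
    (hZ.mul A)
  rw [meanDeriv_mulTuple] at h
  set F := meanDeriv ρ θ X
  have e1 : (G₀ * (A * F * V₀)).trace = (Fᵀ * (Gt * J * V₀)).trace := by
    rw [Matrix.mul_assoc A, ← Matrix.mul_assoc G₀, hGA, ← Matrix.trace_transpose]
    simp only [Matrix.transpose_mul, Matrix.transpose_transpose, hV₀s, hGts]
    rw [Matrix.mul_assoc V₀, Matrix.trace_mul_comm V₀]
    simp only [Matrix.mul_assoc]
  set E := 1 - J * A with hE
  have hAJ : A * J = 1 := by
    rw [hA, Matrix.mul_assoc, ← hG₀def, Matrix.nonsing_inv_mul _ hGu]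
  -- `E = 1 - J A` is a projection, self-adjoint for the inner product given by `G̃`. Hence `Aᵀ G₀ A
  -- ≤ G̃`, and passing to the `p`-tuple does not increase the loss.
  have hGE : Gt - Gt * J * G₀⁻¹ * Jᵀ * Gt = Eᵀ * Gt * E := by
    have h1 : Gt * E = Gt - Gt * J * G₀⁻¹ * Jᵀ * Gt := by
      rw [hE, Matrix.mul_sub, Matrix.mul_one, hA]
      simp only [Matrix.mul_assoc]
    have h2 : Eᵀ * Gt = Gt * E := by
      rw [hE, Matrix.transpose_sub, Matrix.transpose_one, Matrix.transpose_mul, hAT,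
        Matrix.sub_mul, Matrix.one_mul, Matrix.mul_sub, Matrix.mul_one, hA]
      simp only [Matrix.mul_assoc]
    have h3 : E * E = E := by
      have : J * A * (J * A) = J * A := by
        rw [Matrix.mul_assoc, ← Matrix.mul_assoc A, hAJ, Matrix.one_mul]
      rw [hE, Matrix.mul_sub, Matrix.mul_one, Matrix.sub_mul, Matrix.one_mul, this]
      simp
    rw [← h1, h2, Matrix.mul_assoc, h3]
  have hpsd : (Gt - Gt * J * G₀⁻¹ * Jᵀ * Gt).PosSemidef := by
    rw [hGE, ← Matrix.conjTranspose_eq_transpose_of_trivial]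
    exact hGt.posSemidef.conjTranspose_mul_mul_same E
  have h4 := hpsd.trace_mul_nonneg_real (hZ.posSemidef hV)
  have e2 : (G₀ * (A * V * Aᵀ)).trace = (Gt * J * G₀⁻¹ * Jᵀ * Gt * V).trace := by
    rw [Matrix.mul_assoc A, ← Matrix.mul_assoc G₀, hGA, hAT, ← Matrix.mul_assoc,
      Matrix.trace_mul_comm]
    simp only [Matrix.mul_assoc]
  rw [Matrix.sub_mul, Matrix.trace_sub] at h4
  rw [e1, e2] at h
  linarith

end HolevoBound

/-! ### Existence and positive definiteness of the optimal `V₀`. -/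

section Attainment

theorem combo_ofReal_isHermitian {n ι : Type*} [Fintype ι] {X : ι → Matrix n n ℂ}
    (hX : ∀ a, (X a).IsHermitian) (u : ι → ℝ) :
    (combo (fun i => (u i : ℂ)) X).IsHermitian := by
  unfold combo Matrix.IsHermitian
  rw [Matrix.conjTranspose_sum]
  refine Finset.sum_congr rfl fun b _ => ?_
  rw [Matrix.conjTranspose_smul, (hX b).eq]
  simp

variable {n : Type*} [Fintype n] {p : ℕ}

theorem sqMoment_eq_sum_normSq {σ : DensityMatrix n} {B : Matrix n n ℂ} (hB : σ.mat = Bᴴ * B)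
    {X : Matrix n n ℂ} (hX : X.IsHermitian) :
    σ.sqMoment X = ∑ i, ∑ j, (((B * X) i j).re ^ 2 + ((B * X) i j).im ^ 2) := by
  have h1 : (σ.mat * (Xᴴ * X)).trace = ((B * X)ᴴ * (B * X)).trace := by
    rw [Matrix.conjTranspose_mul, hB, hX.eq, ← Matrix.mul_assoc, Matrix.trace_mul_comm]
    simp only [Matrix.mul_assoc]
  rw [DensityMatrix.sqMoment, h1, Matrix.trace, Complex.re_sum, Finset.sum_comm]
  refine Finset.sum_congr rfl fun j _ => ?_
  rw [Matrix.diag_apply, Matrix.mul_apply, Complex.re_sum]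
  refine Finset.sum_congr rfl fun i _ => ?_
  rw [Matrix.conjTranspose_apply, Complex.star_def, ← Complex.normSq_eq_conj_mul_self,
    Complex.ofReal_re, Complex.normSq_apply]
  ring

/-- A self-adjoint matrix whose range is in a subspace on which the quadratic form of `D` vanishes
has zero trace against `D`. -/
theorem trace_mul_re_eq_zero_of_form_eq_zero {D X : Matrix n n ℂ} (hD : D.IsHermitian)
    (hX : X.IsHermitian) (h : ∀ w : n → ℂ, (star (X *ᵥ w) ⬝ᵥ (D *ᵥ (X *ᵥ w))).re = 0) :
    (D * X).trace.re = 0 := by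
  classical
  have hH : (X * D * X).IsHermitian := by
    rw [Matrix.IsHermitian, Matrix.conjTranspose_mul, Matrix.conjTranspose_mul, hX.eq, hD.eq,
      Matrix.mul_assoc]
  have hform : ∀ w : n → ℂ, star w ⬝ᵥ ((X * D * X) *ᵥ w) = 0 := fun w => by
    have e : star w ⬝ᵥ ((X * D * X) *ᵥ w) = star (X *ᵥ w) ⬝ᵥ (D *ᵥ (X *ᵥ w)) := by
      rw [Matrix.star_mulVec, hX.eq, ← Matrix.mulVec_mulVec, ← Matrix.mulVec_mulVec,
        Matrix.dotProduct_mulVec (star w)]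
    apply Complex.ext
    · rw [e]; exact h w
    · exact hH.im_star_dotProduct_mulVec_self w
  have hpsd : (X * D * X).PosSemidef :=
    Matrix.PosSemidef.of_dotProduct_mulVec_nonneg hH fun w => (hform w).ge
  -- A positive semidefinite matrix of trace zero vanishes. Then `(D X)² = 0`, and a nilpotent
  -- matrix has trace zero.
  have h0 : X * D * X = 0 := by
    rw [← hpsd.trace_eq_zero_iff, Matrix.trace]
    refine Finset.sum_eq_zero fun i _ => ?_
    have := hform (Pi.single i 1)
    simpa [Matrix.mulVec_single_one, ← Pi.single_star] using this
  have hnil : IsNilpotent (D * X) := ⟨2, by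
    rw [pow_two, Matrix.mul_assoc, ← Matrix.mul_assoc X, h0, Matrix.mul_zero]⟩
  rw [(Matrix.isNilpotent_trace_of_isNilpotent hnil).eq_zero, Complex.zero_re]

variable {ρ : (Fin p → ℝ) → DensityMatrix n} {θ : Fin p → ℝ}

theorem entryDeriv_isHermitian (hd : ∀ i j, DifferentiableAt ℝ (fun t => (ρ t).mat i j) θ)
    (v : Fin p → ℝ) : (entryDeriv (fun t => (ρ t).mat) θ v).IsHermitian := by
  ext i j
  rw [Matrix.conjTranspose_apply]
  have h1 : (fun t => (ρ t).mat i j) = fun t => Complex.conjCLE ((ρ t).mat j i) := by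
    ext t
    exact ((ρ t).posSemidef.1.apply i j).symm
  have h2 := ((Complex.conjCLE : ℂ →L[ℝ] ℂ).hasFDerivAt.comp θ (hd j i).hasFDerivAt).fderiv
  change _ = fderiv ℝ (fun t => (ρ t).mat i j) θ v
  rw [h1]
  exact (DFunLike.congr_fun h2 v).symm

/-- The derivative of a family of states vanishes as a quadratic form on the kernel of the state. -/
theorem form_entryDeriv_eq_zero (hd : ∀ i j, DifferentiableAt ℝ (fun t => (ρ t).mat i j) θ)
    (v : Fin p → ℝ) {w : n → ℂ} (hw : (ρ θ).mat *ᵥ w = 0) :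
    (star w ⬝ᵥ (entryDeriv (fun t => (ρ t).mat) θ v *ᵥ w)).re = 0 := by
  have e : ∀ A : Matrix n n ℂ, star w ⬝ᵥ (A *ᵥ w) = (A * vecMulVec w (star w)).trace := fun A => by
    rw [Matrix.mul_vecMulVec, Matrix.trace_vecMulVec, dotProduct_comm]
  rw [e, ← fderiv_trace_mul_re (R := fun t => (ρ t).mat) hd]
  -- `⟨w, ρ(t) w⟩` is nonnegative for every `t` and zero at `θ`, so `θ` is a minimum and the
  -- derivative vanishes.
  have hmin : IsLocalMin (fun t => ((ρ t).mat * vecMulVec w (star w)).trace.re) θ := by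
    refine Eventually.of_forall fun t => ?_
    simp only [← e, hw, dotProduct_zero, Complex.zero_re]
    exact (Complex.nonneg_iff.1 ((ρ t).posSemidef.dotProduct_mulVec_nonneg w)).1
  rw [hmin.fderiv_eq_zero]
  rfl

/-- A Cramér–Rao type bound: `|trace (∂ρ X)|² ≤ K trace (ρ X²)` for self-adjoint `X`. -/
theorem exists_sq_trace_entryDeriv_le
    (hd : ∀ i j, DifferentiableAt ℝ (fun t => (ρ t).mat i j) θ) (v : Fin p → ℝ) :
    ∃ K : ℝ, 0 < K ∧ ∀ X : Matrix n n ℂ, X.IsHermitian →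
      (entryDeriv (fun t => (ρ t).mat) θ v * X).trace.re ^ 2 ≤ K * (ρ θ).sqMoment X := by
  classical
  obtain ⟨B, hB⟩ := posSemidef_exists_factor (ρ θ).posSemidef
  set D := entryDeriv (fun t => (ρ t).mat) θ v with hD
  -- Symmetrising by `X + Xᴴ` gives real-linear functionals on the space of all matrices; on
  -- self-adjoint `X` it only doubles `X`.
  let ℓ : Matrix n n ℂ →ₗ[ℝ] ℝ :=
    { toFun := fun X => (D * (X + Xᴴ)).trace.re
      map_add' := fun X Y => by
        simp only [Matrix.conjTranspose_add, Matrix.mul_add, Matrix.trace_add, Complex.add_re]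
        ring
      map_smul' := fun r X => by
        simp [Matrix.conjTranspose_smul, mul_add] }
  let L : (n × n) × Bool → Matrix n n ℂ →ₗ[ℝ] ℝ := fun k =>
    { toFun := fun X => if k.2 then ((B * (X + Xᴴ)) k.1.1 k.1.2).re
        else ((B * (X + Xᴴ)) k.1.1 k.1.2).im
      map_add' := fun X Y => by
        have : B * (X + Y + (X + Y)ᴴ) = B * (X + Xᴴ) + B * (Y + Yᴴ) := by
          simp only [Matrix.conjTranspose_add, Matrix.mul_add]
          abel
        rw [this]
        split_ifs <;> simp
      map_smul' := fun r X => by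
        have : B * (r • X + (r • X)ᴴ) = r • (B * (X + Xᴴ)) := by
          simp [Matrix.conjTranspose_smul, Matrix.mul_add]
        rw [this]
        split_ifs <;> simp }
  -- If `B (X + Xᴴ) = 0`, the range of `X + Xᴴ` lies in the kernel of `ρ`, where the form of `D`
  -- vanishes. So `ℓ` is a linear combination of the coordinates `L k`, and Cauchy–Schwarz gives the
  -- bound.
  have hker : ⨅ k, LinearMap.ker (L k) ≤ LinearMap.ker ℓ := by
    intro X hX
    rw [Submodule.mem_iInf] at hX
    rw [LinearMap.mem_ker]
    have hBX : B * (X + Xᴴ) = 0 := by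
      ext i j
      apply Complex.ext
      · simpa [L] using LinearMap.mem_ker.1 (hX ((i, j), true))
      · simpa [L] using LinearMap.mem_ker.1 (hX ((i, j), false))
    refine trace_mul_re_eq_zero_of_form_eq_zero (entryDeriv_isHermitian hd v)
      (Matrix.isHermitian_add_transpose_self X) fun w => form_entryDeriv_eq_zero hd v ?_
    rw [Matrix.mulVec_mulVec, hB, Matrix.mul_assoc, hBX, Matrix.mul_zero, Matrix.zero_mulVec]
  obtain ⟨c, hc⟩ := (Submodule.mem_span_range_iff_exists_fun ℝ).1 (mem_span_of_iInf_ker_le_ker hker)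
  -- The summand 1 only ensures that the constant is positive.
  refine ⟨∑ k, c k ^ 2 + 1, by positivity, fun X hX => ?_⟩
  have hXX : X + Xᴴ = (2 : ℝ) • X := by rw [hX.eq, two_smul]
  have h1 : (2 * (D * X).trace.re) = ∑ k, c k * L k X := by
    have := DFunLike.congr_fun hc X
    rw [LinearMap.sum_apply] at this
    simp only [LinearMap.smul_apply, smul_eq_mul] at this
    rw [this]
    change _ = (D * (X + Xᴴ)).trace.re
    rw [hXX]
    simp
  have h2 : ∑ k, L k X ^ 2 = 4 * (ρ θ).sqMoment X := by
    rw [sqMoment_eq_sum_normSq hB hX, Fintype.sum_prod_type, Fintype.sum_prod_type, Finset.mul_sum]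
    refine Finset.sum_congr rfl fun i _ => ?_
    rw [Finset.mul_sum]
    refine Finset.sum_congr rfl fun j _ => ?_
    rw [Fintype.sum_bool]
    change ((B * (X + Xᴴ)) i j).re ^ 2 + ((B * (X + Xᴴ)) i j).im ^ 2 = _
    rw [hXX, Matrix.mul_smul, Matrix.smul_apply, Complex.smul_re, Complex.smul_im, smul_eq_mul,
      smul_eq_mul]
    ring
  have h3 := Finset.sum_mul_sq_le_sq_mul_sq Finset.univ c (fun k => L k X)
  rw [← h1, h2] at h3
  nlinarith [(ρ θ).sqMoment_nonneg X]

/-- The matrices in the definition of the Holevo bound are uniformly positive definite. -/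
theorem exists_le_quadForm_of_unbiased
    (hd : ∀ i j, DifferentiableAt ℝ (fun t => (ρ t).mat i j) θ) {u : Fin p → ℝ} (hu : u ≠ 0) :
    ∃ ε : ℝ, 0 < ε ∧ ∀ (X : Fin p → Matrix n n ℂ) (V : Matrix (Fin p) (Fin p) ℝ),
      (∀ j, (X j).IsHermitian) → meanDeriv ρ θ X = 1 → ZLe (ρ θ) X V → ε ≤ u ⬝ᵥ (V *ᵥ u) := by
  obtain ⟨K, hK, hb⟩ := exists_sq_trace_entryDeriv_le hd u
  have hpos : 0 < u ⬝ᵥ u := by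
    have := Matrix.dotProduct_star_self_pos_iff (v := u)
    simpa using this.2 hu
  -- Unbiasedness gives `tr(∂_uρ · ∑ u_i X_i) = u·u`. The Cramér–Rao bound and `Z(X) ≤ V` then give
  -- `(u·u)² ≤ K uᵀ V u`.
  refine ⟨(u ⬝ᵥ u) ^ 2 / K, by positivity, fun X V hX hm hZ => ?_⟩
  have h1 := hb _ (combo_ofReal_isHermitian hX u)
  have h2 := hZ fun i => (u i : ℂ)
  rw [quadForm_ofReal] at h2
  have h3 : (entryDeriv (fun t => (ρ t).mat) θ u * combo (fun i => (u i : ℂ)) X).trace.re =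
      u ⬝ᵥ u := by
    have e : entryDeriv (fun t => (ρ t).mat) θ u = ∑ i, (u i : ℂ) • stateDeriv ρ θ i := by
      ext a b
      rw [Matrix.sum_apply]
      simp only [stateDeriv, entryDeriv, Matrix.smul_apply, Matrix.of_apply, smul_eq_mul]
      conv_lhs => rw [pi_eq_sum_univ u]
      rw [map_sum]
      refine Finset.sum_congr rfl fun i _ => ?_
      rw [map_smul, Complex.real_smul]
      congr 3
      ext j
      simp [Pi.single_apply, eq_comm]
    have hm' : ∀ i a, (stateDeriv ρ θ i * X a).trace.re = if a = i then 1 else 0 := fun i a => by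
      have := congr_fun (congr_fun hm a) i
      rwa [Matrix.one_apply] at this
    rw [e, combo, Matrix.sum_mul, Matrix.trace_sum, Complex.re_sum, dotProduct]
    refine Finset.sum_congr rfl fun i _ => ?_
    rw [Matrix.mul_sum, Matrix.trace_sum, Complex.re_sum, Finset.sum_eq_single i]
    · simp [hm']
    · intro b _ hb
      simp [hm', hb]
    · simp
  rw [h3] at h1
  rw [div_le_iff₀ hK]
  nlinarith

/-- The infimum in the bound is attained in the set `𝒱`. -/
theorem exists_holevoOptimal (hd : ∀ i j, DifferentiableAt ℝ (fun t => (ρ t).mat i j) θ)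
    (hX₀ : ∃ X, IsLocallyUnbiased ρ θ X) {G₀ : Matrix (Fin p) (Fin p) ℝ} (hG₀ : G₀.PosDef) :
    ∃ V₀ ∈ holevoSet ρ θ, (G₀ * V₀).trace = holevoBound ρ θ G₀ := by
  obtain ⟨c, hanti, hlim, hmem⟩ := exists_seq_tendsto_sInf (holevoValues_nonempty hd hX₀ G₀)
    (holevoValues_bddBelow hG₀)
  rw [← holevoBound_eq hd] at hlim
  choose X V hX hm hV hZ hc using hmem
  have hpsd : ∀ k, (V k).PosSemidef := fun k => (hZ k).posSemidef (hV k)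
  obtain ⟨B, hB⟩ := hG₀.posSemidef.exists_real_factor
  have hBu : IsUnit B.det := by
    have h := (Matrix.isUnit_iff_isUnit_det _).1 hG₀.isUnit
    rw [hB, Matrix.det_mul] at h
    exact isUnit_of_mul_isUnit_right h
  -- `W k` is positive semidefinite with trace `c k ≤ c 0`, which bounds its entries; invertibility
  -- of `B` carries convergence back to `V k`.
  set W : ℕ → Matrix (Fin p) (Fin p) ℝ := fun k => B * V k * Bᵀ with hW
  have hWpsd : ∀ k, (W k).PosSemidef := fun k => by
    have := (hpsd k).mul_mul_conjTranspose_same B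
    rwa [Matrix.conjTranspose_eq_transpose_of_trivial] at this
  have hWtr : ∀ k, (W k).trace = c k := fun k => by
    rw [hW, hc, hB, Matrix.trace_mul_comm, ← Matrix.mul_assoc]
  have hVW : ∀ k, V k = B⁻¹ * W k * (B⁻¹)ᵀ := fun k => by
    rw [hW, Matrix.transpose_nonsing_inv]
    have hBu' : IsUnit (Bᵀ).det := by rwa [Matrix.det_transpose]
    simp only [Matrix.mul_assoc]
    rw [Matrix.mul_nonsing_inv _ hBu', Matrix.mul_one, ← Matrix.mul_assoc,
      Matrix.nonsing_inv_mul _ hBu, Matrix.one_mul]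
  have hcomp : IsCompact (Set.pi Set.univ fun _ : Fin p => Set.pi Set.univ fun _ : Fin p =>
      Set.Icc (-c 0) (c 0)) :=
    isCompact_univ_pi fun _ => isCompact_univ_pi fun _ => isCompact_Icc
  have hWmem : ∀ k, (fun i j => W k i j) ∈ Set.pi Set.univ fun _ : Fin p =>
      Set.pi Set.univ fun _ : Fin p => Set.Icc (-c 0) (c 0) := fun k i _ j _ => by
    have h1 := (hWpsd k).abs_apply_le_trace i j
    rw [hWtr] at h1
    exact abs_le.1 (h1.trans (hanti (Nat.zero_le k)))
  -- Only the matrices `V k` need to converge, not the observables `X k`: each `V k` satisfies the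
  -- inequalities defining `𝒱`, and these are closed conditions.
  obtain ⟨W₀, -, φ, hφ, hWlim⟩ := hcomp.tendsto_subseq hWmem
  have hWlim' : Tendsto (fun k => W (φ k)) atTop (𝓝 (Matrix.of W₀)) := hWlim
  set V₀ := B⁻¹ * Matrix.of W₀ * (B⁻¹)ᵀ with hV₀
  have hVlim : Tendsto (fun k => V (φ k)) atTop (𝓝 V₀) := by
    have hcont : Continuous fun A : Matrix (Fin p) (Fin p) ℝ => B⁻¹ * A * (B⁻¹)ᵀ := by fun_prop
    have := (hcont.tendsto (Matrix.of W₀)).comp hWlim'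
    refine this.congr fun k => ?_
    simp only [Function.comp]
    rw [← hVW]
  have htr : ∀ G : Matrix (Fin p) (Fin p) ℝ,
      Tendsto (fun k => (G * V (φ k)).trace) atTop (𝓝 (G * V₀).trace) := fun G => by
    have hcont : Continuous fun A : Matrix (Fin p) (Fin p) ℝ => (G * A).trace := by fun_prop
    exact (hcont.tendsto V₀).comp hVlim
  have hsym : V₀.IsSymm := by
    have h1 : Tendsto (fun k => (V (φ k))ᵀ) atTop (𝓝 V₀ᵀ) :=
      ((continuous_id.matrix_transpose).tendsto V₀).comp hVlim
    refine tendsto_nhds_unique h1 (hVlim.congr fun k => (hV (φ k)).eq.symm)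
  refine ⟨V₀, ⟨?_, fun G hG => ?_⟩, ?_⟩
  -- Positive definiteness is not a closed condition; it survives because `ε` depends on `u` and `θ`
  -- but not on `k`.
  · refine Matrix.PosDef.of_dotProduct_mulVec_pos
      (by rw [Matrix.IsHermitian, Matrix.conjTranspose_eq_transpose_of_trivial]; exact hsym)
      fun {u} hu => ?_
    obtain ⟨ε, hε, hb⟩ := exists_le_quadForm_of_unbiased hd hu
    have hcont : Continuous fun A : Matrix (Fin p) (Fin p) ℝ => u ⬝ᵥ (A *ᵥ u) := by
      fun_prop
    rw [star_trivial]
    exact hε.trans_le (ge_of_tendsto' ((hcont.tendsto V₀).comp hVlim) fun k =>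
      hb _ _ (hX _) (hm _) (hZ _))
  · refine ge_of_tendsto' (htr G) fun k => ?_
    rw [holevoBound_eq hd]
    exact csInf_le (holevoValues_bddBelow hG) ⟨_, _, hX _, hm _, hV _, hZ _, rfl⟩
  · refine tendsto_nhds_unique (htr G₀) ?_
    exact (hlim.comp hφ.tendsto_atTop).congr fun k => hc _

theorem holevoOptimal_spec (hd : ∀ i j, DifferentiableAt ℝ (fun t => (ρ t).mat i j) θ)
    (hX₀ : ∃ X, IsLocallyUnbiased ρ θ X) {G₀ : Matrix (Fin p) (Fin p) ℝ} (hG₀ : G₀.PosDef) :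
    holevoOptimal ρ θ G₀ ∈ holevoSet ρ θ ∧
      (G₀ * holevoOptimal ρ θ G₀).trace = holevoBound ρ θ G₀ :=
  Classical.epsilon_spec (p := fun V => V ∈ holevoSet ρ θ ∧
    (G₀ * V).trace = holevoBound ρ θ G₀) (exists_holevoOptimal hd hX₀ hG₀)

end Attainment

theorem BddMeasurable.integrable_real {X : Type*} [MeasurableSpace X] {f : X → ℝ}
    (hf : BddMeasurable fun x => (f x : ℂ)) (μ : Measure X) [IsFiniteMeasure μ] :
    Integrable f μ := by
  simpa using (hf.integrable μ).re

theorem BddMeasurable.mul_real {X : Type*} [MeasurableSpace X] {f g : X → ℝ}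
    (hf : BddMeasurable fun x => (f x : ℂ)) (hg : BddMeasurable fun x => (g x : ℂ)) :
    BddMeasurable fun x => ((f x * g x : ℝ) : ℂ) := by
  simpa using hf.mul hg

theorem BddMeasurable.sub_const_real {X : Type*} [MeasurableSpace X] {f : X → ℝ}
    (hf : BddMeasurable fun x => (f x : ℂ)) (c : ℝ) :
    BddMeasurable fun x => ((f x - c : ℝ) : ℂ) := by
  simpa [sub_eq_add_neg] using hf.add (BddMeasurable.const (-c : ℂ))

/-! ### The information inequality for `N` copies at a fixed parameter. -/

section Pointwise

theorem trace_mul_of_isHermitian {n : Type*} [Fintype n] {A B : Matrix n n ℂ}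
    (hA : A.IsHermitian) (hB : B.IsHermitian) :
    (A * B).trace = ((A * B).trace.re : ℂ) := by
  have h : star (A * B).trace = (A * B).trace := by
    rw [← Matrix.trace_conjTranspose, Matrix.conjTranspose_mul, hA.eq, hB.eq,
      Matrix.trace_mul_comm]
  exact (Complex.conj_eq_iff_re.1 h).symm

variable {n : Type*} [Fintype n] [DecidableEq n] {N p q : ℕ}

/-- Applied to `Y = ∂_iρ`, whose trace has zero real part, this shows that subtracting a constant
from an estimator does not change the derivative of its mean. -/
theorem trace_mul_oneCopy_one {A : Matrix n n ℂ} (hA : A.trace = 1) (Y : Matrix n n ℂ) :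
    (Y * oneCopy A (1 : Matrix (Fin N → n) (Fin N → n) ℂ)).trace = N * Y.trace := by
  rw [trace_mul_oneCopy]
  have h : ∀ k : Fin N, (piTensor (Function.update (fun _ => A) k Y) *
      (1 : Matrix (Fin N → n) (Fin N → n) ℂ)).trace = Y.trace := fun k => by
    rw [Matrix.mul_one, trace_piTensor, Finset.prod_eq_single k]
    · simp
    · intro l _ hl
      simp [hl, hA]
    · simp
  rw [Finset.sum_congr rfl fun k _ => h k]
  simp

theorem trace_stateDeriv_re {ρ : (Fin p → ℝ) → DensityMatrix n} {θ : Fin p → ℝ}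
    (hd : ∀ i j, DifferentiableAt ℝ (fun t => (ρ t).mat i j) θ) (i : Fin p) :
    (stateDeriv ρ θ i).trace.re = 0 := by
  have h := fderiv_trace_mul_re (R := fun t => (ρ t).mat) hd 1 (Pi.single i 1)
  simp only [Matrix.mul_one, (ρ _).trace_eq_one, Complex.one_re] at h
  rw [stateDeriv, ← h]
  simp

variable {X : Type*} [MeasurableSpace X]

theorem POVM.integral_real_isHermitian (M : POVM X n) (f : X → ℝ) :
    (M.integral fun x => (f x : ℂ)).IsHermitian := by
  rw [Matrix.IsHermitian, ← M.integral_star]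
  simp

/-- The matrix of second moments of a tuple of functions. -/
def momentMatrix (μ : Measure X) (h : Fin q → X → ℝ) : Matrix (Fin q) (Fin q) ℝ :=
  Matrix.of fun a b => ∫ x, h a x * h b x ∂μ

theorem momentMatrix_isSymm (μ : Measure X) (h : Fin q → X → ℝ) : (momentMatrix μ h).IsSymm := by
  ext a b
  simp only [momentMatrix, Matrix.transpose_apply, Matrix.of_apply, mul_comm]

theorem quadForm_momentMatrix (μ : Measure X) [IsFiniteMeasure μ] {h : Fin q → X → ℝ}
    (hh : ∀ a, BddMeasurable fun x => (h a x : ℂ)) (c : Fin q → ℂ) :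
    quadForm (momentMatrix μ h) c = ∫ x, ‖∑ a, c a * (h a x : ℂ)‖ ^ 2 ∂μ := by
  have hi : ∀ a b, Integrable (fun x => h a x * h b x) μ := fun a b =>
    ((hh a).mul_real (hh b)).integrable_real μ
  have e : ∀ x, ‖∑ a, c a * (h a x : ℂ)‖ ^ 2 =
      ∑ a, ∑ b, (star (c a) * c b).re * (h a x * h b x) := fun x => by
    have : ((‖∑ a, c a * (h a x : ℂ)‖ ^ 2 : ℝ) : ℂ) =
        ∑ a, ∑ b, (star (c a) * c b) * ((h a x * h b x : ℝ) : ℂ) := by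
      rw [Complex.ofReal_pow, ← Complex.conj_mul', map_sum, Finset.sum_mul_sum]
      refine Finset.sum_congr rfl fun a _ => Finset.sum_congr rfl fun b _ => ?_
      simp only [map_mul, Complex.conj_ofReal, Complex.star_def]
      push_cast
      ring
    have h2 := congrArg Complex.re this
    simpa only [Complex.ofReal_re, Complex.re_sum, Complex.re_mul_ofReal] using h2
  simp_rw [e]
  rw [integral_finsetSum _ fun a _ => integrable_finsetSum _ fun b _ => (hi a b).const_mul _]
  simp_rw [integral_finsetSum _ fun b _ => (hi _ b).const_mul _, integral_const_mul]
  rw [quadForm, dotProduct, Complex.re_sum]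
  refine Finset.sum_congr rfl fun a _ => ?_
  rw [Matrix.mulVec, dotProduct, Finset.mul_sum, Complex.re_sum]
  refine Finset.sum_congr rfl fun b _ => ?_
  rw [Matrix.map_apply, Pi.star_apply, mul_left_comm, Complex.re_ofReal_mul, mul_comm]
  rfl

/-- The one-copy reduction of centred estimators is dominated by `N` times their covariance. -/
theorem zLe_oneCopy_momentMatrix (σ : DensityMatrix n) (hN : 0 < N) (M : POVM X (Fin N → n))
    {h : Fin q → X → ℝ} (hh : ∀ a, BddMeasurable fun x => (h a x : ℂ))
    (h0 : ∀ a, ∫ x, h a x ∂(outcomeLaw (σ.tensorPow N) M) = 0) :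
    ZLe σ (fun a => oneCopy σ.mat (M.integral fun x => (h a x : ℂ)))
      ((N : ℝ) • momentMatrix (outcomeLaw (σ.tensorPow N) M) h) := by
  intro c
  have hF : ∀ a, BddMeasurable fun x => c a * (h a x : ℂ) := fun a =>
    (BddMeasurable.const (c a)).mul (hh a)
  have hT : combo c (fun a => oneCopy σ.mat (M.integral fun x => (h a x : ℂ))) =
      oneCopy σ.mat (M.integral fun x => ∑ a, c a * (h a x : ℂ)) := by
    rw [M.integral_sum _ hF, map_sum, combo]
    refine Finset.sum_congr rfl fun a _ => ?_
    rw [M.integral_const_mul, map_smul]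
  have hz : ((σ.tensorPow N).mat * M.integral fun x => ∑ a, c a * (h a x : ℂ)).trace = 0 := by
    rw [M.integral_sum _ hF, Matrix.mul_sum, Matrix.trace_sum]
    refine Finset.sum_eq_zero fun a _ => ?_
    rw [M.integral_const_mul, Matrix.mul_smul, Matrix.trace_smul,
      trace_mul_of_isHermitian (σ.tensorPow N).posSemidef.1 (M.integral_real_isHermitian _),
      ← integral_outcomeLaw _ M (hh a), h0 a]
    simp
  have h1 := re_trace_oneCopy_sq_le σ hN hz
  have h2 := re_trace_integral_sq_le (σ.tensorPow N) M (BddMeasurable.sum Finset.univ hF)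
  have h3 := quadForm_add_smul (momentMatrix (outcomeLaw (σ.tensorPow N) M) h) 0 N 0 c
  rw [zero_smul, add_zero, zero_mul, add_zero, quadForm_momentMatrix _ hh] at h3
  rw [hT, h3]
  exact h1.trans (mul_le_mul_of_nonneg_left h2 (Nat.cast_nonneg N))

/-- Nonnegativity of the form of `G` at `r g - G⁻¹ δ`, divided by `r`. -/
theorem two_mul_dotProduct_le {G : Matrix (Fin q) (Fin q) ℝ} (hG : G.PosDef) (g δ : Fin q → ℝ)
    {r : ℝ} (hr : 0 < r) :
    2 * (g ⬝ᵥ δ) ≤ r * (g ⬝ᵥ (G *ᵥ g)) + (δ ⬝ᵥ (G⁻¹ *ᵥ δ)) / r := by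
  have hGu : IsUnit G.det := (Matrix.isUnit_iff_isUnit_det _).1 hG.isUnit
  have hGs : Gᵀ = G := by
    rw [← Matrix.conjTranspose_eq_transpose_of_trivial]; exact hG.1
  have hw : G *ᵥ (G⁻¹ *ᵥ δ) = δ := by
    rw [Matrix.mulVec_mulVec, Matrix.mul_nonsing_inv _ hGu, Matrix.one_mulVec]
  have h := hG.posSemidef.dotProduct_mulVec_nonneg (r • g - G⁻¹ *ᵥ δ)
  have h2 : (G⁻¹ *ᵥ δ) ⬝ᵥ (G *ᵥ g) = g ⬝ᵥ δ := by
    rw [Matrix.dotProduct_mulVec, ← Matrix.mulVec_transpose, hGs, hw, dotProduct_comm]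
  simp only [star_trivial, Matrix.mulVec_sub, Matrix.mulVec_smul, sub_dotProduct, dotProduct_sub,
    smul_dotProduct, dotProduct_smul, hw, h2, smul_eq_mul] at h
  rw [dotProduct_comm (G⁻¹ *ᵥ δ) δ] at h
  have h3 : r * (2 * (g ⬝ᵥ δ)) ≤ r * (r * (g ⬝ᵥ (G *ᵥ g)) + (δ ⬝ᵥ (G⁻¹ *ᵥ δ)) / r) := by
    rw [mul_add, mul_div_cancel₀ _ hr.ne']
    linarith
  exact le_of_mul_le_mul_left h3 hr

/-- The information inequality for the joint measurement of `N` copies, in terms of the mean `g`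
and the derivative of the mean of a bounded estimator error `f`. -/
theorem two_mul_mean_add_trace_le {ρ : (Fin p → ℝ) → DensityMatrix n} {θ : Fin p → ℝ}
    (hd : ∀ i j, DifferentiableAt ℝ (fun t => (ρ t).mat i j) θ)
    (hX₀ : ∃ X, IsLocallyUnbiased ρ θ X) {Gt : Matrix (Fin q) (Fin q) ℝ} (hGt : Gt.PosDef)
    {J : Matrix (Fin q) (Fin p) ℝ} (hG₀ : (Jᵀ * Gt * J).PosDef)
    {V₀ : Matrix (Fin p) (Fin p) ℝ} (hV₀ : V₀ ∈ holevoSet ρ θ)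
    (hopt : (Jᵀ * Gt * J * V₀).trace = holevoBound ρ θ (Jᵀ * Gt * J))
    (hN : 0 < N) (M : POVM X (Fin N → n)) {f : Fin q → X → ℝ}
    (hf : ∀ a, BddMeasurable fun x => (f a x : ℂ)) (δ : Fin q → ℝ) :
    2 * (∑ a, (((ρ θ).tensorPow N).mat * M.integral fun x => (f a x : ℂ)).trace.re * δ a +
        ∑ a, ∑ i, (stateDeriv ρ θ i *
          oneCopy (ρ θ).mat (M.integral fun x => (f a x : ℂ))).trace.re * (Gt * J * V₀) a i) ≤
      N * ∫ x, (fun a => f a x) ⬝ᵥ (Gt *ᵥ fun a => f a x) ∂(outcomeLaw ((ρ θ).tensorPow N) M) +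
        (δ ⬝ᵥ (Gt⁻¹ *ᵥ δ)) / N + holevoBound ρ θ (Jᵀ * Gt * J) := by
  set P := outcomeLaw ((ρ θ).tensorPow N) M with hP
  set g : Fin q → ℝ := fun a =>
    (((ρ θ).tensorPow N).mat * M.integral fun x => (f a x : ℂ)).trace.re with hg
  have hgi : ∀ a, ∫ x, f a x ∂P = g a := fun a => integral_outcomeLaw _ M (hf a)
  -- The factor `N` in the moment reduction requires centred operators. The mean `g` is the value at
  -- the fixed `θ`, so this is subtraction of a constant.
  set h : Fin q → X → ℝ := fun a x => f a x - g a with hh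
  have hhb : ∀ a, BddMeasurable fun x => (h a x : ℂ) := fun a => (hf a).sub_const_real (g a)
  have hfi : ∀ a, Integrable (f a) P := fun a => (hf a).integrable_real P
  have hffi : ∀ a b, Integrable (fun x => f a x * f b x) P := fun a b =>
    ((hf a).mul_real (hf b)).integrable_real P
  have hh0 : ∀ a, ∫ x, h a x ∂P = 0 := fun a => by
    rw [hh, integral_sub (hfi a) (integrable_const _), hgi]
    simp
  have hMh : ∀ a, M.integral (fun x => (h a x : ℂ)) =
      M.integral (fun x => (f a x : ℂ)) - (g a : ℂ) • 1 := fun a => by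
    have e : (fun x => (h a x : ℂ)) = fun x => (f a x : ℂ) + (-(g a : ℂ)) * 1 := by
      ext x
      simp [hh, sub_eq_add_neg]
    rw [e, M.integral_add (hf a) ((BddMeasurable.const _).mul (BddMeasurable.const _)),
      M.integral_const_mul, M.integral_one, neg_smul, sub_eq_add_neg]
  have hZ := zLe_oneCopy_momentMatrix (ρ θ) hN M hhb hh0
  have hherm : ∀ a, (oneCopy (ρ θ).mat (M.integral fun x => (h a x : ℂ))).IsHermitian :=
    fun a => by
      rw [Matrix.IsHermitian, ← oneCopy_conjTranspose (ρ θ).posSemidef.1,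
        (M.integral_real_isHermitian (h a)).eq]
  have key := two_mul_trace_le_of_optimal_pullback hd hX₀ hGt hG₀ hV₀ hopt hherm
    ((momentMatrix_isSymm P h).smul (N : ℝ)) hZ
  have e1 : ((meanDeriv ρ θ fun a =>
      oneCopy (ρ θ).mat (M.integral fun x => (h a x : ℂ)))ᵀ * (Gt * J * V₀)).trace =
      ∑ a, ∑ i, (stateDeriv ρ θ i *
          oneCopy (ρ θ).mat (M.integral fun x => (f a x : ℂ))).trace.re * (Gt * J * V₀) a i := by
    rw [Matrix.trace, Finset.sum_comm]
    refine Finset.sum_congr rfl fun i _ => ?_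
    rw [Matrix.diag_apply, Matrix.mul_apply]
    refine Finset.sum_congr rfl fun a _ => ?_
    rw [Matrix.transpose_apply, meanDeriv, Matrix.of_apply, hMh, map_sub, map_smul,
      Matrix.mul_sub, Matrix.trace_sub, Matrix.mul_smul, Matrix.trace_smul,
      trace_mul_oneCopy_one (ρ θ).trace_eq_one, Complex.sub_re, smul_eq_mul,
      Complex.re_ofReal_mul, ← Complex.ofReal_natCast, Complex.re_ofReal_mul,
      trace_stateDeriv_re hd]
    ring
  have e2 : ∀ a b, momentMatrix P h a b = ∫ x, f a x * f b x ∂P - g a * g b := fun a b => by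
    have e : ∀ x, h a x * h b x = f a x * f b x - (g b * f a x + (g a * f b x - g a * g b)) :=
      fun x => by simp only [hh]; ring
    rw [momentMatrix, Matrix.of_apply]
    simp_rw [e]
    have i3 : Integrable (fun x => g a * f b x - g a * g b) P :=
      ((hfi b).const_mul _).sub (integrable_const _)
    have i2 : Integrable (fun x => g b * f a x + (g a * f b x - g a * g b)) P :=
      ((hfi a).const_mul _).add i3
    rw [integral_sub (hffi a b) i2, integral_add ((hfi a).const_mul _) i3,
      integral_sub ((hfi b).const_mul _) (integrable_const _), integral_const_mul,
      integral_const_mul, hgi, hgi]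
    simp [mul_comm]
  have e3 : (Gt * ((N : ℝ) • momentMatrix P h)).trace =
      N * (∫ x, (fun a => f a x) ⬝ᵥ (Gt *ᵥ fun a => f a x) ∂P) - N * (g ⬝ᵥ (Gt *ᵥ g)) := by
    have i1 : ∫ x, (fun a => f a x) ⬝ᵥ (Gt *ᵥ fun a => f a x) ∂P =
        ∑ a, ∑ b, Gt a b * ∫ x, f a x * f b x ∂P := by
      have e : ∀ x, (fun a => f a x) ⬝ᵥ (Gt *ᵥ fun a => f a x) =
          ∑ a, ∑ b, Gt a b * (f a x * f b x) := fun x => by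
        simp only [dotProduct, Matrix.mulVec, Finset.mul_sum]
        exact Finset.sum_congr rfl fun a _ => Finset.sum_congr rfl fun b _ => by ring
      simp_rw [e]
      have i0 : ∀ a b, Integrable (fun x => Gt a b * (f a x * f b x)) P := fun a b =>
        (hffi a b).const_mul _
      rw [integral_finsetSum _ fun a _ => integrable_finsetSum _ fun b _ => i0 a b]
      refine Finset.sum_congr rfl fun a _ => ?_
      rw [integral_finsetSum _ fun b _ => i0 a b]
      exact Finset.sum_congr rfl fun b _ => integral_const_mul _ _
    rw [i1, Matrix.mul_smul, Matrix.trace_smul, smul_eq_mul, ← mul_sub]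
    congr 1
    simp only [Matrix.trace, Matrix.diag_apply, Matrix.mul_apply, dotProduct, Matrix.mulVec,
      Finset.mul_sum, ← Finset.sum_sub_distrib]
    refine Finset.sum_congr rfl fun a _ => Finset.sum_congr rfl fun b _ => ?_
    rw [(momentMatrix_isSymm P h).apply, e2]
    ring
  -- The choice `r = N` cancels the term `-N gᵀ G̃ g` left by passing from the covariance to the
  -- mean square error.
  have hy := two_mul_dotProduct_le hGt g δ (Nat.cast_pos.2 hN : (0 : ℝ) < N)
  rw [e1, e3, hopt] at key
  rw [dotProduct] at hy
  linarith

end Pointwise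

/-- No integrability or measurability is needed: without integrability the Bochner integral is `0`
by convention. -/
theorem ofReal_integral_le_lintegral_ofReal {α : Type*} [MeasurableSpace α] (μ : Measure α)
    (f : α → ℝ) : ENNReal.ofReal (∫ x, f x ∂μ) ≤ ∫⁻ x, ENNReal.ofReal (f x) ∂μ := by
  by_cases hf : Integrable f μ
  · rw [integral_eq_lintegral_pos_part_sub_lintegral_neg_part hf]
    exact (ENNReal.ofReal_le_ofReal (sub_le_self _ ENNReal.toReal_nonneg)).trans
      ENNReal.ofReal_toReal_le
  · simp [integral_undef hf]

/-! ### Integrability of derivatives on the interior. -/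

section InteriorIntegrals

variable {p : ℕ} {K : Set (Fin p → ℝ)}

theorem ContDiffOn.continuousOn_fderiv_apply_interior {f : (Fin p → ℝ) → ℝ}
    (hf : ContDiffOn ℝ 1 f K) (v : Fin p → ℝ) :
    ContinuousOn (fun x => fderiv ℝ f x v) (interior K) :=
  ((hf.mono interior_subset).continuousOn_fderiv_of_isOpen isOpen_interior le_rfl).clm_apply
    continuousOn_const

theorem ContinuousOn.integrableOn_interior_of_bound (hK : IsCompact K) {f : (Fin p → ℝ) → ℝ}
    (hf : ContinuousOn f (interior K)) {C : ℝ} (hC : ∀ x ∈ interior K, |f x| ≤ C) :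
    IntegrableOn f (interior K) := by
  have hfin : volume (interior K) < ∞ :=
    (measure_mono interior_subset).trans_lt hK.measure_lt_top
  have : IsFiniteMeasure (volume.restrict (interior K)) := ⟨by simpa using hfin⟩
  refine Integrable.of_bound (hf.aestronglyMeasurable isOpen_interior.measurableSet) C ?_
  filter_upwards [ae_restrict_mem isOpen_interior.measurableSet] with x hx
  exact hC x hx

theorem IsCompact.integrableOn_fderiv_apply_mul (hK : IsCompact K) {f g : (Fin p → ℝ) → ℝ}
    (hf : ContDiffOn ℝ 1 f K) (hg : ContinuousOn g K) (v : Fin p → ℝ) :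
    IntegrableOn (fun x => fderiv ℝ f x v * g x) (interior K) := by
  obtain ⟨C, hC0, hC⟩ := hK.exists_bound_fderiv_interior hf
  obtain ⟨D, hD⟩ := hK.exists_bound_of_continuousOn hg
  refine ContinuousOn.integrableOn_interior_of_bound hK
    ((hf.continuousOn_fderiv_apply_interior v).mul (hg.mono interior_subset))
    (C := C * ‖v‖ * D) fun x hx => ?_
  rw [abs_mul]
  exact mul_le_mul (((fderiv ℝ f x).le_opNorm v).trans
    (mul_le_mul_of_nonneg_right (hC x hx) (norm_nonneg _))) (hD x (interior_subset hx))
    (abs_nonneg _) (mul_nonneg hC0 (norm_nonneg _))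

end InteriorIntegrals

/-! ### The mean error of a truncated estimator and its derivative. -/

section MeanError

variable {p q N : ℕ} {n : Type*} [Fintype n]

/-- The mean of `S - ψ_a B` for `N` copies of the state. -/
def meanError (ρ : (Fin p → ℝ) → DensityMatrix n) (ψ : (Fin p → ℝ) → Fin q → ℝ)
    (S : Fin q → Matrix (Fin N → n) (Fin N → n) ℂ) (B : Matrix (Fin N → n) (Fin N → n) ℂ)
    (a : Fin q) (θ : Fin p → ℝ) : ℝ :=
  (((ρ θ).tensorPow N).mat * S a).trace.re - ψ θ a * (((ρ θ).tensorPow N).mat * B).trace.re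

theorem meanError_eq (ρ : (Fin p → ℝ) → DensityMatrix n) (ψ : (Fin p → ℝ) → Fin q → ℝ)
    (S : Fin q → Matrix (Fin N → n) (Fin N → n) ℂ) (B : Matrix (Fin N → n) (Fin N → n) ℂ)
    (a : Fin q) (θ : Fin p → ℝ) :
    meanError ρ ψ S B a θ =
      (((ρ θ).tensorPow N).mat * (S a - (ψ θ a : ℂ) • B)).trace.re := by
  rw [Matrix.mul_sub, Matrix.trace_sub, Matrix.mul_smul, Matrix.trace_smul, Complex.sub_re,
    smul_eq_mul, Complex.re_ofReal_mul, meanError]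

theorem contDiffOn_meanError {ρ : (Fin p → ℝ) → DensityMatrix n} {ψ : (Fin p → ℝ) → Fin q → ℝ}
    {K : Set (Fin p → ℝ)} (hρ : ∀ i j, ContDiffOn ℝ 1 (fun t => (ρ t).mat i j) K)
    (S : Fin q → Matrix (Fin N → n) (Fin N → n) ℂ) (B : Matrix (Fin N → n) (Fin N → n) ℂ)
    {a : Fin q} (hψ : ContDiffOn ℝ 1 (fun t => ψ t a) K) :
    ContDiffOn ℝ 1 (meanError ρ ψ S B a) K :=
  (contDiffOn_trace_piTensor_mul_re (R := fun t => (ρ t).mat) hρ (S a)).sub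
    (hψ.mul (contDiffOn_trace_piTensor_mul_re (R := fun t => (ρ t).mat) hρ B))

variable [DecidableEq n]

/-- The first term comes from varying the state, the second from varying the target. For a truncated
estimator `B = M(A)`, so the second carries the probability of `A` rather than 1. -/
theorem fderiv_meanError {ρ : (Fin p → ℝ) → DensityMatrix n} {ψ : (Fin p → ℝ) → Fin q → ℝ}
    {K : Set (Fin p → ℝ)} {θ : Fin p → ℝ} (hθ : θ ∈ interior K)
    (hρ : ∀ i j, ContDiffOn ℝ 1 (fun t => (ρ t).mat i j) K)
    (S : Fin q → Matrix (Fin N → n) (Fin N → n) ℂ) (B : Matrix (Fin N → n) (Fin N → n) ℂ)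
    {a : Fin q} (hψ : ContDiffOn ℝ 1 (fun t => ψ t a) K) (j : Fin p) :
    fderiv ℝ (meanError ρ ψ S B a) θ (Pi.single j 1) =
      (stateDeriv ρ θ j * oneCopy (ρ θ).mat (S a - (ψ θ a : ℂ) • B)).trace.re -
        jacobian ψ θ a j * (((ρ θ).tensorPow N).mat * B).trace.re := by
  have hK := mem_interior_iff_mem_nhds.1 hθ
  have hT : ∀ T : Matrix (Fin N → n) (Fin N → n) ℂ,
      DifferentiableAt ℝ (fun t => (((ρ t).tensorPow N).mat * T).trace.re) θ := fun T =>
    ((contDiffOn_trace_piTensor_mul_re (R := fun t => (ρ t).mat) hρ T).contDiffAt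
      hK).differentiableAt one_ne_zero
  have hF : ∀ T : Matrix (Fin N → n) (Fin N → n) ℂ,
      fderiv ℝ (fun t => (((ρ t).tensorPow N).mat * T).trace.re) θ (Pi.single j 1) =
        (stateDeriv ρ θ j * oneCopy (ρ θ).mat T).trace.re := fun T =>
    fderiv_trace_piTensor_mul_re (R := fun t => (ρ t).mat)
      (fun i j => ((hρ i j).contDiffAt hK).differentiableAt one_ne_zero) T _
  have e := ((hT (S a)).hasFDerivAt.sub (((hψ.contDiffAt hK).differentiableAt
    one_ne_zero).hasFDerivAt.mul (hT B).hasFDerivAt)).fderiv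
  refine (congrArg (fun L : (Fin p → ℝ) →L[ℝ] ℝ => L (Pi.single j 1)) e).trans ?_
  simp only [_root_.sub_apply, _root_.add_apply,
    _root_.smul_apply, smul_eq_mul, hF, jacobian, Matrix.of_apply, map_sub, map_smul,
    Matrix.mul_sub, Matrix.trace_sub, Matrix.mul_smul, Matrix.trace_smul, Complex.sub_re,
    Complex.re_ofReal_mul]
  ring

end MeanError

/-! ### The divergence identity and the weighted Holevo bound. -/

section Model

variable {p q : ℕ} {n : Type*} [Fintype n]

/-- The regularity conditions on a quantum statistical model `ρ`, target `ψ`, loss `Gt` and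
prior density `π` on `Θ₀`. -/
structure RegularModel (Θ₀ : Set (Fin p → ℝ)) (ρ : (Fin p → ℝ) → DensityMatrix n)
    (ψ : (Fin p → ℝ) → Fin q → ℝ) (Gt : (Fin p → ℝ) → Matrix (Fin q) (Fin q) ℝ)
    (π : (Fin p → ℝ) → ℝ) : Prop where
  isCompact : IsCompact Θ₀
  state : ∀ i j, ContDiffOn ℝ 1 (fun θ => (ρ θ).mat i j) Θ₀
  unbiased : ∀ θ ∈ interior Θ₀, ∃ X : Fin p → Matrix n n ℂ, IsLocallyUnbiased ρ θ X
  target : ∀ a, ContDiffOn ℝ 1 (fun θ => ψ θ a) Θ₀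
  loss_aemeasurable : ∀ a b, AEMeasurable (fun θ => Gt θ a b) (volume.restrict Θ₀)
  loss_posDef : ∀ θ ∈ Θ₀, (Gt θ).PosDef
  pullback_posDef : ∀ θ ∈ interior Θ₀, (lossPullback ψ Gt θ).PosDef
  prior : ContDiffOn ℝ 1 π Θ₀
  prior_nonneg : ∀ θ ∈ Θ₀, 0 ≤ π θ
  prior_frontier : ∀ θ ∈ frontier Θ₀, π θ = 0
  flux : ∀ a j, ContDiffOn ℝ 1 (fun θ => vanTreesC ρ ψ Gt θ a j * π θ) Θ₀

/-- The Holevo bound for the pulled back loss, weighted by the prior density and expressed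
through the matrix `C`. -/
def weightedHolevo (ρ : (Fin p → ℝ) → DensityMatrix n) (ψ : (Fin p → ℝ) → Fin q → ℝ)
    (Gt : (Fin p → ℝ) → Matrix (Fin q) (Fin q) ℝ) (π : (Fin p → ℝ) → ℝ) (θ : Fin p → ℝ) : ℝ :=
  ∑ a, ∑ j, jacobian ψ θ a j * (vanTreesC ρ ψ Gt θ a j * π θ)

/-- The divergence of the product of the mean error and the matrix function `Cπ`. -/
def errorDivergence {N : ℕ} (ρ : (Fin p → ℝ) → DensityMatrix n) (ψ : (Fin p → ℝ) → Fin q → ℝ)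
    (Gt : (Fin p → ℝ) → Matrix (Fin q) (Fin q) ℝ) (π : (Fin p → ℝ) → ℝ)
    (S : Fin q → Matrix (Fin N → n) (Fin N → n) ℂ) (B : Matrix (Fin N → n) (Fin N → n) ℂ)
    (θ : Fin p → ℝ) : ℝ :=
  ∑ a, ∑ j, fderiv ℝ (fun t => meanError ρ ψ S B a t * (vanTreesC ρ ψ Gt t a j * π t)) θ
    (Pi.single j 1)

/-- The integrand of the information in the prior. -/
def priorScore (ρ : (Fin p → ℝ) → DensityMatrix n) (ψ : (Fin p → ℝ) → Fin q → ℝ)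
    (Gt : (Fin p → ℝ) → Matrix (Fin q) (Fin q) ℝ) (π : (Fin p → ℝ) → ℝ) (θ : Fin p → ℝ) : ℝ :=
  (rowDivergence (vanTreesC ρ ψ Gt) π θ ⬝ᵥ
    ((Gt θ)⁻¹ *ᵥ rowDivergence (vanTreesC ρ ψ Gt) π θ)) / π θ ^ 2

namespace RegularModel

variable {Θ₀ : Set (Fin p → ℝ)} {ρ : (Fin p → ℝ) → DensityMatrix n}
  {ψ : (Fin p → ℝ) → Fin q → ℝ} {Gt : (Fin p → ℝ) → Matrix (Fin q) (Fin q) ℝ}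
  {π : (Fin p → ℝ) → ℝ} {θ : Fin p → ℝ}

theorem state_differentiableAt (h : RegularModel Θ₀ ρ ψ Gt π) (hθ : θ ∈ interior Θ₀) (i j : n) :
    DifferentiableAt ℝ (fun t => (ρ t).mat i j) θ :=
  ((h.state i j).contDiffAt (mem_interior_iff_mem_nhds.1 hθ)).differentiableAt one_ne_zero

theorem flux_differentiableAt (h : RegularModel Θ₀ ρ ψ Gt π) (hθ : θ ∈ interior Θ₀)
    (a : Fin q) (j : Fin p) :
    DifferentiableAt ℝ (fun t => vanTreesC ρ ψ Gt t a j * π t) θ :=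
  ((h.flux a j).contDiffAt (mem_interior_iff_mem_nhds.1 hθ)).differentiableAt one_ne_zero

theorem optimal_spec [DecidableEq n] (h : RegularModel Θ₀ ρ ψ Gt π) (hθ : θ ∈ interior Θ₀) :
    holevoOptimal ρ θ (lossPullback ψ Gt θ) ∈ holevoSet ρ θ ∧
      (lossPullback ψ Gt θ * holevoOptimal ρ θ (lossPullback ψ Gt θ)).trace =
        holevoBound ρ θ (lossPullback ψ Gt θ) :=
  holevoOptimal_spec (fun i j => h.state_differentiableAt hθ i j) (h.unbiased θ hθ)
    (h.pullback_posDef θ hθ)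

theorem holevoBound_nonneg [DecidableEq n] (h : RegularModel Θ₀ ρ ψ Gt π)
    (hθ : θ ∈ interior Θ₀) : 0 ≤ holevoBound ρ θ (lossPullback ψ Gt θ) := by
  rw [← (h.optimal_spec hθ).2]
  exact (h.pullback_posDef θ hθ).posSemidef.trace_mul_nonneg_real
    (h.optimal_spec hθ).1.1.posSemidef

/-- Optimality gives `𝒞_{G₀} = tr(G₀ V₀) = tr(ψ'ᵀ C)`. Integrability then follows from the
regularity of `ψ` and `Cπ`, with no separate study of how the Holevo bound depends on `θ`. -/
theorem weightedHolevo_eq [DecidableEq n] (h : RegularModel Θ₀ ρ ψ Gt π)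
    (hθ : θ ∈ interior Θ₀) :
    weightedHolevo ρ ψ Gt π θ = holevoBound ρ θ (lossPullback ψ Gt θ) * π θ := by
  rw [← (h.optimal_spec hθ).2]
  have e : ∀ V : Matrix (Fin p) (Fin p) ℝ, lossPullback ψ Gt θ * V =
      (jacobian ψ θ)ᵀ * (Gt θ * jacobian ψ θ * V) := fun V => by
    rw [lossPullback]
    simp only [Matrix.mul_assoc]
  rw [e (holevoOptimal ρ θ (lossPullback ψ Gt θ)), ← vanTreesC, weightedHolevo,
    Finset.sum_comm, Matrix.trace, Finset.sum_mul]
  refine Finset.sum_congr rfl fun j _ => ?_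
  rw [Matrix.diag_apply, Matrix.mul_apply, Finset.sum_mul]
  exact Finset.sum_congr rfl fun a _ => by rw [Matrix.transpose_apply, mul_assoc]

theorem weightedHolevo_nonneg [DecidableEq n] (h : RegularModel Θ₀ ρ ψ Gt π)
    (hθ : θ ∈ interior Θ₀) : 0 ≤ weightedHolevo ρ ψ Gt π θ := by
  rw [h.weightedHolevo_eq hθ]
  exact mul_nonneg (h.holevoBound_nonneg hθ) (h.prior_nonneg θ (interior_subset hθ))

theorem integrableOn_mul_weightedHolevo (h : RegularModel Θ₀ ρ ψ Gt π)
    {f : (Fin p → ℝ) → ℝ} (hf : ContinuousOn f Θ₀) :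
    IntegrableOn (fun θ => f θ * weightedHolevo ρ ψ Gt π θ) (interior Θ₀) := by
  have e : (fun θ => f θ * weightedHolevo ρ ψ Gt π θ) = fun θ => ∑ a, ∑ j,
      fderiv ℝ (fun t => ψ t a) θ (Pi.single j 1) *
        (f θ * (vanTreesC ρ ψ Gt θ a j * π θ)) := by
    ext θ
    simp only [weightedHolevo, Finset.mul_sum, jacobian, Matrix.of_apply, mul_left_comm]
  rw [e]
  exact integrable_finsetSum _ fun a _ => integrable_finsetSum _ fun j _ =>
    h.isCompact.integrableOn_fderiv_apply_mul (h.target a) (hf.mul (h.flux a j).continuousOn) _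

theorem integrableOn_weightedHolevo (h : RegularModel Θ₀ ρ ψ Gt π) :
    IntegrableOn (weightedHolevo ρ ψ Gt π) (interior Θ₀) := by
  simpa using h.integrableOn_mul_weightedHolevo (f := fun _ => 1) continuousOn_const

section Divergence

variable {N : ℕ} (S : Fin q → Matrix (Fin N → n) (Fin N → n) ℂ)
  (B : Matrix (Fin N → n) (Fin N → n) ℂ)

theorem contDiffOn_meanError_mul_flux (h : RegularModel Θ₀ ρ ψ Gt π) (a : Fin q) (j : Fin p) :
    ContDiffOn ℝ 1 (fun t => meanError ρ ψ S B a t * (vanTreesC ρ ψ Gt t a j * π t)) Θ₀ :=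
  (contDiffOn_meanError h.state S B (h.target a)).mul (h.flux a j)

theorem integrableOn_fderiv_meanError_mul_flux (h : RegularModel Θ₀ ρ ψ Gt π) (a : Fin q)
    (j : Fin p) : IntegrableOn (fun θ => fderiv ℝ (fun t => meanError ρ ψ S B a t *
      (vanTreesC ρ ψ Gt t a j * π t)) θ (Pi.single j 1)) (interior Θ₀) := by
  simpa using h.isCompact.integrableOn_fderiv_apply_mul
    (h.contDiffOn_meanError_mul_flux S B a j) (g := fun _ => 1) continuousOn_const
    (Pi.single j 1)

theorem integrableOn_errorDivergence (h : RegularModel Θ₀ ρ ψ Gt π) :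
    IntegrableOn (errorDivergence ρ ψ Gt π S B) (interior Θ₀) :=
  integrable_finsetSum _ fun a _ => integrable_finsetSum _ fun j _ =>
    h.integrableOn_fderiv_meanError_mul_flux S B a j

theorem setIntegral_errorDivergence (h : RegularModel Θ₀ ρ ψ Gt π) :
    ∫ θ in interior Θ₀, errorDivergence ρ ψ Gt π S B θ = 0 := by
  have hi := h.integrableOn_fderiv_meanError_mul_flux S B
  simp only [errorDivergence]
  rw [integral_finsetSum _ fun a _ => integrable_finsetSum _ fun j _ => hi a j]
  refine Finset.sum_eq_zero fun a _ => ?_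
  rw [integral_finsetSum _ fun j _ => hi a j]
  refine Finset.sum_eq_zero fun j _ => ?_
  refine setIntegral_fderiv_eq_zero_of_frontier volume h.isCompact
    (h.contDiffOn_meanError_mul_flux S B a j) (fun x hx => ?_) _
  rw [h.prior_frontier x hx, mul_zero, mul_zero]

/-- The product rule, with the contribution of `ψ'` moved to the left. The right side is `π` times
what the information inequality bounds once `δ = (Cπ)'/π`. -/
theorem errorDivergence_add [DecidableEq n] (h : RegularModel Θ₀ ρ ψ Gt π)
    (hθ : θ ∈ interior Θ₀) :
    errorDivergence ρ ψ Gt π S B θ +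
        (((ρ θ).tensorPow N).mat * B).trace.re * weightedHolevo ρ ψ Gt π θ =
      ∑ a, meanError ρ ψ S B a θ * rowDivergence (vanTreesC ρ ψ Gt) π θ a +
        ∑ a, ∑ j, (stateDeriv ρ θ j *
          oneCopy (ρ θ).mat (S a - (ψ θ a : ℂ) • B)).trace.re *
            (vanTreesC ρ ψ Gt θ a j * π θ) := by
  have hK := mem_interior_iff_mem_nhds.1 hθ
  have e : ∀ a j, fderiv ℝ (fun t => meanError ρ ψ S B a t *
      (vanTreesC ρ ψ Gt t a j * π t)) θ (Pi.single j 1) =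
      meanError ρ ψ S B a θ *
        fderiv ℝ (fun t => vanTreesC ρ ψ Gt t a j * π t) θ (Pi.single j 1) +
      (vanTreesC ρ ψ Gt θ a j * π θ) *
        fderiv ℝ (meanError ρ ψ S B a) θ (Pi.single j 1) := fun a j => by
    have h1 := (((contDiffOn_meanError h.state S B (h.target a)).contDiffAt
      hK).differentiableAt one_ne_zero).hasFDerivAt.mul (h.flux_differentiableAt hθ a j).hasFDerivAt
    exact congrArg (fun L : (Fin p → ℝ) →L[ℝ] ℝ => L (Pi.single j 1)) h1.fderiv
  simp only [errorDivergence, e, weightedHolevo, rowDivergence, Finset.mul_sum,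
    fderiv_meanError hθ h.state S B (h.target _), ← Finset.sum_add_distrib]
  exact Finset.sum_congr rfl fun a _ => Finset.sum_congr rfl fun j _ => by ring

/-- `Cπ` vanishes wherever `π` does, and so almost everywhere there does its derivative. Points with
`π = 0`, where `δ` is unavailable, then contribute nothing. -/
theorem rowDivergence_eq_zero_ae (h : RegularModel Θ₀ ρ ψ Gt π) :
    ∀ᵐ θ ∂(volume.restrict (interior Θ₀)), π θ = 0 →
      rowDivergence (vanTreesC ρ ψ Gt) π θ = 0 := by
  have hm : MeasurableSet (Θ₀ ∩ π ⁻¹' {0}) := (h.prior.continuousOn.preimage_isClosed_of_isClosed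
    h.isCompact.isClosed isClosed_singleton).measurableSet
  have hz : ∀ a j, ∀ᵐ θ ∂(volume : Measure (Fin p → ℝ)), θ ∈ Θ₀ ∩ π ⁻¹' {0} →
      DifferentiableAt ℝ (fun t => vanTreesC ρ ψ Gt t a j * π t) θ →
        fderiv ℝ (fun t => vanTreesC ρ ψ Gt t a j * π t) θ = 0 := fun a j =>
    ae_fderiv_eq_zero_of_eq_zero volume hm fun x hx => by
      rw [show π x = 0 from hx.2, mul_zero]
  rw [ae_restrict_iff' isOpen_interior.measurableSet]
  filter_upwards [ae_all_iff.2 fun a => ae_all_iff.2 fun j => hz a j] with θ h1 hθ h0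
  ext a
  rw [rowDivergence, Pi.zero_apply]
  refine Finset.sum_eq_zero fun j _ => ?_
  rw [h1 a j ⟨interior_subset hθ, h0⟩ (h.flux_differentiableAt hθ a j)]
  rfl

end Divergence

theorem aemeasurable_priorScore (h : RegularModel Θ₀ ρ ψ Gt π) :
    AEMeasurable (priorScore ρ ψ Gt π) (volume.restrict (interior Θ₀)) := by
  have hGi : ∀ a b, AEMeasurable (fun θ => (Gt θ)⁻¹ a b) (volume.restrict (interior Θ₀)) := by
    intro a b
    have hG : AEMeasurable (fun θ a b => Gt θ a b) (volume.restrict (interior Θ₀)) :=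
      aemeasurable_pi_lambda _ fun a => aemeasurable_pi_lambda _ fun b =>
        (h.loss_aemeasurable a b).mono_measure (Measure.restrict_mono interior_subset le_rfl)
    have hdet : Continuous fun B : Fin q → Fin q → ℝ => (Matrix.of B).det :=
      Continuous.matrix_det continuous_id
    have hadj : Continuous fun B : Fin q → Fin q → ℝ => (Matrix.of B).adjugate a b :=
      (Continuous.matrix_adjugate continuous_id).matrix_elem a b
    have e : (fun θ => (Gt θ)⁻¹ a b) = fun θ => ((Gt θ).det)⁻¹ * (Gt θ).adjugate a b := by
      ext θ
      rw [Matrix.inv_def, Ring.inverse_eq_inv', Matrix.smul_apply, smul_eq_mul]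
    rw [e]
    exact (hdet.measurable.comp_aemeasurable hG).inv.mul (hadj.measurable.comp_aemeasurable hG)
  have hr : ∀ a, AEMeasurable (fun θ => rowDivergence (vanTreesC ρ ψ Gt) π θ a)
      (volume.restrict (interior Θ₀)) := fun a =>
    Finset.aemeasurable_fun_sum _ fun j _ =>
      ((h.flux a j).continuousOn_fderiv_apply_interior _).aemeasurable
        isOpen_interior.measurableSet
  have hp : AEMeasurable π (volume.restrict (interior Θ₀)) :=
    (h.prior.continuousOn.mono interior_subset).aemeasurable isOpen_interior.measurableSet
  have hv : ∀ a, AEMeasurable (fun θ => ∑ b, (Gt θ)⁻¹ a b *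
      rowDivergence (vanTreesC ρ ψ Gt) π θ b) (volume.restrict (interior Θ₀)) := fun a =>
    Finset.aemeasurable_fun_sum _ fun b _ => (hGi a b).mul (hr b)
  have hq : AEMeasurable (fun θ => ∑ a, rowDivergence (vanTreesC ρ ψ Gt) π θ a *
      ∑ b, (Gt θ)⁻¹ a b * rowDivergence (vanTreesC ρ ψ Gt) π θ b)
      (volume.restrict (interior Θ₀)) :=
    Finset.aemeasurable_fun_sum _ fun a _ => (hr a).mul (hv a)
  exact hq.div (hp.pow_const 2)

end RegularModel

end Model

/-! ### Restriction of an estimator to outcomes where it is bounded. -/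

section Truncation

variable {X : Type*} [MeasurableSpace X] {q : ℕ} {A : Set X} {est : X → Fin q → ℝ} {K : ℝ}

theorem bddMeasurable_indicator_sub (hA : MeasurableSet A) (hest : Measurable est)
    (hK : ∀ x ∈ A, ∀ a, |est x a| ≤ K) (a : Fin q) (c : ℝ) :
    BddMeasurable fun x => ((A.indicator (fun x => est x a - c) x : ℝ) : ℂ) := by
  refine ⟨Complex.measurable_ofReal.comp
    ((((measurable_pi_apply a).comp hest).sub_const c).indicator hA), |K| + |c|, fun x => ?_⟩
  rw [Complex.norm_real, Real.norm_eq_abs]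
  by_cases hx : x ∈ A
  · rw [Set.indicator_of_mem hx]
    exact (abs_sub _ _).trans (add_le_add ((hK x hx a).trans (le_abs_self K)) le_rfl)
  · rw [Set.indicator_of_notMem hx, abs_zero]
    positivity

variable {m : Type*} [Fintype m] [DecidableEq m]

theorem POVM.integral_indicator_sub (M : POVM X m) (hA : MeasurableSet A) (hest : Measurable est)
    (hK : ∀ x ∈ A, ∀ a, |est x a| ≤ K) (a : Fin q) (c : ℝ) :
    (M.integral fun x => ((A.indicator (fun x => est x a - c) x : ℝ) : ℂ)) =
      (M.integral fun x => ((A.indicator (fun x => est x a) x : ℝ) : ℂ)) -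
        (c : ℂ) • M.measure A := by
  have h1 := bddMeasurable_indicator_sub hA hest hK a 0
  simp only [sub_zero] at h1
  have h2 : BddMeasurable (A.indicator (1 : X → ℂ)) :=
    (BddMeasurable.const 1).indicator hA
  have e : (fun x => ((A.indicator (fun x => est x a - c) x : ℝ) : ℂ)) =
      fun x => ((A.indicator (fun x => est x a) x : ℝ) : ℂ) +
        (-(c : ℂ)) * A.indicator (1 : X → ℂ) x := by
    ext x
    by_cases hx : x ∈ A <;> simp [hx, sub_eq_add_neg]
  rw [e, M.integral_add h1 ((BddMeasurable.const _).mul h2), M.integral_const_mul,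
    M.integral_indicator_one hA, neg_smul, sub_eq_add_neg]

/-- Truncating the whole error, rather than the estimator alone, makes the loss zero off `A`, so the
risk can only decrease. -/
theorem ofReal_integral_quadratic_indicator_le {G : Matrix (Fin q) (Fin q) ℝ}
    (μ : Measure X) (c : Fin q → ℝ) :
    ENNReal.ofReal (∫ x, (fun a => A.indicator (fun x => est x a - c a) x) ⬝ᵥ
        (G *ᵥ fun a => A.indicator (fun x => est x a - c a) x) ∂μ) ≤
      ∫⁻ x, ENNReal.ofReal ((est x - c) ⬝ᵥ (G *ᵥ (est x - c))) ∂μ := by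
  refine (ofReal_integral_le_lintegral_ofReal _ _).trans (lintegral_mono fun x => ?_)
  by_cases hx : x ∈ A
  · simp only [Set.indicator_of_mem hx]
    exact le_rfl
  · simp only [Set.indicator_of_notMem hx]
    simp [dotProduct]

end Truncation

/-! ### Integration against the prior and removal of the truncation. -/

section Bound

variable {p q N : ℕ} {n : Type*} [Fintype n] [DecidableEq n]
  {X : Type*} [MeasurableSpace X]
  {Θ₀ : Set (Fin p → ℝ)} {ρ : (Fin p → ℝ) → DensityMatrix n}
  {ψ : (Fin p → ℝ) → Fin q → ℝ} {Gt : (Fin p → ℝ) → Matrix (Fin q) (Fin q) ℝ}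
  {π : (Fin p → ℝ) → ℝ} {θ : Fin p → ℝ} {A : Set X} {est : X → Fin q → ℝ} {K : ℝ}

/-- The pointwise inequality with `δ = (Cπ)'/π`, multiplied by `π`; the term `δᵀ G̃⁻¹ δ` becomes
`priorScore`. -/
theorem RegularModel.two_mul_errorDivergence_le_of_pos (h : RegularModel Θ₀ ρ ψ Gt π)
    (hN : 0 < N) (M : POVM X (Fin N → n)) (hA : MeasurableSet A) (hest : Measurable est)
    (hK : ∀ x ∈ A, ∀ a, |est x a| ≤ K) (hθ : θ ∈ interior Θ₀) (hπ : 0 < π θ) :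
    2 * (errorDivergence ρ ψ Gt π
          (fun a => M.integral fun x => ((A.indicator (fun x => est x a) x : ℝ) : ℂ))
          (M.measure A) θ +
        (((ρ θ).tensorPow N).mat * M.measure A).trace.re * weightedHolevo ρ ψ Gt π θ) -
      weightedHolevo ρ ψ Gt π θ ≤
    π θ * (N * ∫ x, (fun a => A.indicator (fun x => est x a - ψ θ a) x) ⬝ᵥ
        (Gt θ *ᵥ fun a => A.indicator (fun x => est x a - ψ θ a) x)
          ∂(outcomeLaw ((ρ θ).tensorPow N) M) + priorScore ρ ψ Gt π θ / N) := by
  have key := two_mul_mean_add_trace_le (fun i j => h.state_differentiableAt hθ i j)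
    (h.unbiased θ hθ) (h.loss_posDef θ (interior_subset hθ)) (J := jacobian ψ θ)
    (h.pullback_posDef θ hθ) (h.optimal_spec hθ).1 (h.optimal_spec hθ).2 hN M
    (fun a => bddMeasurable_indicator_sub hA hest hK a (ψ θ a))
    ((π θ)⁻¹ • rowDivergence (vanTreesC ρ ψ Gt) π θ)
  simp only [M.integral_indicator_sub hA hest hK, Matrix.mulVec_smul, dotProduct_smul,
    smul_dotProduct, smul_eq_mul, Pi.smul_apply] at key
  rw [h.errorDivergence_add _ _ hθ, h.weightedHolevo_eq hθ]
  simp only [meanError_eq]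
  have key2 := mul_le_mul_of_nonneg_left key hπ.le
  have s1 : ∑ a, (((ρ θ).tensorPow N).mat *
        ((M.integral fun x => ((A.indicator (fun x => est x a) x : ℝ) : ℂ)) -
          (ψ θ a : ℂ) • M.measure A)).trace.re * rowDivergence (vanTreesC ρ ψ Gt) π θ a =
      π θ * ∑ a, (((ρ θ).tensorPow N).mat *
        ((M.integral fun x => ((A.indicator (fun x => est x a) x : ℝ) : ℂ)) -
          (ψ θ a : ℂ) • M.measure A)).trace.re *
            ((π θ)⁻¹ * rowDivergence (vanTreesC ρ ψ Gt) π θ a) := by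
    rw [Finset.mul_sum]
    refine Finset.sum_congr rfl fun a _ => ?_
    field_simp
  have s2 : ∑ a, ∑ j, (stateDeriv ρ θ j * oneCopy (ρ θ).mat
        ((M.integral fun x => ((A.indicator (fun x => est x a) x : ℝ) : ℂ)) -
          (ψ θ a : ℂ) • M.measure A)).trace.re * (vanTreesC ρ ψ Gt θ a j * π θ) =
      π θ * ∑ a, ∑ j, (stateDeriv ρ θ j * oneCopy (ρ θ).mat
        ((M.integral fun x => ((A.indicator (fun x => est x a) x : ℝ) : ℂ)) -
          (ψ θ a : ℂ) • M.measure A)).trace.re * vanTreesC ρ ψ Gt θ a j := by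
    simp only [Finset.mul_sum]
    exact Finset.sum_congr rfl fun a _ => Finset.sum_congr rfl fun j _ => by ring
  have s3 : priorScore ρ ψ Gt π θ = (π θ)⁻¹ * ((π θ)⁻¹ *
      (rowDivergence (vanTreesC ρ ψ Gt) π θ ⬝ᵥ
        ((Gt θ)⁻¹ *ᵥ rowDivergence (vanTreesC ρ ψ Gt) π θ))) := by
    rw [priorScore]
    field_simp
  rw [s1, s2, s3]
  change π θ * (2 * (_ + ∑ a, ∑ j, _ * vanTreesC ρ ψ Gt θ a j)) ≤
    π θ * (_ + holevoBound ρ θ (lossPullback ψ Gt θ)) at key2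
  linarith

theorem RegularModel.two_mul_errorDivergence_le_ae (h : RegularModel Θ₀ ρ ψ Gt π)
    (hN : 0 < N) (M : POVM X (Fin N → n)) (hA : MeasurableSet A) (hest : Measurable est)
    (hK : ∀ x ∈ A, ∀ a, |est x a| ≤ K) : ∀ᵐ θ ∂(volume.restrict (interior Θ₀)),
    2 * (errorDivergence ρ ψ Gt π
          (fun a => M.integral fun x => ((A.indicator (fun x => est x a) x : ℝ) : ℂ))
          (M.measure A) θ +
        (((ρ θ).tensorPow N).mat * M.measure A).trace.re * weightedHolevo ρ ψ Gt π θ) -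
      weightedHolevo ρ ψ Gt π θ ≤
    π θ * (N * ∫ x, (fun a => A.indicator (fun x => est x a - ψ θ a) x) ⬝ᵥ
        (Gt θ *ᵥ fun a => A.indicator (fun x => est x a - ψ θ a) x)
          ∂(outcomeLaw ((ρ θ).tensorPow N) M) + priorScore ρ ψ Gt π θ / N) := by
  filter_upwards [h.rowDivergence_eq_zero_ae, ae_restrict_mem isOpen_interior.measurableSet]
    with θ h0 hθ
  rcases (h.prior_nonneg θ (interior_subset hθ)).eq_or_lt with hπ | hπ
  · rw [h.errorDivergence_add _ _ hθ, h0 hπ.symm, ← hπ, weightedHolevo, ← hπ]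
    simp
  · exact h.two_mul_errorDivergence_le_of_pos hN M hA hest hK hθ hπ

theorem lintegral_priorMeasure_of_aemeasurable (hπ : AEMeasurable π (volume.restrict Θ₀))
    (F : (Fin p → ℝ) → ℝ≥0∞) :
    ∫⁻ θ, F θ ∂(priorMeasure Θ₀ π) = ∫⁻ θ in Θ₀, ENNReal.ofReal (π θ) * F θ :=
  lintegral_withDensity_eq_lintegral_mul_non_measurable₀ _ hπ.ennreal_ofReal
    (ae_of_all _ fun _ => ENNReal.ofReal_lt_top) F

/-- The information inequality integrated against the prior, for the estimator restricted to a
set `A` of outcomes on which it is bounded. -/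
theorem RegularModel.ofReal_two_mul_integral_sub_le (h : RegularModel Θ₀ ρ ψ Gt π)
    (hN : 0 < N) (M : POVM X (Fin N → n)) (hA : MeasurableSet A) (hest : Measurable est)
    (hK : ∀ x ∈ A, ∀ a, |est x a| ≤ K) :
    ENNReal.ofReal (2 * (∫ θ in interior Θ₀,
          (((ρ θ).tensorPow N).mat * M.measure A).trace.re * weightedHolevo ρ ψ Gt π θ) -
        ∫ θ in interior Θ₀, weightedHolevo ρ ψ Gt π θ) ≤
      (N : ℝ≥0∞) * bayesRisk ρ ψ Gt Θ₀ π N M est +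
        priorInformation ρ ψ Gt Θ₀ π / (N : ℝ≥0∞) := by
  have hπ := h.prior.continuousOn.aemeasurable (μ := volume) h.isCompact.measurableSet
  have hN0 : (N : ℝ≥0∞) ≠ 0 := by exact_mod_cast hN.ne'
  have hτ : ContinuousOn (fun θ => (((ρ θ).tensorPow N).mat * M.measure A).trace.re) Θ₀ :=
    (contDiffOn_trace_piTensor_mul_re (R := fun t => (ρ t).mat) h.state _).continuousOn
  set S : Fin q → Matrix (Fin N → n) (Fin N → n) ℂ := fun a =>
    M.integral fun x => ((A.indicator (fun x => est x a) x : ℝ) : ℂ) with hS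
  have iD := h.integrableOn_errorDivergence S (M.measure A)
  have iτ := h.integrableOn_mul_weightedHolevo hτ
  have e : 2 * (∫ θ in interior Θ₀,
          (((ρ θ).tensorPow N).mat * M.measure A).trace.re * weightedHolevo ρ ψ Gt π θ) -
        ∫ θ in interior Θ₀, weightedHolevo ρ ψ Gt π θ =
      ∫ θ in interior Θ₀, (2 * (errorDivergence ρ ψ Gt π S (M.measure A) θ +
        (((ρ θ).tensorPow N).mat * M.measure A).trace.re * weightedHolevo ρ ψ Gt π θ) -
          weightedHolevo ρ ψ Gt π θ) := by
    have iS : IntegrableOn (fun θ => 2 * (errorDivergence ρ ψ Gt π S (M.measure A) θ +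
        (((ρ θ).tensorPow N).mat * M.measure A).trace.re * weightedHolevo ρ ψ Gt π θ))
        (interior Θ₀) := (iD.add iτ).const_mul 2
    rw [integral_sub iS h.integrableOn_weightedHolevo,
      integral_const_mul, integral_add iD iτ, h.setIntegral_errorDivergence, zero_add]
  set L : (Fin p → ℝ) → ℝ≥0∞ := fun θ =>
    ∫⁻ x, ENNReal.ofReal ((est x - ψ θ) ⬝ᵥ (Gt θ *ᵥ (est x - ψ θ)))
      ∂(outcomeLaw ((ρ θ).tensorPow N) M) with hL
  have hle : ∀ᵐ θ ∂(volume.restrict (interior Θ₀)),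
      ENNReal.ofReal (2 * (errorDivergence ρ ψ Gt π S (M.measure A) θ +
        (((ρ θ).tensorPow N).mat * M.measure A).trace.re * weightedHolevo ρ ψ Gt π θ) -
          weightedHolevo ρ ψ Gt π θ) ≤
      (N : ℝ≥0∞) * (ENNReal.ofReal (π θ) * L θ) +
        (N : ℝ≥0∞)⁻¹ * (ENNReal.ofReal (π θ) * ENNReal.ofReal (priorScore ρ ψ Gt π θ)) := by
    filter_upwards [h.two_mul_errorDivergence_le_ae hN M hA hest hK,
      ae_restrict_mem isOpen_interior.measurableSet] with θ h1 hθ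
    refine (ENNReal.ofReal_le_ofReal h1).trans ?_
    rw [ENNReal.ofReal_mul (h.prior_nonneg θ (interior_subset hθ)), mul_left_comm,
      mul_left_comm (N : ℝ≥0∞)⁻¹, ← mul_add]
    refine mul_le_mul_right (ENNReal.ofReal_add_le.trans (add_le_add ?_ ?_)) _
    · rw [ENNReal.ofReal_mul (Nat.cast_nonneg N), ENNReal.ofReal_natCast]
      exact mul_le_mul_right (ofReal_integral_quadratic_indicator_le _ _) _
    · rw [ENNReal.ofReal_div_of_pos (Nat.cast_pos.2 hN), ENNReal.ofReal_natCast,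
        ENNReal.div_eq_inv_mul]
  -- Additivity of the lower integral needs only one measurable summand. The prior term is used, so
  -- no measurability of the risk `L` in `θ` is required.
  have hm : AEMeasurable (fun θ => (N : ℝ≥0∞)⁻¹ *
      (ENNReal.ofReal (π θ) * ENNReal.ofReal (priorScore ρ ψ Gt π θ)))
      (volume.restrict (interior Θ₀)) :=
    ((hπ.mono_measure (Measure.restrict_mono interior_subset le_rfl)).ennreal_ofReal.mul
      h.aemeasurable_priorScore.ennreal_ofReal).const_mul _
  rw [e]
  refine (ofReal_integral_le_lintegral_ofReal _ _).trans ((lintegral_mono_ae hle).trans ?_)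
  rw [lintegral_add_right' _ hm, lintegral_const_mul' _ _ (ENNReal.natCast_ne_top N),
    lintegral_const_mul' _ _ (ENNReal.inv_ne_top.2 hN0), ENNReal.div_eq_inv_mul, bayesRisk,
    priorInformation, lintegral_priorMeasure_of_aemeasurable hπ,
    lintegral_priorMeasure_of_aemeasurable hπ]
  exact add_le_add (mul_le_mul_right (lintegral_mono_set interior_subset) _)
    (mul_le_mul_right (lintegral_mono_set interior_subset) _)

/-- The frontier may have positive volume, but `π` vanishes there. -/
theorem RegularModel.expectedHolevo_le (h : RegularModel Θ₀ ρ ψ Gt π) :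
    expectedHolevo ρ ψ Gt Θ₀ π ≤
      ENNReal.ofReal (∫ θ in interior Θ₀, weightedHolevo ρ ψ Gt π θ) := by
  have hπ := h.prior.continuousOn.aemeasurable (μ := volume) h.isCompact.measurableSet
  have hun : Θ₀ = interior Θ₀ ∪ frontier Θ₀ := by
    rw [← closure_eq_interior_union_frontier, h.isCompact.isClosed.closure_eq]
  rw [expectedHolevo, lintegral_priorMeasure_of_aemeasurable hπ,
    ofReal_integral_eq_lintegral_ofReal h.integrableOn_weightedHolevo]
  · conv_lhs => rw [hun]
    refine (lintegral_union_le _ _ _).trans ?_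
    have h0 : ∫⁻ θ in frontier Θ₀, ENNReal.ofReal (π θ) *
        ENNReal.ofReal (holevoBound ρ θ (lossPullback ψ Gt θ)) = 0 := by
      rw [setLIntegral_congr_fun (g := fun _ => 0) isClosed_frontier.measurableSet fun θ hθ => by
        simp [h.prior_frontier θ hθ], lintegral_zero]
    rw [h0, add_zero]
    refine setLIntegral_mono' isOpen_interior.measurableSet fun θ hθ => ?_
    rw [← ENNReal.ofReal_mul (h.prior_nonneg θ (interior_subset hθ)), h.weightedHolevo_eq hθ,
      mul_comm]
  · filter_upwards [ae_restrict_mem isOpen_interior.measurableSet] with θ hθ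
    exact h.weightedHolevo_nonneg hθ

theorem tendsto_trace_mul_measure_iUnion (σ : DensityMatrix n) (M : POVM X n) {A : ℕ → Set X}
    (hA : ∀ k, MeasurableSet (A k)) (hmono : Monotone A) (hun : ⋃ k, A k = Set.univ) :
    Tendsto (fun k => (σ.mat * M.measure (A k)).trace.re) atTop (𝓝 1) := by
  have h1 := tendsto_measure_iUnion_atTop (μ := outcomeLaw σ M) hmono
  rw [hun, measure_univ] at h1
  have h2 := (ENNReal.tendsto_toReal ENNReal.one_ne_top).comp h1
  refine h2.congr fun k => ?_
  rw [Function.comp_apply, Function.comp_apply, outcomeLaw_apply σ M (hA k), ENNReal.toReal_ofReal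
    (trace_mul_re_nonneg σ.posSemidef (M.posSemidef _ (hA k)))]

theorem abs_trace_mul_measure_le_one (σ : DensityMatrix n) (M : POVM X n) {B : Set X}
    (hB : MeasurableSet B) : |(σ.mat * M.measure B).trace.re| ≤ 1 := by
  rw [abs_of_nonneg (trace_mul_re_nonneg σ.posSemidef (M.posSemidef _ hB)),
    ← ENNReal.ofReal_le_one, ← outcomeLaw_apply σ M hB]
  exact prob_le_one

/-- The quantum van Trees inequality: a non-asymptotic lower bound on the Bayes risk. -/
theorem RegularModel.expectedHolevo_le_bayesRisk_add (h : RegularModel Θ₀ ρ ψ Gt π)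
    (hN : 0 < N) (M : POVM X (Fin N → n)) (hest : Measurable est) :
    expectedHolevo ρ ψ Gt Θ₀ π ≤ (N : ℝ≥0∞) * bayesRisk ρ ψ Gt Θ₀ π N M est +
      priorInformation ρ ψ Gt Θ₀ π / (N : ℝ≥0∞) := by
  set A : ℕ → Set X := fun k => {x | ∀ a, |est x a| ≤ k} with hAdef
  have hA : ∀ k, MeasurableSet (A k) := fun k => by
    simp only [hAdef, Set.ofPred_forall]
    exact MeasurableSet.iInter fun a => measurableSet_le
      ((measurable_pi_apply a).comp hest).abs measurable_const
  have hmono : Monotone A := fun k l hkl x hx a => (hx a).trans (Nat.cast_le.2 hkl)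
  have hun : ⋃ k, A k = Set.univ := Set.eq_univ_of_forall fun x => by
    obtain ⟨k, hk⟩ := exists_nat_ge ‖est x‖
    exact Set.mem_iUnion.2 ⟨k, fun a => (norm_le_pi_norm (est x) a).trans hk⟩
  -- The probability of `A k` tends to 1 at every `θ` and is at most 1, so `weightedHolevo`
  -- dominates.
  have hlim : Tendsto (fun k => ∫ θ in interior Θ₀,
      (((ρ θ).tensorPow N).mat * M.measure (A k)).trace.re * weightedHolevo ρ ψ Gt π θ) atTop
      (𝓝 (∫ θ in interior Θ₀, weightedHolevo ρ ψ Gt π θ)) := by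
    refine tendsto_integral_of_dominated_convergence (fun θ => |weightedHolevo ρ ψ Gt π θ|)
      (fun k => ?_) h.integrableOn_weightedHolevo.abs
      (fun k => ae_of_all _ fun θ => ?_) (ae_of_all _ fun θ => ?_)
    · exact (h.integrableOn_mul_weightedHolevo (contDiffOn_trace_piTensor_mul_re
        (R := fun t => (ρ t).mat) h.state (M.measure (A k))).continuousOn).1
    · rw [norm_mul]
      exact mul_le_of_le_one_left (norm_nonneg _)
        (abs_trace_mul_measure_le_one _ M (hA k))
    · simpa using (tendsto_trace_mul_measure_iUnion ((ρ θ).tensorPow N) M hA hmono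
        hun).mul_const (weightedHolevo ρ ψ Gt π θ)
  have hlim2 := ENNReal.tendsto_ofReal ((hlim.const_mul 2).sub_const
    (∫ θ in interior Θ₀, weightedHolevo ρ ψ Gt π θ))
  -- In the limit, twice the integral minus the integral leaves one copy of it.
  rw [two_mul, add_sub_cancel_right] at hlim2
  exact h.expectedHolevo_le.trans (le_of_tendsto' hlim2 fun k =>
    h.ofReal_two_mul_integral_sub_le hN M (hA k) hest fun x hx => hx)

end Bound

end

theorem theorem1 {d p q : ℕ}
    (Θ Θ₀ : Set (Fin p → ℝ)) (hΘ₀ : IsCompact Θ₀) (hsub : Θ₀ ⊆ Θ)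
    (ρ : (Fin p → ℝ) → DensityMatrix (Fin d))
    (hρ : ∀ i j, ContDiffOn ℝ 1 (fun θ => (ρ θ).mat i j) Θ)
    (hfin : ∀ θ ∈ interior Θ₀, ∃ X : Fin p → Matrix (Fin d) (Fin d) ℂ, IsLocallyUnbiased ρ θ X)
    (ψ : (Fin p → ℝ) → Fin q → ℝ) (hψ : ContDiffOn ℝ 1 ψ Θ)
    (Gt : (Fin p → ℝ) → Matrix (Fin q) (Fin q) ℝ)
    (hGt_meas : ∀ a b, AEMeasurable (fun θ => Gt θ a b) (volume.restrict Θ₀))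
    (hGt : ∀ θ ∈ Θ₀, (Gt θ).PosDef)
    (hG₀ : ∀ θ ∈ interior Θ₀, (lossPullback ψ Gt θ).PosDef)
    (π : (Fin p → ℝ) → ℝ) (hπ : ContDiffOn ℝ 1 π Θ₀) (hπ_nonneg : ∀ θ ∈ Θ₀, 0 ≤ π θ)
    (hπ_int : ∫ θ in Θ₀, π θ = 1) (hπ_bdry : ∀ θ ∈ frontier Θ₀, π θ = 0)
    (hCπ : ∀ a j, ContDiffOn ℝ 1 (fun θ => vanTreesC ρ ψ Gt θ a j * π θ) Θ₀)
    (hJ : priorInformation ρ ψ Gt Θ₀ π ≠ ∞)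
    (X : ℕ → Type*) [∀ N, MeasurableSpace (X N)]
    (M : ∀ N, POVM (X N) (Fin N → Fin d))
    (est : ∀ N, X N → Fin q → ℝ) (hest : ∀ N, Measurable (est N)) :
    expectedHolevo ρ ψ Gt Θ₀ π ≤
        liminf (fun N : ℕ => (N : ℝ≥0∞) * bayesRisk ρ ψ Gt Θ₀ π N (M N) (est N)) atTop ∧
      ∀ N : ℕ, 0 < N →
        expectedHolevo ρ ψ Gt Θ₀ π ≤
          (N : ℝ≥0∞) * bayesRisk ρ ψ Gt Θ₀ π N (M N) (est N) +
            priorInformation ρ ψ Gt Θ₀ π / (N : ℝ≥0∞) := by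
  have h : RegularModel Θ₀ ρ ψ Gt π :=
    { isCompact := hΘ₀
      state := fun i j => (hρ i j).mono hsub
      unbiased := hfin
      target := fun a => (contDiffOn_pi.1 hψ a).mono hsub
      loss_aemeasurable := hGt_meas
      loss_posDef := hGt
      pullback_posDef := hG₀
      prior := hπ
      prior_nonneg := hπ_nonneg
      prior_frontier := hπ_bdry
      flux := hCπ }
  have hb : ∀ N : ℕ, 0 < N → expectedHolevo ρ ψ Gt Θ₀ π ≤
      (N : ℝ≥0∞) * bayesRisk ρ ψ Gt Θ₀ π N (M N) (est N) +
        priorInformation ρ ψ Gt Θ₀ π / (N : ℝ≥0∞) := fun N hN =>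
    h.expectedHolevo_le_bayesRisk_add hN (M N) (hest N)
  refine ⟨?_, hb⟩
  have hJ0 : Tendsto (fun N : ℕ => priorInformation ρ ψ Gt Θ₀ π / (N : ℝ≥0∞)) atTop (𝓝 0) := by
    simpa using ENNReal.Tendsto.const_div ENNReal.tendsto_nat_nhds_top (Or.inr hJ)
  -- Finiteness of `𝒥` makes the correction vanish; truncated subtraction in `ℝ≥0∞` is harmless,
  -- since it only moves `𝒥/N` to the other side of the bound.
  have hsubJ : Tendsto (fun N : ℕ => expectedHolevo ρ ψ Gt Θ₀ π -
      priorInformation ρ ψ Gt Θ₀ π / (N : ℝ≥0∞)) atTop (𝓝 (expectedHolevo ρ ψ Gt Θ₀ π)) := by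
    simpa using ENNReal.Tendsto.sub (tendsto_const_nhds (x := expectedHolevo ρ ψ Gt Θ₀ π)) hJ0
      (Or.inr ENNReal.zero_ne_top)
  rw [← hsubJ.liminf_eq]
  refine liminf_le_liminf ?_
  filter_upwards [eventually_gt_atTop 0] with N hN
  exact tsub_le_iff_right.2 (hb N hN)
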